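/- Let $0<q<1$ and let $\Theta=(\theta_{i,j})_{1\le i,j\le 3}$ be complex numbers with $|\theta_{i,j}|=1$, $\theta_{i,i}=1$, $\theta_{j,i}=\overline{\theta_{i,j}}$. Write $\gamma=\theta_{2,1}$, $\lambda=\theta_{3,1}$, $\varsigma=\theta_{3,2}$. For increasing $I=(i_1,\dots,i_r)$, $J=(j_1,\dots,j_r)$ put $$[D^I_J]=\sum_{\sigma\in S_r}\Big(\prod_{x<y,\ \sigma(x)>\sigma(y)}(-q\,\theta_{i_{\sigma(y)},i_{\sigma(x)}})\Big)V_{i_{\sigma(1)},j_1}\cdots V_{i_{\sigma(r)},j_r},$$ $Det_q=[D^{123}_{123}]$, $M_{k,i}=[D^{\{1,2,3\}\setminus k}_{\{1,2,3\}\setminus i}]$, $\kappa_k=\prod_{j>k}\theta_{j,k}$. Let $C(U_{q,\Theta}(3))$ be the universal unital C*-algebra generated by $V_{i,j}$ ($1\le i,j\le 3$) and $\mathscr D^{-1}$ with the relations $$V_{i,j}V_{i,l}=q\theta_{l,j}V_{i,l}V_{i,j}\ (j<l),\qquad V_{i,j}V_{k,j}=q\theta_{i,k}V_{k,j}V_{i,j}\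 (i<k),$$ $$\theta_{l,j}V_{i,l}V_{k,j}=\theta_{i,k}V_{k,j}V_{i,l},\qquad \theta_{j,l}V_{i,j}V_{k,l}-\theta_{i,k}V_{k,l}V_{i,j}=(q-q^{-1})V_{i,l}V_{k,j}\qquad(i<k,\ j<l),$$ $$Det_q\,\mathscr D^{-1}=1,\qquad V_{i,k}\mathscr D^{-1}=\frac{\prod_{j\ne k}\theta_{k,j}}{\prod_{j\ne i}\theta_{i,j}}\,\mathscr D^{-1}V_{i,k},\qquad V_{k,i}^*=\frac{\kappa_i}{\kappa_k}(-q)^{i-k}\mathscr D^{-1}M_{k,i},\qquad (\mathscr D^{-1})^*=Det_q .$$ Write $a,b,c;\,d,e,f;\,g,h,k$ for the images under a representation of the rows of $(V_{i,j})$, and $D$ for the image of $Det_q$. On $\ell^2(\mathbb N)$, $\mathbb N=\{0,1,2,\dots\}$, let $Se_n=e_{n-1}$ ($Se_0=0$), $q^Ne_n=q^ne_n$, $z^Ne_n=z^ne_n$, $q^{N+1}e_n=q^{n+1}e_n$, and put $A=S\sqrt{1-q^{2N}}$, so $A^*=\sqrt{1-q^{2N}}S^*$. Let $\mathbb T_{a_1,a_2,a_3}(3)$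 be the noncommutative torus, that is, the universal unital C*-algebra generated by unitaries $W,X,Y$ with $WX=a_1XW$, $WY=a_2YW$, $XY=a_3YX$. The family $\mathscr R$ consists of the following, where in each case $\rho$ runs through the irreducible representations, on Hilbert spaces $\mathbb K$, of the indicated torus, and $W,X,Y$ below stand for $\rho(W),\rho(X),\rho(Y)$. Generators not listed go to $0$. * $\chi_{(\mu_1,\mu_2,\mu_3)}$ on $\mathbb C$, $|\mu_i|=1$: $a\mapsto\mu_1$, $e\mapsto\mu_2/\mu_1$, $k\mapsto\mu_3/\mu_2$, $D\mapsto\mu_3$. * $\psi_{s_1,\rho}$ on $\ell^2(\mathbb N)\otimes\mathbb K$, torus $\mathbb T_{\lambda\bar\varsigma,\gamma^2,1}(3)$: $a\mapsto A\otimes1$, $b\mapsto-q^{N+1}\gamma^{N+1}\otimes W^*Y$, $d\mapsto q^N\bar\gamma^N\otimes W$, $e\mapsto A^*\otimes Y$, $k\mapsto1\otimes X$, $D\mapsto1\otimes XY$. * $\psi_{s_2,\rho}$ on $\ell^2(\mathbb N)\otimes\mathbb K$, torus $\mathbb T_{\gamma\bar\lambda,1,\varsigma^2}(3)$: $a\mapsto1\otimes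 W$, $e\mapsto A\otimes1$, $f\mapsto-q^{N+1}\varsigma^{N+1}\otimes X^*Y$, $h\mapsto q^N\bar\varsigma^N\otimes X$, $k\mapsto A^*\otimes Y$, $D\mapsto1\otimes YW$. * $\psi_{s_2s_1,\rho}$ on $\ell^2(\mathbb N)^{\otimes2}\otimes\mathbb K$, torus $\mathbb T_{\gamma^2\lambda\bar\varsigma,\ \bar\gamma\lambda\varsigma^2,\ \varsigma\bar\gamma}(3)$: $a\mapsto1\otimes A\otimes1$, $b\mapsto(\varsigma\bar\lambda)^N\otimes(-q^{N+1}\gamma^N)\otimes X$, $d\mapsto\gamma\,A(\lambda\bar\varsigma)^N\otimes q^N\bar\gamma^N\otimes WX^*$, $e\mapsto A\otimes A^*\otimes W$, $f\mapsto-q^{N+1}\bar\varsigma^N\otimes(\lambda\bar\gamma)^N\otimes Y$, $g\mapsto\lambda\gamma\,q^N\lambda^N\otimes q^N\bar\lambda^N\otimes WX^*Y^*$, $h\mapsto\gamma\bar\lambda\bar\varsigma\,q^N\varsigma^N\otimes A^*(\gamma\bar\lambda)^N\otimes Y^*W$, $k\mapsto A^*\otimes1\otimes1$, $D\mapsto1\otimes1\otimes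 W$. * $\psi_{s_1s_2,\rho}$ on $\ell^2(\mathbb N)^{\otimes2}\otimes\mathbb K$, torus $\mathbb T_{\gamma\bar\varsigma,\ \gamma^2\bar\varsigma\lambda,\ \bar\gamma\varsigma^2\lambda}(3)$: $a\mapsto1\otimes A\otimes1$, $b\mapsto\bar\varsigma\lambda\gamma\,A(\bar\lambda\varsigma)^N\otimes(-q^{N+1}\gamma^N)\otimes W^*Y$, $c\mapsto\lambda\varsigma\,(-q^{N+1}\bar\lambda^N)\otimes(-q^{N+1}\lambda^N)\otimes W^*X^*Y$, $d\mapsto(\lambda\bar\varsigma)^N\otimes q^N\bar\gamma^N\otimes W$, $e\mapsto A\otimes A^*\otimes Y$, $f\mapsto\lambda\varsigma\bar\gamma\,(-q^{N+1}\bar\varsigma^N)\otimes A^*(\lambda\bar\gamma)^N\otimes X^*Y$, $h\mapsto q^N\varsigma^N\otimes(\gamma\bar\lambda)^N\otimes X$, $k\mapsto A^*\otimes1\otimes1$, $D\mapsto1\otimes1\otimes Y$. * $\psi_{s_2s_1s_2,\rho}$ on $\ell^2(\mathbb N)^{\otimes3}\otimes\mathbb K$, torus $\mathbb T_{\gamma\lambda^2\varsigma,\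 \overline{\gamma\lambda^2\varsigma},\ \bar\lambda^2}(3)$: $a\mapsto1\otimes A\otimes1\otimes1$, $b\mapsto\gamma^{2N}\otimes q^{N+1}\gamma^N\otimes A\otimes1$, $c\mapsto(\lambda\gamma)^N\otimes q^{N+1}\lambda^N\otimes q^{N+1}\varsigma^N\otimes X$, $d\mapsto A\otimes q^N\bar\gamma^N\otimes1\otimes1$, $g\mapsto q^N\bar\varsigma^N\otimes q^N\bar\lambda^N\otimes(\bar\gamma\bar\lambda)^N\otimes Y$, $D\mapsto(\gamma^2\lambda\bar\varsigma)^N\otimes1\otimes(\bar\gamma^2\bar\lambda\varsigma)^N\otimes W$, $e\mapsto-\bar\gamma\,A\gamma^{2N}\otimes A^*\otimes A\otimes1-q\lambda\,(q\gamma)^N\otimes1\otimes(q\bar\gamma)^N\otimes X^*Y^*W$, $f\mapsto q\lambda\varsigma\,(q\lambda)^N\otimes(\lambda\bar\gamma)^N\otimes A^*(\bar\gamma\varsigma)^N\otimes Y^*W-q\bar\gamma\,A(\lambda\gamma)^N\otimes A^*(\lambda\bar\gamma)^N\otimes(q\varsigma)^N\otimes X$, $h\mapsto\bar\lambda\bar\varsigma\,A^*(\gamma\bar\varsigma)^N\otimes(\gamma\bar\lambda)^N\otimes(q\bar\gamma^2\bar\lambda)^N\otimes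 X^*W-\gamma\,(q\gamma^2\bar\varsigma)^N\otimes A^*(\gamma\bar\lambda)^N\otimes A(\bar\gamma\bar\lambda)^N\otimes Y$, $k\mapsto-\bar\gamma\,A^*(\lambda\bar\varsigma)^N\otimes1\otimes A^*(\bar\gamma^2\bar\lambda\varsigma)^N\otimes W-q\lambda\,(q\gamma\lambda\bar\varsigma)^N\otimes A^*\otimes(q\bar\gamma\bar\lambda\varsigma)^N\otimes XY$. **Theorem.** Each of these assignments extends to a unique *-representation of $C(U_{q,\Theta}(3))$, and this representation is irreducible. The representations in $\mathscr R$ are pairwise unitarily inequivalent: $\chi_\mu\not\simeq\chi_{\mu'}$ for $\mu\ne\mu'$; no $\chi_\mu$ is equivalent to a $\psi_{w,\rho}$; $\psi_{w,\rho}\not\simeq\psi_{w',\rho'}$ for $w\ne w'$; and $\psi_{w,\rho}\not\simeq\psi_{w,\rho'}$ if $\rho$ and $\rho'$ are inequivalent. -/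

import Mathlib

open scoped ENNReal ComplexConjugate

universe u

/-! ### Universal C*-algebras given by generators and relations -/

/-- Generators `G` together with relations, imposed on `G`-tuples in unital C*-algebras, that bound
the norms of the generators (so that the universal C*-algebra exists). -/
structure CStarPresentation (G : Type) where
  Rel : ∀ {B : Type u} [CStarAlgebra B], (G → B) → Prop
  bound : G → ℝ
  norm_le : ∀ {B : Type u} [CStarAlgebra B] [Nontrivial B] (t : G → B), Rel t →
    ∀ g, ‖t g‖ ≤ bound g

namespace CStarPresentation

variable {G : Type} (P : CStarPresentation.{u} G)

/-- A nonzero unital C*-algebra with a tuple of elements satisfying the relations. -/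
structure Model where
  carrier : Type u
  [cstar : CStarAlgebra carrier]
  [nontriv : Nontrivial carrier]
  val : G → carrier
  rel : P.Rel val

attribute [instance] Model.cstar Model.nontriv

/-- The C*-algebra of bounded families indexed by all models. -/
abbrev Product : Type (u + 1) := lp (fun M : P.Model => M.carrier) ∞

noncomputable instance : CStarAlgebra P.Product where

/-- The family consisting of the values of the generator `g` in all models. -/
def gen₀ (g : G) : P.Product :=
  ⟨fun M => M.val g, memℓp_infty ⟨P.bound g, by
    rintro _ ⟨M, rfl⟩
    exact P.norm_le M.val M.rel g⟩⟩

/-- The universal unital C*-algebra of the presentation: the C*-subalgebra of the product over all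
models that is generated by the tautological families. -/
def CStarAlg : Type (u + 1) :=
  (StarAlgebra.adjoin ℂ (Set.range P.gen₀)).topologicalClosure

noncomputable instance : CStarAlgebra P.CStarAlg :=
  letI S := (StarAlgebra.adjoin ℂ (Set.range P.gen₀)).topologicalClosure
  haveI : CompleteSpace S :=
    (StarSubalgebra.isClosed_topologicalClosure _).completeSpace_coe
  { (inferInstance : NormedRing S), (inferInstance : StarRing S),
    (inferInstance : NormedAlgebra ℂ S), (inferInstance : CStarRing S),
    (inferInstance : StarModule ℂ S) with
    toCompleteSpace := this }

/-- The generators of the universal C*-algebra. -/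
def gen (g : G) : P.CStarAlg :=
  ⟨P.gen₀ g, StarSubalgebra.le_topologicalClosure _ (StarAlgebra.subset_adjoin ℂ _ ⟨g, rfl⟩)⟩

end CStarPresentation

/-! ### Representations on Hilbert spaces -/

/-- A *-representation is irreducible if its space is nonzero and has no closed invariant subspaces
other than `0` and the whole space. -/
def IsIrreducibleRep {A : Type*} [CStarAlgebra A] {H : Type*} [NormedAddCommGroup H]
    [InnerProductSpace ℂ H] [CompleteSpace H] (π : A →⋆ₐ[ℂ] (H →L[ℂ] H)) : Prop :=
  Nontrivial H ∧ ∀ S : Submodule ℂ H, IsClosed (S : Set H) →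
    (∀ a, ∀ ξ ∈ S, π a ξ ∈ S) → S = ⊥ ∨ S = ⊤

/-- Unitary equivalence of *-representations. -/
def IsEquivalentRep {A : Type*} [CStarAlgebra A]
    {H : Type*} [NormedAddCommGroup H] [InnerProductSpace ℂ H] [CompleteSpace H]
    {H' : Type*} [NormedAddCommGroup H'] [InnerProductSpace ℂ H'] [CompleteSpace H']
    (π : A →⋆ₐ[ℂ] (H →L[ℂ] H)) (π' : A →⋆ₐ[ℂ] (H' →L[ℂ] H')) : Prop :=
  ∃ U : H ≃ₗᵢ[ℂ] H', ∀ a ξ, U (π a ξ) = π' a (U ξ)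

/-! ### The noncommutative 3-torus -/

/-- Three unitaries `W = t 0`, `X = t 1`, `Y = t 2` with
`W X = a 0 X W`, `W Y = a 1 Y W`, `X Y = a 2 Y X`. -/
def torusPresentation (a : Fin 3 → ℂ) : CStarPresentation.{u} (Fin 3) where
  Rel t := (∀ i, star (t i) * t i = 1 ∧ t i * star (t i) = 1) ∧
    t 0 * t 1 = a 0 • (t 1 * t 0) ∧ t 0 * t 2 = a 1 • (t 2 * t 0) ∧ t 1 * t 2 = a 2 • (t 2 * t 1)
  bound _ := 1
  norm_le _ h g := (CStarRing.norm_of_mem_unitary (Unitary.mem_iff.2 (h.1 g))).le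

/-- The noncommutative torus `𝕋_a(3)` with parameters `a = (a 0, a 1, a 2)`. -/
abbrev NCTorus (a : Fin 3 → ℂ) : Type (u + 1) := (torusPresentation.{u} a).CStarAlg

namespace NCTorus

variable {a : Fin 3 → ℂ}

def W : NCTorus.{u} a := (torusPresentation a).gen 0

def X : NCTorus.{u} a := (torusPresentation a).gen 1

def Y : NCTorus.{u} a := (torusPresentation a).gen 2

end NCTorus

/-! ### The C*-algebra `C(U_{q,Θ}(3))` -/

/-- The deformation parameters: `q > 0` and a matrix `Θ = (θᵢⱼ)` of complex numbers of modulus one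
with unit diagonal and `θⱼᵢ` the conjugate of `θᵢⱼ`. Rows and columns are numbered `0, 1, 2`. -/
structure UqParam where
  q : ℝ
  q_pos : 0 < q
  θ : Fin 3 → Fin 3 → ℂ
  norm_θ : ∀ i j, ‖θ i j‖ = 1
  θ_diag : ∀ i, θ i i = 1
  θ_conj : ∀ i j, conj (θ j i) = θ i j

namespace UqParam

variable (p : UqParam)

/-- The quantum minor with rows `I 0 < ⋯ < I (r-1)` and columns `J 0 < ⋯ < J (r-1)`: the sum over
`σ` of the product of the `-q θ_{I(σ y), I(σ x)}` over the inversions `x < y`, `σ x > σ y`, times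
`V_{I(σ 0), J 0} ⋯ V_{I(σ (r-1)), J (r-1)}`. -/
def qMinor {B : Type*} [Ring B] [Algebra ℂ B] (V : Fin 3 → Fin 3 → B) {r : ℕ}
    (I J : Fin r → Fin 3) : B :=
  ∑ σ : Equiv.Perm (Fin r),
    (∏ x, ∏ y, if x < y ∧ σ y < σ x then -(p.q : ℂ) * p.θ (I (σ y)) (I (σ x)) else 1) •
      (List.ofFn fun x => V (I (σ x)) (J x)).prod

/-- The quantum determinant. -/
def qDet {B : Type*} [Ring B] [Algebra ℂ B] (V : Fin 3 → Fin 3 → B) : B :=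
  p.qMinor V id id

/-- `M_{i,k}`: the quantum minor with row `i` and column `k` removed. -/
def cominor {B : Type*} [Ring B] [Algebra ℂ B] (V : Fin 3 → Fin 3 → B) (i k : Fin 3) : B :=
  p.qMinor V i.succAbove k.succAbove

/-- `κ_k = ∏_{j > k} θ_{j,k}`. -/
def κ (k : Fin 3) : ℂ := ∏ j with k < j, p.θ j k

/-- The defining relations of `C(U_{q,Θ}(3))`, for the generators `V_{i,j}` and `𝒟⁻¹ = Dinv`. -/
structure IsUqTuple {B : Type*} [CStarAlgebra B] (V : Fin 3 → Fin 3 → B) (Dinv : B) : Prop where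
  row : ∀ i j l, j < l → V i j * V i l = ((p.q : ℂ) * p.θ l j) • (V i l * V i j)
  col : ∀ i k j, i < k → V i j * V k j = ((p.q : ℂ) * p.θ i k) • (V k j * V i j)
  anti : ∀ i k j l, i < k → j < l →
    p.θ l j • (V i l * V k j) = p.θ i k • (V k j * V i l)
  diag : ∀ i k j l, i < k → j < l →
    p.θ j l • (V i j * V k l) - p.θ i k • (V k l * V i j)
      = ((p.q : ℂ) - (p.q : ℂ)⁻¹) • (V i l * V k j)
  det_mul : p.qDet V * Dinv = 1
  mul_Dinv : ∀ i k, V i k * Dinv =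
    ((∏ j ∈ {k}ᶜ, p.θ k j) / (∏ j ∈ {i}ᶜ, p.θ i j)) • (Dinv * V i k)
  star_V : ∀ k i, star (V k i) =
    (p.κ i / p.κ k * (-(p.q : ℂ)) ^ ((i : ℤ) - (k : ℤ))) • (Dinv * p.cominor V k i)
  star_Dinv : star Dinv = p.qDet V

section bound

variable {B : Type*} [CStarAlgebra B] {V : Fin 3 → Fin 3 → B} {Dinv : B}

theorem θ_mul (i j : Fin 3) : p.θ i j * p.θ j i = 1 := by
  rw [← p.θ_conj j i, Complex.mul_conj', p.norm_θ]; simp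

theorem θ_ne_zero (i j : Fin 3) : p.θ i j ≠ 0 := left_ne_zero_of_mul_eq_one (p.θ_mul i j)

theorem qDet_eq (V : Fin 3 → Fin 3 → B) : p.qDet V =
    V 0 0 * V 1 1 * V 2 2
    + (-(p.q : ℂ) * p.θ 0 1) • (V 1 0 * V 0 1 * V 2 2)
    + (-(p.q : ℂ) * p.θ 1 2) • (V 0 0 * V 2 1 * V 1 2)
    + ((p.q : ℂ) ^ 2 * p.θ 0 1 * p.θ 0 2) • (V 1 0 * V 2 1 * V 0 2)
    + ((p.q : ℂ) ^ 2 * p.θ 0 2 * p.θ 1 2) • (V 2 0 * V 0 1 * V 1 2)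
    + (-(p.q : ℂ) ^ 3 * p.θ 0 1 * p.θ 0 2 * p.θ 1 2) • (V 2 0 * V 1 1 * V 0 2) := by
  have h : (Finset.univ : Finset (Equiv.Perm (Fin 3))) =
      {1, Equiv.swap 0 1, Equiv.swap 1 2, Equiv.swap 0 1 * Equiv.swap 1 2,
        Equiv.swap 1 2 * Equiv.swap 0 1, Equiv.swap 0 2} := by decide
  rw [qDet, qMinor, h, Finset.sum_insert (by decide), Finset.sum_insert (by decide),
    Finset.sum_insert (by decide), Finset.sum_insert (by decide), Finset.sum_insert (by decide),
    Finset.sum_singleton]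
  simp [Fin.prod_univ_three, List.ofFn_succ, Equiv.swap_apply_def, mul_assoc]
  match_scalars <;> ring

theorem cominor_eq (V : Fin 3 → Fin 3 → B) (i k : Fin 3) : p.cominor V i k =
    V (i.succAbove 0) (k.succAbove 0) * V (i.succAbove 1) (k.succAbove 1)
    - ((p.q : ℂ) * p.θ (i.succAbove 0) (i.succAbove 1)) •
      (V (i.succAbove 1) (k.succAbove 0) * V (i.succAbove 0) (k.succAbove 1)) := by
  have h : (Finset.univ : Finset (Equiv.Perm (Fin 2))) = {1, Equiv.swap 0 1} := by decide
  rw [cominor, qMinor, h, Finset.sum_insert (by decide), Finset.sum_singleton]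
  simp [Fin.prod_univ_two, List.ofFn_succ, sub_eq_add_neg]

namespace IsUqTuple

variable {p}

theorem swap_lt (h : p.IsUqTuple V Dinv) {a b j l : Fin 3} (hab : a < b) (hjl : j < l) :
    V b l * V a j = (p.θ b a * p.θ j l) • (V a j * V b l)
      - (((p.q : ℂ) - (p.q : ℂ)⁻¹) * p.θ j l) • (V b j * V a l) := by
  have h1 := h.diag a b j l hab hjl
  have h2 := h.anti a b j l hab hjl
  have e1 := p.θ_mul a b
  have e2 := p.θ_mul j l
  have h3 : V a l * V b j = (p.θ j l * p.θ a b) • (V b j * V a l) := by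
    have := congrArg (p.θ j l • ·) h2
    simpa only [smul_smul, e2, one_smul] using this
  have h4 : V b l * V a j = (p.θ b a * p.θ a b) • (V b l * V a j) := by
    rw [mul_comm, e1, one_smul]
  rw [h3] at h1
  have h5 : p.θ a b • (V b l * V a j) = p.θ j l • (V a j * V b l) -
      ((p.q : ℂ) - (p.q : ℂ)⁻¹) • (p.θ j l * p.θ a b) • (V b j * V a l) := by
    rw [← h1]; abel
  rw [h4, mul_smul, h5, smul_sub, smul_smul, smul_smul, smul_smul]
  congr 2
  linear_combination (((p.q : ℂ) - (p.q : ℂ)⁻¹) * p.θ j l) * e1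

theorem swap_gt (h : p.IsUqTuple V Dinv) {a b j l : Fin 3} (hab : b < a) (hjl : j < l) :
    V b l * V a j = (p.θ b a * p.θ j l) • (V a j * V b l) := by
  have := congrArg (p.θ j l • ·) (h.anti b a j l hab hjl)
  simp only [smul_smul, p.θ_mul, one_smul] at this
  rw [this, mul_comm]

theorem Dinv_mul_det (h : p.IsUqTuple V Dinv) : Dinv * p.qDet V = 1 := by
  rw [← h.det_mul, qDet_eq]
  have hd : ∀ i, (∏ j ∈ ({i}ᶜ : Finset (Fin 3)), p.θ i j) ≠ 0 := fun i =>
    Finset.prod_ne_zero_iff.2 fun j _ => p.θ_ne_zero i j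
  have h0 := hd 0
  have h1 := hd 1
  have h2 := hd 2
  have key : ∀ a b c : Fin 3, V a 0 * V b 1 * V c 2 * Dinv =
      (((∏ j ∈ {0}ᶜ, p.θ 0 j) / (∏ j ∈ {a}ᶜ, p.θ a j)) *
        ((∏ j ∈ {1}ᶜ, p.θ 1 j) / (∏ j ∈ {b}ᶜ, p.θ b j)) *
        ((∏ j ∈ {2}ᶜ, p.θ 2 j) / (∏ j ∈ {c}ᶜ, p.θ c j))) •
        (Dinv * (V a 0 * V b 1 * V c 2)) := by
    intro a b c
    rw [mul_assoc, h.mul_Dinv c 2, mul_smul_comm, ← mul_assoc, mul_assoc (V a 0), h.mul_Dinv b 1,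
      mul_smul_comm, smul_mul_assoc, ← mul_assoc, h.mul_Dinv a 0]
    simp only [smul_mul_assoc, smul_smul, mul_assoc]
    congr 1
    ring
  simp only [mul_add, add_mul, mul_smul_comm, smul_mul_assoc, key]
  match_scalars <;> field_simp

theorem sum_star_mul_self (h : p.IsUqTuple V Dinv) (j : Fin 3) :
    ∑ k, star (V k j) * V k j = 1 := by
  have hq : (p.q : ℂ) ≠ 0 := by exact_mod_cast p.q_pos.ne'
  have t01 := p.θ_ne_zero 0 1
  have t02 := p.θ_ne_zero 0 2
  have t12 := p.θ_ne_zero 1 2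
  have e01 : p.θ 1 0 = (p.θ 0 1)⁻¹ := eq_inv_of_mul_eq_one_left (p.θ_mul 1 0)
  have e02 : p.θ 2 0 = (p.θ 0 2)⁻¹ := eq_inv_of_mul_eq_one_left (p.θ_mul 2 0)
  have e12 : p.θ 2 1 = (p.θ 1 2)⁻¹ := eq_inv_of_mul_eq_one_left (p.θ_mul 2 1)
  have k0 : p.κ 0 = p.θ 1 0 * p.θ 2 0 := by
    rw [κ, show ({j | 0 < j} : Finset (Fin 3)) = {1, 2} by decide]; simp
  have k1 : p.κ 1 = p.θ 2 1 := by
    rw [κ, show ({j | 1 < j} : Finset (Fin 3)) = {2} by decide]; simp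
  have k2 : p.κ 2 = 1 := by
    rw [κ, show ({j | 2 < j} : Finset (Fin 3)) = ∅ by decide]; simp
  have main : ∑ k, (p.κ j / p.κ k * (-(p.q : ℂ)) ^ ((j : ℤ) - (k : ℤ))) •
      (p.cominor V k j * V k j) = p.qDet V := by
    have s1 : ∀ {a b j l : Fin 3}, a < b → j < l → ∀ Z, V b l * (V a j * Z) =
        (p.θ b a * p.θ j l) • (V a j * (V b l * Z))
        - (((p.q : ℂ) - (p.q : ℂ)⁻¹) * p.θ j l) • (V b j * (V a l * Z)) := by
      intro a b j l hab hjl Z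
      rw [← mul_assoc, h.swap_lt hab hjl, sub_mul, smul_mul_assoc, smul_mul_assoc, mul_assoc,
        mul_assoc]
    have s2 : ∀ {a b j l : Fin 3}, b < a → j < l → ∀ Z, V b l * (V a j * Z) =
        (p.θ b a * p.θ j l) • (V a j * (V b l * Z)) := by
      intro a b j l hab hjl Z
      rw [← mul_assoc, h.swap_gt hab hjl, smul_mul_assoc, mul_assoc]
    have l01 : (0 : Fin 3) < 1 := by decide
    have l02 : (0 : Fin 3) < 2 := by decide
    have l12 : (1 : Fin 3) < 2 := by decide
    have r : ∀ {j l : Fin 3}, j < l →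
        (V 1 l * V 0 j = _ ∧ V 2 l * V 0 j = _ ∧ V 2 l * V 1 j = _) ∧
        (V 0 l * V 1 j = _ ∧ V 0 l * V 2 j = _ ∧ V 1 l * V 2 j = _) := fun hjl =>
      ⟨⟨h.swap_lt l01 hjl, h.swap_lt l02 hjl, h.swap_lt l12 hjl⟩,
        h.swap_gt l01 hjl, h.swap_gt l02 hjl, h.swap_gt l12 hjl⟩
    have r' : ∀ {j l : Fin 3}, j < l → ∀ Z,
        (V 1 l * (V 0 j * Z) = _ ∧ V 2 l * (V 0 j * Z) = _ ∧ V 2 l * (V 1 j * Z) = _) ∧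
        (V 0 l * (V 1 j * Z) = _ ∧ V 0 l * (V 2 j * Z) = _ ∧ V 1 l * (V 2 j * Z) = _) :=
      fun hjl Z => ⟨⟨s1 l01 hjl Z, s1 l02 hjl Z, s1 l12 hjl Z⟩,
        s2 l01 hjl Z, s2 l02 hjl Z, s2 l12 hjl Z⟩
    have a00 : (0 : Fin 3).succAbove (0 : Fin 2) = 1 := rfl
    have a01 : (0 : Fin 3).succAbove (1 : Fin 2) = 2 := rfl
    have a10 : (1 : Fin 3).succAbove (0 : Fin 2) = 0 := rfl
    have a11 : (1 : Fin 3).succAbove (1 : Fin 2) = 2 := rfl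
    have a20 : (2 : Fin 3).succAbove (0 : Fin 2) = 0 := rfl
    have a21 : (2 : Fin 3).succAbove (1 : Fin 2) = 1 := rfl
    rw [Fin.sum_univ_three, p.qDet_eq]
    simp only [p.cominor_eq, a00, a01, a10, a11, a20, a21]
    fin_cases j <;>
    simp [a00, a01, a10, a11, a20, a21, mul_assoc, sub_mul, mul_sub,
      r l02, r l12, r' l01, k0, k1, k2, e01, e02, e12] <;>
    match_scalars <;> field_simp <;> ring
  rw [← h.Dinv_mul_det, ← main, Finset.mul_sum]
  refine Finset.sum_congr rfl fun k _ => ?_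
  rw [h.star_V, smul_mul_assoc, mul_smul_comm, mul_assoc]

theorem norm_le_one [Nontrivial B] (h : p.IsUqTuple V Dinv) (i j : Fin 3) : ‖V i j‖ ≤ 1 := by
  let _ := CStarAlgebra.spectralOrder B
  have _ := CStarAlgebra.spectralOrderedRing B
  have h1 : star (V i j) * V i j ≤ 1 := by
    rw [← h.sum_star_mul_self j]
    exact Finset.single_le_sum (f := fun k => star (V k j) * V k j)
      (fun k _ => star_mul_self_nonneg _) (Finset.mem_univ i)
  have h2 := CStarAlgebra.norm_le_norm_of_nonneg_of_le (star_mul_self_nonneg _) h1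
  rw [CStarRing.norm_star_mul_self] at h2
  have h3 : ‖(1 : B)‖ = 1 := norm_one
  nlinarith [norm_nonneg (V i j)]

end IsUqTuple

theorem IsUqTuple.norm_Dinv_le_one [Nontrivial B] (h : p.IsUqTuple V Dinv) : ‖Dinv‖ ≤ 1 := by
  have h1 := CStarRing.norm_star_mul_self (x := Dinv)
  rw [h.star_Dinv, h.det_mul, norm_one] at h1
  nlinarith [norm_nonneg Dinv]

end bound

end UqParam

/-- The generators `V_{i,j}` and `𝒟⁻¹`. -/
inductive UqGen : Type
  | V (i j : Fin 3)
  | Dinv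

namespace UqParam

variable (p : UqParam)

def uqPresentation : CStarPresentation.{u} UqGen where
  Rel t := p.IsUqTuple (fun i j => t (.V i j)) (t .Dinv)
  bound _ := 1
  norm_le _ h g := match g with
    | .V i j => h.norm_le_one i j
    | .Dinv => h.norm_Dinv_le_one p

/-- The universal C*-algebra `C(U_{q,Θ}(3))`. -/
abbrev CU : Type (u + 1) := p.uqPresentation.{u}.CStarAlg

/-- The generator `V_{i,j}` of `C(U_{q,Θ}(3))`. -/
def V (i j : Fin 3) : CU.{u} p := p.uqPresentation.gen (.V i j)

/-- The quantum determinant in `C(U_{q,Θ}(3))`. -/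
noncomputable def D : CU.{u} p := p.qDet p.V

/-! ### The family of representations -/

abbrev γ : ℂ := p.θ 1 0

abbrev lam : ℂ := p.θ 2 0

abbrev ς : ℂ := p.θ 2 1

/-- The weight `√(1 - q^{2n})` as a complex number. -/
noncomputable def r (n : ℕ) : ℂ := (√(1 - p.q ^ (2 * n)) : ℝ)

end UqParam

/-- The Hilbert space `ℓ²(ℕ) ⊗ ⋯ ⊗ ℓ²(ℕ) ⊗ K` with `k` factors `ℓ²(ℕ)`, realised as the space of
square-summable `K`-valued families on `ℕᵏ`. -/
abbrev L2 (k : ℕ) (K : Type u) [NormedAddCommGroup K] : Type u := lp (fun _ : Fin k → ℕ => K) 2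

/-- The vector `e_{n 0} ⊗ ⋯ ⊗ e_{n (k-1)} ⊗ x`. -/
noncomputable def δ {k : ℕ} {K : Type u} [NormedAddCommGroup K] (n : Fin k → ℕ) (x : K) : L2 k K :=
  lp.single 2 n x

/-- The labels of the infinite-dimensional series `ψ_{s₁}`, `ψ_{s₂}`, `ψ_{s₂s₁}`, `ψ_{s₁s₂}`,
`ψ_{s₂s₁s₂}`. -/
inductive Series : Type
  | s₁
  | s₂
  | s₂s₁
  | s₁s₂
  | s₂s₁s₂

/-- The number of factors `ℓ²(ℕ)`. -/
def Series.length : Series → ℕ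
  | s₁ => 1
  | s₂ => 1
  | s₂s₁ => 2
  | s₁s₂ => 2
  | s₂s₁s₂ => 3

namespace UqParam

open NCTorus

variable (p : UqParam)

/-- The parameters of the noncommutative torus attached to each series. -/
noncomputable def torusParam : Series → Fin 3 → ℂ
  | .s₁ => ![p.lam * conj p.ς, p.γ ^ 2, 1]
  | .s₂ => ![p.γ * conj p.lam, 1, p.ς ^ 2]
  | .s₂s₁ => ![p.γ ^ 2 * p.lam * conj p.ς, conj p.γ * p.lam * p.ς ^ 2, p.ς * conj p.γ]
  | .s₁s₂ => ![p.γ * conj p.ς, p.γ ^ 2 * conj p.ς * p.lam, conj p.γ * p.ς ^ 2 * p.lam]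
  | .s₂s₁s₂ => ![p.γ * p.lam ^ 2 * p.ς, conj (p.γ * p.lam ^ 2 * p.ς), conj p.lam ^ 2]

/-- `π` is the one-dimensional representation `χ_{(μ₁,μ₂,μ₃)}`, with `μᵢ = μ (i-1)`. -/
structure IsChi (μ : Fin 3 → Circle) (π : CU.{u} p →⋆ₐ[ℂ] (ℂ →L[ℂ] ℂ)) : Prop where
  a : π (p.V 0 0) = (μ 0 : ℂ) • 1
  e : π (p.V 1 1) = ((μ 1 : ℂ) / μ 0) • 1
  k : π (p.V 2 2) = ((μ 2 : ℂ) / μ 1) • 1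
  D : π p.D = (μ 2 : ℂ) • 1
  off_diag : ∀ i j, i ≠ j → π (p.V i j) = 0

section psi

variable {K : Type u} [NormedAddCommGroup K] [InnerProductSpace ℂ K] [CompleteSpace K]

/-! In the following structures, `a, b, c`, `d, e, f`, `g, h, k` are the images of the rows of
`(V_{i,j})` and `D` is the image of the quantum determinant; the operators are given by their values
on the vectors `e_m ⊗ e_n ⊗ e_l ⊗ x`. The operator `S √(1 - q^{2N})` sends `e_n` to
`√(1 - q^{2n}) e_{n-1}`, which is `0` for `n = 0`. -/

/-- `π = ψ_{s₁,ρ}`. -/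
structure IsPsiS₁ (ρ : NCTorus.{u} (p.torusParam .s₁) →⋆ₐ[ℂ] (K →L[ℂ] K))
    (π : CU.{u} p →⋆ₐ[ℂ] (L2 1 K →L[ℂ] L2 1 K)) : Prop where
  a : ∀ n x, π (p.V 0 0) (δ ![n] x) = p.r n • δ ![n - 1] x
  b : ∀ n x, π (p.V 0 1) (δ ![n] x) =
    (-(p.q : ℂ) ^ (n + 1) * p.γ ^ (n + 1)) • δ ![n] (ρ (star W * Y) x)
  c : π (p.V 0 2) = 0
  d : ∀ n x, π (p.V 1 0) (δ ![n] x) = ((p.q : ℂ) ^ n * conj p.γ ^ n) • δ ![n] (ρ W x)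
  e : ∀ n x, π (p.V 1 1) (δ ![n] x) = p.r (n + 1) • δ ![n + 1] (ρ Y x)
  f : π (p.V 1 2) = 0
  g : π (p.V 2 0) = 0
  h : π (p.V 2 1) = 0
  k : ∀ n x, π (p.V 2 2) (δ ![n] x) = δ ![n] (ρ X x)
  D : ∀ n x, π p.D (δ ![n] x) = δ ![n] (ρ (X * Y) x)

/-- `π = ψ_{s₂,ρ}`. -/
structure IsPsiS₂ (ρ : NCTorus.{u} (p.torusParam .s₂) →⋆ₐ[ℂ] (K →L[ℂ] K))
    (π : CU.{u} p →⋆ₐ[ℂ] (L2 1 K →L[ℂ] L2 1 K)) : Prop where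
  a : ∀ n x, π (p.V 0 0) (δ ![n] x) = δ ![n] (ρ W x)
  b : π (p.V 0 1) = 0
  c : π (p.V 0 2) = 0
  d : π (p.V 1 0) = 0
  e : ∀ n x, π (p.V 1 1) (δ ![n] x) = p.r n • δ ![n - 1] x
  f : ∀ n x, π (p.V 1 2) (δ ![n] x) =
    (-(p.q : ℂ) ^ (n + 1) * p.ς ^ (n + 1)) • δ ![n] (ρ (star X * Y) x)
  g : π (p.V 2 0) = 0
  h : ∀ n x, π (p.V 2 1) (δ ![n] x) = ((p.q : ℂ) ^ n * conj p.ς ^ n) • δ ![n] (ρ X x)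
  k : ∀ n x, π (p.V 2 2) (δ ![n] x) = p.r (n + 1) • δ ![n + 1] (ρ Y x)
  D : ∀ n x, π p.D (δ ![n] x) = δ ![n] (ρ (Y * W) x)

/-- `π = ψ_{s₂s₁,ρ}`. -/
structure IsPsiS₂S₁ (ρ : NCTorus.{u} (p.torusParam .s₂s₁) →⋆ₐ[ℂ] (K →L[ℂ] K))
    (π : CU.{u} p →⋆ₐ[ℂ] (L2 2 K →L[ℂ] L2 2 K)) : Prop where
  a : ∀ m n x, π (p.V 0 0) (δ ![m, n] x) = p.r n • δ ![m, n - 1] x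
  b : ∀ m n x, π (p.V 0 1) (δ ![m, n] x) =
    ((p.ς * conj p.lam) ^ m * (-(p.q : ℂ) ^ (n + 1) * p.γ ^ n)) • δ ![m, n] (ρ X x)
  c : π (p.V 0 2) = 0
  d : ∀ m n x, π (p.V 1 0) (δ ![m, n] x) =
    (p.γ * (p.r m * p.lam ^ m * conj p.ς ^ m) * ((p.q : ℂ) ^ n * conj p.γ ^ n)) •
      δ ![m - 1, n] (ρ (W * star X) x)
  e : ∀ m n x, π (p.V 1 1) (δ ![m, n] x) = (p.r m * p.r (n + 1)) • δ ![m - 1, n + 1] (ρ W x)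
  f : ∀ m n x, π (p.V 1 2) (δ ![m, n] x) =
    ((-(p.q : ℂ) ^ (m + 1) * conj p.ς ^ m) * (p.lam ^ n * conj p.γ ^ n)) • δ ![m, n] (ρ Y x)
  g : ∀ m n x, π (p.V 2 0) (δ ![m, n] x) =
    (p.lam * p.γ * ((p.q : ℂ) ^ m * p.lam ^ m) * ((p.q : ℂ) ^ n * conj p.lam ^ n)) •
      δ ![m, n] (ρ (W * star X * star Y) x)
  h : ∀ m n x, π (p.V 2 1) (δ ![m, n] x) =
    (p.γ * conj p.lam * conj p.ς * ((p.q : ℂ) ^ m * p.ς ^ m) *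
      (p.r (n + 1) * p.γ ^ n * conj p.lam ^ n)) • δ ![m, n + 1] (ρ (star Y * W) x)
  k : ∀ m n x, π (p.V 2 2) (δ ![m, n] x) = p.r (m + 1) • δ ![m + 1, n] x
  D : ∀ m n x, π p.D (δ ![m, n] x) = δ ![m, n] (ρ W x)

/-- `π = ψ_{s₁s₂,ρ}`. -/
structure IsPsiS₁S₂ (ρ : NCTorus.{u} (p.torusParam .s₁s₂) →⋆ₐ[ℂ] (K →L[ℂ] K))
    (π : CU.{u} p →⋆ₐ[ℂ] (L2 2 K →L[ℂ] L2 2 K)) : Prop where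
  a : ∀ m n x, π (p.V 0 0) (δ ![m, n] x) = p.r n • δ ![m, n - 1] x
  b : ∀ m n x, π (p.V 0 1) (δ ![m, n] x) =
    (conj p.ς * p.lam * p.γ * (p.r m * (conj p.lam * p.ς) ^ m) *
      (-(p.q : ℂ) ^ (n + 1) * p.γ ^ n)) • δ ![m - 1, n] (ρ (star W * Y) x)
  c : ∀ m n x, π (p.V 0 2) (δ ![m, n] x) =
    (p.lam * p.ς * (-(p.q : ℂ) ^ (m + 1) * conj p.lam ^ m) * (-(p.q : ℂ) ^ (n + 1) * p.lam ^ n)) •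
      δ ![m, n] (ρ (star W * star X * Y) x)
  d : ∀ m n x, π (p.V 1 0) (δ ![m, n] x) =
    ((p.lam * conj p.ς) ^ m * ((p.q : ℂ) ^ n * conj p.γ ^ n)) • δ ![m, n] (ρ W x)
  e : ∀ m n x, π (p.V 1 1) (δ ![m, n] x) = (p.r m * p.r (n + 1)) • δ ![m - 1, n + 1] (ρ Y x)
  f : ∀ m n x, π (p.V 1 2) (δ ![m, n] x) =
    (p.lam * p.ς * conj p.γ * (-(p.q : ℂ) ^ (m + 1) * conj p.ς ^ m) *
      (p.r (n + 1) * p.lam ^ n * conj p.γ ^ n)) • δ ![m, n + 1] (ρ (star X * Y) x)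
  g : π (p.V 2 0) = 0
  h : ∀ m n x, π (p.V 2 1) (δ ![m, n] x) =
    ((p.q : ℂ) ^ m * p.ς ^ m * (p.γ ^ n * conj p.lam ^ n)) • δ ![m, n] (ρ X x)
  k : ∀ m n x, π (p.V 2 2) (δ ![m, n] x) = p.r (m + 1) • δ ![m + 1, n] x
  D : ∀ m n x, π p.D (δ ![m, n] x) = δ ![m, n] (ρ Y x)

/-- `π = ψ_{s₂s₁s₂,ρ}`. -/
structure IsPsiS₂S₁S₂ (ρ : NCTorus.{u} (p.torusParam .s₂s₁s₂) →⋆ₐ[ℂ] (K →L[ℂ] K))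
    (π : CU.{u} p →⋆ₐ[ℂ] (L2 3 K →L[ℂ] L2 3 K)) : Prop where
  a : ∀ m n l x, π (p.V 0 0) (δ ![m, n, l] x) = p.r n • δ ![m, n - 1, l] x
  b : ∀ m n l x, π (p.V 0 1) (δ ![m, n, l] x) =
    (p.γ ^ (2 * m) * ((p.q : ℂ) ^ (n + 1) * p.γ ^ n) * p.r l) • δ ![m, n, l - 1] x
  c : ∀ m n l x, π (p.V 0 2) (δ ![m, n, l] x) =
    ((p.lam * p.γ) ^ m * ((p.q : ℂ) ^ (n + 1) * p.lam ^ n) * ((p.q : ℂ) ^ (l + 1) * p.ς ^ l)) •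
      δ ![m, n, l] (ρ X x)
  d : ∀ m n l x, π (p.V 1 0) (δ ![m, n, l] x) =
    (p.r m * ((p.q : ℂ) ^ n * conj p.γ ^ n)) • δ ![m - 1, n, l] x
  e : ∀ m n l x, π (p.V 1 1) (δ ![m, n, l] x) =
    (-(conj p.γ * (p.r m * p.γ ^ (2 * m)) * p.r (n + 1) * p.r l)) • δ ![m - 1, n + 1, l - 1] x
    + (-(p.q * p.lam * ((p.q : ℂ) ^ m * p.γ ^ m) * ((p.q : ℂ) ^ l * conj p.γ ^ l))) •
      δ ![m, n, l] (ρ (star X * star Y * W) x)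
  f : ∀ m n l x, π (p.V 1 2) (δ ![m, n, l] x) =
    (p.q * p.lam * p.ς * ((p.q : ℂ) ^ m * p.lam ^ m) * (p.lam * conj p.γ) ^ n *
      (p.r (l + 1) * (conj p.γ * p.ς) ^ l)) • δ ![m, n, l + 1] (ρ (star Y * W) x)
    + (-(p.q * conj p.γ * (p.r m * (p.lam * p.γ) ^ m) * (p.r (n + 1) * (p.lam * conj p.γ) ^ n) *
      ((p.q : ℂ) ^ l * p.ς ^ l))) • δ ![m - 1, n + 1, l] (ρ X x)
  g : ∀ m n l x, π (p.V 2 0) (δ ![m, n, l] x) =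
    (((p.q : ℂ) ^ m * conj p.ς ^ m) * ((p.q : ℂ) ^ n * conj p.lam ^ n) *
      (conj p.γ * conj p.lam) ^ l) • δ ![m, n, l] (ρ Y x)
  h : ∀ m n l x, π (p.V 2 1) (δ ![m, n, l] x) =
    (conj p.lam * conj p.ς * (p.r (m + 1) * (p.γ * conj p.ς) ^ m) * (p.γ * conj p.lam) ^ n *
      ((p.q : ℂ) ^ l * (conj p.γ ^ 2 * conj p.lam) ^ l)) • δ ![m + 1, n, l] (ρ (star X * W) x)
    + (-(p.γ * ((p.q : ℂ) ^ m * (p.γ ^ 2 * conj p.ς) ^ m) *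
      (p.r (n + 1) * (p.γ * conj p.lam) ^ n) * (p.r l * (conj p.γ * conj p.lam) ^ l))) •
      δ ![m, n + 1, l - 1] (ρ Y x)
  k : ∀ m n l x, π (p.V 2 2) (δ ![m, n, l] x) =
    (-(conj p.γ * (p.r (m + 1) * (p.lam * conj p.ς) ^ m) *
      (p.r (l + 1) * (conj p.γ ^ 2 * conj p.lam * p.ς) ^ l))) • δ ![m + 1, n, l + 1] (ρ W x)
    + (-(p.q * p.lam * ((p.q : ℂ) ^ m * (p.γ * p.lam * conj p.ς) ^ m) * p.r (n + 1) *
      ((p.q : ℂ) ^ l * (conj p.γ * conj p.lam * p.ς) ^ l))) • δ ![m, n + 1, l] (ρ (X * Y) x)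
  D : ∀ m n l x, π p.D (δ ![m, n, l] x) =
    ((p.γ ^ 2 * p.lam * conj p.ς) ^ m * (conj p.γ ^ 2 * conj p.lam * p.ς) ^ l) •
      δ ![m, n, l] (ρ W x)

/-- `π = ψ_{w,ρ}`. -/
def IsPsi : (w : Series) → (NCTorus.{u} (p.torusParam w) →⋆ₐ[ℂ] (K →L[ℂ] K)) →
    (CU.{u} p →⋆ₐ[ℂ] (L2 w.length K →L[ℂ] L2 w.length K)) → Prop
  | .s₁, ρ, π => p.IsPsiS₁ ρ π
  | .s₂, ρ, π => p.IsPsiS₂ ρ π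
  | .s₂s₁, ρ, π => p.IsPsiS₂S₁ ρ π
  | .s₁s₂, ρ, π => p.IsPsiS₁S₂ ρ π
  | .s₂s₁s₂, ρ, π => p.IsPsiS₂S₁S₂ ρ π

end psi

end UqParam

/-!
The proof has three ingredients: a construction of the representations from the universal
property, a description of all intertwiners between them, and a comparison of the entries that
vanish.

*Existence and uniqueness.* By the universal property (`UqParam.exists_hom`, `UqParam.hom_ext`), a
representation of `C(U_{q,Θ}(3))` is the same as a `3 × 3` matrix of operators with the defining
relations. For the five infinite-dimensional series the relations are verified on the rescaled
basis vectors `UqParam.ket`, `e_n / ∏_{0 < j ≤ n} √(1 - q^{2j})`, extended by `0` to negative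
indices. On these, `A = S√(1 - q^{2N})` is the plain shift and `A*` the shift with the weight
`1 - q^{2n+2}`. Hence no square roots and no exceptional behaviour at `n = 0` remain, and once the
generators `W, X, Y` of the torus are brought into a fixed order (`TorusTriple.apply_eq`), each
relation is an identity of rational functions in `q, γ, λ, ς` and their powers. The relation for
`V_{k,i}*` is multiplied by the unitary `D`, so that it too is polynomial
(`UqParam.isUqTuple_of`).

*Intertwiners.* In each series there are elements `R i` of `C(U_{q,Θ}(3))` whose adjoints have
exactly the vacuum vectors `e_0 ⊗ x` as common kernel and which produce every `e_n ⊗ x` from the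
vacuum, by formulas that do not involve `ρ`; moreover three elements act on the vacuum as
multiples of `W, X, Y` (`IsVacuumGenerated`). An operator that intertwines two members of the same
series therefore preserves the vacuum, has the form `1 ⊗ t`, and `t` intertwines the
representations of the torus (`IsVacuumGenerated.intertwiner_apply`,
`IsVacuumGenerated.vac_intertwine`). Applied to the projection onto an invariant subspace this
gives irreducibility, and applied to a unitary equivalence it gives the equivalence of the
representations `ρ`.

*Separation of the series.* Unitary equivalence preserves the kernel of a representation. Which of
the entries `c, d, g` of the matrix vanish determines the series, and no member of a series
annihilates all of `d, h, c, g`, whereas the one-dimensional representations do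
(`UqParam.IsPsi.vanishing`).
-/

set_option linter.unusedSectionVars false
set_option linter.unusedSimpArgs false

/-! ### The universal property -/

namespace CStarPresentation

variable {G : Type} (P : CStarPresentation.{u} G)

/-- The `*`-homomorphism from the universal C*-algebra onto its component at the model `M`. -/
noncomputable def evalModel (M : P.Model) : P.CStarAlg →⋆ₐ[ℂ] M.carrier where
  toFun x := x.1.1 M
  map_one' := rfl
  map_mul' _ _ := rfl
  map_zero' := rfl
  map_add' _ _ := rfl
  commutes' _ := rfl
  map_star' _ := rfl

theorem evalModel_gen (M : P.Model) (g : G) : P.evalModel M (P.gen g) = M.val g := rfl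

variable {P}

theorem ext_evalModel {x y : P.CStarAlg} (h : ∀ M, P.evalModel M x = P.evalModel M y) : x = y :=
  Subtype.ext (Subtype.ext (funext h))

/-- A closed property of elements that is stable under the `*`-algebra operations and holds for the
generators holds everywhere. -/
theorem induction_gen {p : P.CStarAlg → Prop} (gen : ∀ g, p (P.gen g))
    (algebraMap : ∀ c : ℂ, p (algebraMap ℂ _ c)) (add : ∀ x y, p x → p y → p (x + y))
    (mul : ∀ x y, p x → p y → p (x * y)) (star : ∀ x, p x → p (star x))
    (closed : IsClosed {x | p x}) (x : P.CStarAlg) : p x := by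
  have key : ∀ (x : P.Product) (hx : x ∈ StarAlgebra.adjoin ℂ (Set.range P.gen₀)),
      p ⟨x, StarSubalgebra.le_topologicalClosure _ hx⟩ := by
    intro x hx
    induction hx using StarAlgebra.adjoin_induction with
    | mem x hx => obtain ⟨g, rfl⟩ := hx; exact gen g
    | algebraMap r => exact algebraMap r
    | add x y hx hy hpx hpy => exact add _ _ hpx hpy
    | mul x y hx hy hpx hpy => exact mul _ _ hpx hpy
    | star x hx hpx => exact star _ hpx
  have hx : x.1 ∈ closure (StarAlgebra.adjoin ℂ (Set.range P.gen₀) : Set P.Product) := x.2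
  have : x ∈ closure {y : P.CStarAlg | p y} := by
    rw [show (closure {y : P.CStarAlg | p y}) = _ from
      Topology.IsInducing.subtypeVal.closure_eq_preimage_closure_image _]
    refine closure_mono ?_ hx
    intro y hy
    exact ⟨⟨y, StarSubalgebra.le_topologicalClosure _ hy⟩, key y hy, rfl⟩
  rwa [closed.closure_eq] at this

theorem continuous_hom {A B : Type*} [CStarAlgebra A] [CStarAlgebra B] (φ : A →⋆ₐ[ℂ] B) :
    Continuous φ :=
  AddMonoidHomClass.continuous_of_bound φ 1 fun x => by
    rw [one_mul]; exact NonUnitalStarAlgHom.norm_apply_le φ x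

theorem hom_ext {B : Type*} [CStarAlgebra B] {φ ψ : P.CStarAlg →⋆ₐ[ℂ] B}
    (h : ∀ g, φ (P.gen g) = ψ (P.gen g)) : φ = ψ := by
  ext x
  refine induction_gen (p := fun x => φ x = ψ x) h ?_ ?_ ?_ ?_ ?_ x
  · intro c; rw [AlgHomClass.commutes, AlgHomClass.commutes]
  · intro x y hx hy; rw [map_add, map_add, hx, hy]
  · intro x y hx hy; rw [map_mul, map_mul, hx, hy]
  · intro x hx; rw [map_star, map_star, hx]
  · exact isClosed_eq (continuous_hom φ) (continuous_hom ψ)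

theorem exists_hom {B : Type u} [CStarAlgebra B] [Nontrivial B] {t : G → B} (ht : P.Rel t) :
    ∃ φ : P.CStarAlg →⋆ₐ[ℂ] B, ∀ g, φ (P.gen g) = t g :=
  ⟨P.evalModel ⟨B, t, ht⟩, fun _ => rfl⟩

end CStarPresentation

namespace NCTorus

variable {a : Fin 3 → ℂ}


theorem gen_unitary (i : Fin 3) :
    star ((torusPresentation.{u} a).gen i) * (torusPresentation.{u} a).gen i = 1 ∧
    (torusPresentation.{u} a).gen i * star ((torusPresentation.{u} a).gen i) = 1 := by
  constructor <;> refine CStarPresentation.ext_evalModel fun M => ?_ <;>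
    simp only [map_mul, map_star, map_one, CStarPresentation.evalModel_gen]
  exacts [(M.rel.1 i).1, (M.rel.1 i).2]

theorem W_mul_X : (W * X : NCTorus.{u} a) = a 0 • (X * W) := by
  refine CStarPresentation.ext_evalModel fun M => ?_
  simp only [map_mul, map_smul, W, X, CStarPresentation.evalModel_gen]
  exact M.rel.2.1

theorem W_mul_Y : (W * Y : NCTorus.{u} a) = a 1 • (Y * W) := by
  refine CStarPresentation.ext_evalModel fun M => ?_
  simp only [map_mul, map_smul, W, Y, CStarPresentation.evalModel_gen]
  exact M.rel.2.2.1

theorem X_mul_Y : (X * Y : NCTorus.{u} a) = a 2 • (Y * X) := by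
  refine CStarPresentation.ext_evalModel fun M => ?_
  simp only [map_mul, map_smul, X, Y, CStarPresentation.evalModel_gen]
  exact M.rel.2.2.2

end NCTorus

namespace UqParam

variable (p : UqParam)

theorem map_qMinor {A B : Type*} [Ring A] [Algebra ℂ A] [Ring B] [Algebra ℂ B] {F : Type*}
    [FunLike F A B] [AlgHomClass F ℂ A B] (φ : F) (V : Fin 3 → Fin 3 → A) {r : ℕ}
    (I J : Fin r → Fin 3) :
    φ (p.qMinor V I J) = p.qMinor (fun i j => φ (V i j)) I J := by
  simp only [qMinor, map_sum, map_smul, map_list_prod, List.map_ofFn, Function.comp_def]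

/-- The image of the determinant is the determinant of the images. -/
theorem map_D {B : Type*} [Ring B] [Algebra ℂ B] {F : Type*}
    [FunLike F (CU.{u} p) B] [AlgHomClass F ℂ (CU.{u} p) B] (φ : F) :
    φ p.D = p.qDet fun i j => φ (p.V i j) :=
  p.map_qMinor φ p.V id id

/-- `𝒟⁻¹` is the adjoint of the quantum determinant. -/
theorem gen_Dinv_eq : (p.uqPresentation.{u}).gen .Dinv = star p.D := by
  refine CStarPresentation.ext_evalModel fun M => ?_
  rw [map_star, map_D, CStarPresentation.evalModel_gen, ← star_star (M.val UqGen.Dinv),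
    M.rel.star_Dinv]
  rfl

/-- A representation of `C(U_{q,Θ}(3))` is determined by the images of the `V_{i,j}`. -/
theorem hom_ext {B : Type*} [CStarAlgebra B] {φ ψ : CU.{u} p →⋆ₐ[ℂ] B}
    (h : ∀ i j, φ (p.V i j) = ψ (p.V i j)) : φ = ψ := by
  refine CStarPresentation.hom_ext fun g => ?_
  cases g with
  | V i j => exact h i j
  | Dinv => rw [gen_Dinv_eq, map_star, map_star, map_D, map_D]; simp only [h]

theorem exists_hom {B : Type u} [CStarAlgebra B] [Nontrivial B] {V : Fin 3 → Fin 3 → B} {Dinv : B}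
    (h : p.IsUqTuple V Dinv) :
    ∃ φ : CU.{u} p →⋆ₐ[ℂ] B, (∀ i j, φ (p.V i j) = V i j) ∧ φ p.D = star Dinv := by
  let t : UqGen → B := fun g => match g with
    | .V i j => V i j
    | .Dinv => Dinv
  have ht : (p.uqPresentation.{u}).Rel t := h
  obtain ⟨φ, hφ⟩ := CStarPresentation.exists_hom ht
  refine ⟨φ, fun i j => hφ (.V i j), ?_⟩
  have := hφ .Dinv
  rw [gen_Dinv_eq, map_star] at this
  rw [← star_star (φ p.D), this]

end UqParam

/-! ### Weighted shifts on `ℓ²(ℕ)^{⊗k} ⊗ K` -/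

section L2

variable {k : ℕ} {K : Type u} [NormedAddCommGroup K] [InnerProductSpace ℂ K]

theorem δ_add (n : Fin k → ℕ) (x y : K) : δ n (x + y) = δ n x + δ n y := lp.single_add _ _ _ _

theorem δ_smul (n : Fin k → ℕ) (c : ℂ) (x : K) : δ n (c • x) = c • δ n x :=
  lp.single_smul _ _ _ _

theorem δ_zero (n : Fin k → ℕ) : δ n (0 : K) = 0 := lp.single_zero _ _

theorem norm_δ (n : Fin k → ℕ) (x : K) : ‖δ n x‖ = ‖x‖ := lp.norm_single (by norm_num) _ _

theorem δ_apply_self (n : Fin k → ℕ) (x : K) : (δ n x : L2 k K) n = x := lp.single_apply_self _ _ _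

theorem inner_δ_left (n : Fin k → ℕ) (x : K) (f : L2 k K) : inner ℂ (δ n x) f = inner ℂ x (f n) :=
  lp.inner_single_left _ _ _

theorem δ_ne_zero (n : Fin k → ℕ) {x : K} (hx : x ≠ 0) : δ n x ≠ 0 := fun h => hx <| by
  rw [← norm_eq_zero, ← norm_δ n, h, norm_zero]

theorem ext_δ {F : Type*} [NormedAddCommGroup F] [Module ℂ F] {B B' : L2 k K →L[ℂ] F}
    (h : ∀ n x, B (δ n x) = B' (δ n x)) : B = B' :=
  lp.ext_continuousLinearMap (by norm_num) fun n => ContinuousLinearMap.ext fun x => h n x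

/-- The operator `f ↦ (n ↦ c n • T (f (g n)))`, for `g` injective and `|c| ≤ 1`. -/
noncomputable def pullOp (g : (Fin k → ℕ) → (Fin k → ℕ)) (hg : g.Injective) (c : (Fin k → ℕ) → ℂ)
    (hc : ∀ n, ‖c n‖ ≤ 1) (T : K →L[ℂ] K) : L2 k K →L[ℂ] L2 k K :=
  have le : ∀ (f : L2 k K) n,
      ‖c n • T (f (g n))‖ ^ (2 : ℝ≥0∞).toReal ≤ ‖T‖ ^ 2 * ‖f (g n)‖ ^ (2 : ℝ≥0∞).toReal := by
    intro f n
    have : ‖c n • T (f (g n))‖ ≤ ‖T‖ * ‖f (g n)‖ := by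
      rw [norm_smul]
      calc _ ≤ 1 * (‖T‖ * ‖f (g n)‖) := by
            gcongr
            exacts [hc n, T.le_opNorm _]
        _ = _ := one_mul _
    simp only [ENNReal.toReal_ofNat, Real.rpow_ofNat]
    rw [← mul_pow]
    gcongr
  have sm : ∀ f : L2 k K, Summable fun n => ‖T‖ ^ 2 * ‖f (g n)‖ ^ (2 : ℝ≥0∞).toReal := fun f =>
    ((lp.hasSum_norm (by norm_num) f).summable.comp_injective hg).mul_left _
  have sm' : ∀ f : L2 k K, Summable fun n => ‖c n • T (f (g n))‖ ^ (2 : ℝ≥0∞).toReal := fun f =>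
    Summable.of_nonneg_of_le (fun _ => by positivity) (le f) (sm f)
  LinearMap.mkContinuous
    { toFun := fun f => ⟨fun n => c n • T (f (g n)), memℓp_gen (sm' f)⟩
      map_add' := fun f f' => Subtype.ext <| funext fun n => by
        change c n • T (f (g n) + f' (g n)) = c n • T (f (g n)) + c n • T (f' (g n))
        rw [map_add, smul_add]
      map_smul' := fun a f => Subtype.ext <| funext fun n => by
        change c n • T (a • f (g n)) = a • c n • T (f (g n))
        rw [map_smul, smul_comm] }
    ‖T‖ fun f => by
      refine lp.norm_le_of_tsum_le (by norm_num) (by positivity) ?_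
      calc _ ≤ ∑' n, ‖T‖ ^ 2 * ‖f (g n)‖ ^ (2 : ℝ≥0∞).toReal := (sm' f).tsum_le_tsum (le f) (sm f)
        _ = ‖T‖ ^ 2 * ∑' n, ‖f (g n)‖ ^ (2 : ℝ≥0∞).toReal := tsum_mul_left
        _ ≤ ‖T‖ ^ 2 * ∑' n, ‖f n‖ ^ (2 : ℝ≥0∞).toReal := by
            refine mul_le_mul_of_nonneg_left ?_ (by positivity)
            exact tsum_comp_le_tsum_of_inj (lp.hasSum_norm (by norm_num) f).summable
              (fun _ => by positivity) hg
        _ = _ := by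
            rw [← lp.norm_rpow_eq_tsum (by norm_num)]
            simp [mul_pow]

variable {g : (Fin k → ℕ) → (Fin k → ℕ)} {hg : g.Injective} {c : (Fin k → ℕ) → ℂ}
  {hc : ∀ n, ‖c n‖ ≤ 1} {T : K →L[ℂ] K}

theorem pullOp_apply (f : L2 k K) (n : Fin k → ℕ) : pullOp g hg c hc T f n = c n • T (f (g n)) :=
  rfl

variable [CompleteSpace K]

/-- The adjoint of `pullOp g c T` pushes the basis forward along `g`. -/
theorem star_pullOp_δ (n : Fin k → ℕ) (x : K) :
    star (pullOp g hg c hc T) (δ n x) = conj (c n) • δ (g n) (star T x) := by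
  refine ext_inner_right ℂ fun f => ?_
  rw [ContinuousLinearMap.star_eq_adjoint, ContinuousLinearMap.adjoint_inner_left, inner_δ_left,
    inner_smul_left, inner_δ_left, pullOp_apply, inner_smul_right, Complex.conj_conj,
    ContinuousLinearMap.star_eq_adjoint, ContinuousLinearMap.adjoint_inner_left]

theorem pullOp_id_δ {hg : (id : (Fin k → ℕ) → (Fin k → ℕ)).Injective} (n : Fin k → ℕ) (x : K) :
    pullOp id hg c hc T (δ n x) = c n • δ n (T x) := by
  refine lp.ext (funext fun m => ?_)
  rw [pullOp_apply, lp.coeFn_smul, Pi.smul_apply, δ, δ, id, lp.single_apply, lp.single_apply]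
  by_cases h : m = n
  · subst h; simp
  · simp [h]

end L2

namespace UqParam

variable (p : UqParam) {k : ℕ} {K : Type u} [NormedAddCommGroup K] [InnerProductSpace ℂ K]
  [CompleteSpace K]

theorem norm_r_le (n : ℕ) : ‖p.r n‖ ≤ 1 := by
  have : 0 ≤ p.q ^ (2 * n) := by have := p.q_pos; positivity
  rw [r, Complex.norm_real, Real.norm_of_nonneg (Real.sqrt_nonneg _)]
  exact Real.sqrt_le_one.2 (by linarith)

theorem r_zero : p.r 0 = 0 := by simp [r]

theorem conj_r (n : ℕ) : conj (p.r n) = p.r n := Complex.conj_ofReal _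

theorem r_sq (hq : p.q < 1) (n : ℕ) : p.r n * p.r n = 1 - (p.q : ℂ) ^ (2 * n) := by
  have : p.q ^ (2 * n) ≤ 1 := pow_le_one₀ p.q_pos.le hq.le
  rw [r, ← Complex.ofReal_mul, Real.mul_self_sqrt (by linarith)]
  push_cast; rfl

theorem r_succ_ne_zero (hq : p.q < 1) (n : ℕ) : p.r (n + 1) ≠ 0 := by
  have : p.q ^ (2 * (n + 1)) < 1 := pow_lt_one₀ p.q_pos.le hq (by simp)
  rw [r, Complex.ofReal_ne_zero, Real.sqrt_ne_zero']
  linarith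

theorem update_succ_injective (i : Fin k) :
    Function.Injective fun n : Fin k → ℕ => Function.update n i (n i + 1) := by
  intro n m h
  funext j
  have := congrFun h j
  by_cases hj : j = i
  · subst hj; simpa using this
  · simpa [hj] using this

/-- The operator `A = S √(1 - q^{2N})` in the `i`-th tensor factor. -/
noncomputable def lowOp (i : Fin k) : L2 k K →L[ℂ] L2 k K :=
  pullOp (fun n => Function.update n i (n i + 1))
    (update_succ_injective i)
    (fun n => p.r (n i + 1)) (fun _ => p.norm_r_le _) 1

/-- The operator `q^N` in the `i`-th tensor factor. -/
noncomputable def qOp (hq : p.q < 1) (i : Fin k) : L2 k K →L[ℂ] L2 k K :=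
  pullOp id Function.injective_id (fun n => (p.q : ℂ) ^ n i) (fun n => by
    rw [norm_pow, Complex.norm_real, Real.norm_of_nonneg p.q_pos.le]
    exact pow_le_one₀ p.q_pos.le hq.le) 1

/-- The operator `z^N` in the `i`-th tensor factor. -/
noncomputable def phOp (i : Fin k) (z : Circle) : L2 k K →L[ℂ] L2 k K :=
  pullOp id Function.injective_id (fun n => (z : ℂ) ^ n i) (fun n => by
    rw [norm_pow, Circle.norm_coe, one_pow]) 1

/-- The operator `1 ⊗ T`. -/
noncomputable def ampOp (T : K →L[ℂ] K) : L2 k K →L[ℂ] L2 k K :=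
  pullOp id Function.injective_id (fun _ => 1) (fun _ => by simp) T

theorem lowOp_δ (i : Fin k) (n : Fin k → ℕ) (x : K) :
    p.lowOp i (δ n x) = p.r (n i) • δ (Function.update n i (n i - 1)) x := by
  refine lp.ext (funext fun m => ?_)
  rw [lowOp, pullOp_apply, lp.coeFn_smul, Pi.smul_apply, δ, δ, lp.single_apply, lp.single_apply]
  by_cases h : Function.update m i (m i + 1) = n
  · subst h; simp
  · rw [Pi.single_eq_of_ne h]
    by_cases h' : m = Function.update n i (n i - 1)
    · subst h'
      have : n i = 0 := by
        by_contra h0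
        exact h (by simp [Nat.sub_add_cancel (Nat.one_le_iff_ne_zero.2 h0)])
      simp [this, r_zero]
    · rw [Pi.single_eq_of_ne h']; simp

theorem star_lowOp_δ (i : Fin k) (n : Fin k → ℕ) (x : K) :
    star (p.lowOp i) (δ n x) = p.r (n i + 1) • δ (Function.update n i (n i + 1)) x := by
  rw [lowOp, star_pullOp_δ, conj_r, star_one]; rfl

theorem qOp_δ (hq : p.q < 1) (i : Fin k) (n : Fin k → ℕ) (x : K) :
    p.qOp hq i (δ n x) = (p.q : ℂ) ^ n i • δ n x := pullOp_id_δ _ _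

theorem star_qOp_δ (hq : p.q < 1) (i : Fin k) (n : Fin k → ℕ) (x : K) :
    star (p.qOp hq i) (δ n x) = (p.q : ℂ) ^ n i • δ n x := by
  rw [qOp, star_pullOp_δ, star_one, map_pow, Complex.conj_ofReal]; rfl

theorem phOp_δ (i : Fin k) (z : Circle) (n : Fin k → ℕ) (x : K) :
    phOp i z (δ n x) = (z : ℂ) ^ n i • δ n x := pullOp_id_δ _ _

theorem star_phOp_δ (i : Fin k) (z : Circle) (n : Fin k → ℕ) (x : K) :
    star (phOp i z) (δ n x) = (z : ℂ)⁻¹ ^ n i • δ n x := by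
  rw [phOp, star_pullOp_δ, star_one, map_pow, ← Circle.coe_inv_eq_conj, Circle.coe_inv]; rfl

theorem ampOp_δ (T : K →L[ℂ] K) (n : Fin k → ℕ) (x : K) : ampOp T (δ n x) = δ n (T x) := by
  rw [ampOp, pullOp_id_δ, one_smul]

theorem star_ampOp_δ (T : K →L[ℂ] K) (n : Fin k → ℕ) (x : K) :
    star (ampOp T) (δ n x) = δ n (star T x) := by
  rw [ampOp, star_pullOp_δ, map_one, one_smul]; rfl

/-! ### Rescaled basis vectors -/

/-- The weight `∏_{j < n} r(j+1)⁻¹` for `n ≥ 0`, and `0` for `n < 0`. -/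
noncomputable def wt (n : ℤ) : ℂ := if n < 0 then 0 else ∏ j ∈ Finset.range n.toNat, (p.r (j + 1))⁻¹

theorem wt_ne_zero (hq : p.q < 1) (n : ℕ) : p.wt n ≠ 0 := by
  rw [wt, if_neg (by omega)]
  exact Finset.prod_ne_zero_iff.2 fun j _ => inv_ne_zero (p.r_succ_ne_zero hq j)

theorem wt_neg {n : ℤ} (h : n < 0) : p.wt n = 0 := if_pos h

theorem wt_succ (n : ℕ) : p.wt (n + 1 : ℤ) = p.wt n * (p.r (n + 1))⁻¹ := by
  rw [wt, if_neg (by omega), wt, if_neg (by omega), show ((n : ℤ) + 1).toNat = n + 1 by omega,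
    Finset.prod_range_succ]
  simp

theorem wt_mul_r (hq : p.q < 1) (n : ℤ) : p.wt n * p.r n.toNat = p.wt (n - 1) := by
  rcases lt_or_ge n 0 with h | h
  · rw [p.wt_neg h, p.wt_neg (by omega), zero_mul]
  lift n to ℕ using h
  cases n with
  | zero => simp [p.wt_neg, r_zero]
  | succ n =>
    push_cast
    rw [wt_succ, add_sub_cancel_right, show ((n : ℤ) + 1).toNat = n + 1 by omega,
      inv_mul_cancel_right₀ (p.r_succ_ne_zero hq n)]

theorem wt_mul_r_succ (hq : p.q < 1) (n : ℤ) :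
    p.wt n * p.r (n.toNat + 1) = (1 - ((p.q : ℂ) ^ n * p.q) ^ 2) * p.wt (n + 1) := by
  rcases lt_or_ge n (-1) with h | h
  · rw [p.wt_neg (by omega), p.wt_neg (by omega), mul_zero, zero_mul]
  rcases h.eq_or_lt with rfl | h
  · have : (p.q : ℂ) ≠ 0 := by exact_mod_cast p.q_pos.ne'
    simp [p.wt_neg, this]
  lift n to ℕ using by omega
  have := p.r_succ_ne_zero hq n
  rw [wt_succ, Int.toNat_natCast, zpow_natCast, ← pow_succ, ← pow_mul, mul_comm (n + 1),
    ← p.r_sq hq]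
  field_simp

/-- The multiple `e_n / ∏_{0 < j ≤ n} r(j)` of the basis vector `e_n`, taken in each tensor factor;
it is `0` if some `n i` is negative. On these vectors the operator `A` is the shift `n ↦ n - 1` and
`A*` is the shift `n ↦ n + 1` with the weight `1 - q^{2n+2}`, so that no square roots and no case
distinctions at `n = 0` occur. -/
noncomputable def ket (n : Fin k → ℤ) : K →ₗ[ℂ] L2 k K where
  toFun x := (∏ i, p.wt (n i)) • δ (fun i => (n i).toNat) x
  map_add' x y := by rw [δ_add, smul_add]
  map_smul' c x := by rw [δ_smul, smul_comm]; rfl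

theorem ket_apply (n : Fin k → ℤ) (x : K) :
    p.ket n x = (∏ i, p.wt (n i)) • δ (fun i => (n i).toNat) x := rfl

theorem ext_ket (hq : p.q < 1) {B B' : L2 k K →L[ℂ] L2 k K}
    (h : ∀ n x, B (p.ket n x) = B' (p.ket n x)) : B = B' := by
  refine ext_δ fun n x => ?_
  have := h (fun i => n i) x
  simp only [ket_apply, map_smul, Int.toNat_natCast] at this
  exact smul_right_injective _
    (Finset.prod_ne_zero_iff.2 fun i _ => p.wt_ne_zero hq (n i)) this

theorem prod_wt_update (n : Fin k → ℤ) (i : Fin k) (m : ℤ) :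
    ∏ j, p.wt (Function.update n i m j) = p.wt m * ∏ j ∈ Finset.univ \ {i}, p.wt (n j) :=
  Finset.prod_update_of_mem (Finset.mem_univ i) (fun j => p.wt (n j)) (p.wt m) ▸ by
    refine Finset.prod_congr rfl fun j _ => ?_
    by_cases h : j = i
    · subst h; simp
    · simp [h]

theorem lowOp_ket (hq : p.q < 1) (i : Fin k) (n : Fin k → ℤ) (x : K) :
    p.lowOp i (p.ket n x) = p.ket (Function.update n i (n i - 1)) x := by
  have h1 : (∏ j, p.wt (n j)) = p.wt (n i) * ∏ j ∈ Finset.univ \ {i}, p.wt (n j) := by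
    rw [← prod_wt_update, Function.update_eq_self]
  have h2 : (fun j => (Function.update n i (n i - 1) j).toNat) =
      Function.update (fun j => (n j).toNat) i ((n i).toNat - 1) := by
    funext j
    by_cases h : j = i
    · subst h; simp
    · simp [h]
  rw [ket_apply, map_smul, lowOp_δ, smul_smul, ket_apply, prod_wt_update, h1, h2,
    ← p.wt_mul_r hq]
  congr 1; ring

theorem star_lowOp_ket (hq : p.q < 1) (i : Fin k) (n : Fin k → ℤ) (x : K) :
    star (p.lowOp i) (p.ket n x) =
      (1 - ((p.q : ℂ) ^ n i * p.q) ^ 2) • p.ket (Function.update n i (n i + 1)) x := by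
  have h1 : (∏ j, p.wt (n j)) = p.wt (n i) * ∏ j ∈ Finset.univ \ {i}, p.wt (n j) := by
    rw [← prod_wt_update, Function.update_eq_self]
  have h3 : (∏ j, p.wt (n j)) * p.r ((n i).toNat + 1) =
      (1 - ((p.q : ℂ) ^ n i * p.q) ^ 2) * ∏ j, p.wt (Function.update n i (n i + 1) j) := by
    rw [h1, prod_wt_update, ← mul_assoc, ← p.wt_mul_r_succ hq]; ring
  rw [ket_apply, map_smul, star_lowOp_δ, smul_smul, ket_apply, h3, smul_smul]
  rcases lt_or_ge (n i) 0 with h | h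
  -- for `n i < 0` the weight `wt (n i)` makes both sides vanish
  · rw [← h3, h1, p.wt_neg h]; simp
  · congr 2
    funext j
    by_cases hj : j = i
    · subst hj; simp; omega
    · simp [hj]

/-- A diagonal operator acts on rescaled basis vectors by zpowers. -/
theorem zpow_smul_ket (z : ℂ) (i : Fin k) (n : Fin k → ℤ) (x : K) :
    (z ^ (n i).toNat) • p.ket n x = z ^ n i • p.ket n x := by
  rcases lt_or_ge (n i) 0 with h | h
  · have : p.ket n x = 0 := by
      rw [ket_apply, Finset.prod_eq_zero (Finset.mem_univ i) (p.wt_neg h), zero_smul]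
    rw [this, smul_zero, smul_zero]
  · rw [← zpow_natCast, Int.toNat_of_nonneg h]

theorem qOp_ket (hq : p.q < 1) (i : Fin k) (n : Fin k → ℤ) (x : K) :
    p.qOp hq i (p.ket n x) = (p.q : ℂ) ^ n i • p.ket n x := by
  rw [← zpow_smul_ket, ket_apply, map_smul, qOp_δ, smul_comm]

theorem star_qOp_ket (hq : p.q < 1) (i : Fin k) (n : Fin k → ℤ) (x : K) :
    star (p.qOp hq i) (p.ket n x) = (p.q : ℂ) ^ n i • p.ket n x := by
  rw [← zpow_smul_ket, ket_apply, map_smul, star_qOp_δ, smul_comm]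

theorem phOp_ket (i : Fin k) (z : Circle) (n : Fin k → ℤ) (x : K) :
    phOp i z (p.ket n x) = (z : ℂ) ^ n i • p.ket n x := by
  rw [← zpow_smul_ket, ket_apply, map_smul, phOp_δ, smul_comm]

theorem star_phOp_ket (i : Fin k) (z : Circle) (n : Fin k → ℤ) (x : K) :
    star (phOp i z) (p.ket n x) = (z : ℂ)⁻¹ ^ n i • p.ket n x := by
  rw [← zpow_smul_ket, ket_apply, map_smul, star_phOp_δ, smul_comm]

theorem ampOp_ket (T : K →L[ℂ] K) (n : Fin k → ℤ) (x : K) :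
    ampOp T (p.ket n x) = p.ket n (T x) := by
  rw [ket_apply, map_smul, ampOp_δ, ket_apply]

theorem star_ampOp_ket (T : K →L[ℂ] K) (n : Fin k → ℤ) (x : K) :
    star (ampOp T) (p.ket n x) = p.ket n (star T x) := by
  rw [ket_apply, map_smul, star_ampOp_δ, ket_apply]

end UqParam

/-! ### The relations in coordinates -/

namespace UqParam

variable (p : UqParam)

theorem θ_inv (i j : Fin 3) : p.θ i j = (p.θ j i)⁻¹ := eq_inv_of_mul_eq_one_left (p.θ_mul i j)

theorem q_ne_zero : (p.q : ℂ) ≠ 0 := by exact_mod_cast p.q_pos.ne'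

theorem conj_θ (i j : Fin 3) : conj (p.θ i j) = (p.θ i j)⁻¹ := by
  rw [p.θ_conj, p.θ_inv]

/-- The number `θ_{i,j}` as an element of the circle. -/
noncomputable def θc (i j : Fin 3) : Circle := ⟨p.θ i j, mem_sphere_zero_iff_norm.2 (p.norm_θ i j)⟩

theorem coe_θc (i j : Fin 3) : (p.θc i j : ℂ) = p.θ i j := rfl

theorem forall_fin_three {P : Fin 3 → Prop} : (∀ i, P i) ↔ P 0 ∧ P 1 ∧ P 2 :=
  ⟨fun h => ⟨h 0, h 1, h 2⟩, fun ⟨h0, h1, h2⟩ i => by fin_cases i <;> assumption⟩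

/-- The defining relations of `C(U_{q,Θ}(3))`, written out for a unitary `D` in place of the quantum
determinant, with the parameters expressed through `γ, λ, ς` and the adjoints of the generators
multiplied by `D`.

The lists run over the pairs of columns `j < l`, with the first component `θ l j`, and in `star0`
over the columns `i` and the two other columns, with the first component `κ i * (-q) ^ i`. The
parameters are variables `q, γ, lam, ς`, so that `simp` treats them as atoms. -/
theorem isUqTuple_of {B : Type*} [CStarAlgebra B] {V : Fin 3 → Fin 3 → B} {D : B} {q γ lam ς : ℂ}
    (hqq : q = p.q) (hγ : γ = p.γ) (hl : lam = p.lam) (hς : ς = p.ς)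
    (row : ∀ i, V i 0 * V i 1 = (q * γ) • (V i 1 * V i 0) ∧
      V i 0 * V i 2 = (q * lam) • (V i 2 * V i 0) ∧
      V i 1 * V i 2 = (q * ς) • (V i 2 * V i 1))
    (col : ∀ j, V 0 j * V 1 j = (q * γ⁻¹) • (V 1 j * V 0 j) ∧
      V 0 j * V 2 j = (q * lam⁻¹) • (V 2 j * V 0 j) ∧
      V 1 j * V 2 j = (q * ς⁻¹) • (V 2 j * V 1 j))
    (anti : ∀ s : ℂ × Fin 3 × Fin 3, s ∈ [(γ, 0, 1), (lam, 0, 2), (ς, 1, 2)] →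
      V 0 s.2.2 * V 1 s.2.1 = (s.1 * γ)⁻¹ • (V 1 s.2.1 * V 0 s.2.2) ∧
      V 0 s.2.2 * V 2 s.2.1 = (s.1 * lam)⁻¹ • (V 2 s.2.1 * V 0 s.2.2) ∧
      V 1 s.2.2 * V 2 s.2.1 = (s.1 * ς)⁻¹ • (V 2 s.2.1 * V 1 s.2.2))
    (diag : ∀ s : ℂ × Fin 3 × Fin 3, s ∈ [(γ, 0, 1), (lam, 0, 2), (ς, 1, 2)] →
      s.1⁻¹ • (V 0 s.2.1 * V 1 s.2.2) - γ⁻¹ • (V 1 s.2.2 * V 0 s.2.1) =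
        (q - q⁻¹) • (V 0 s.2.2 * V 1 s.2.1) ∧
      s.1⁻¹ • (V 0 s.2.1 * V 2 s.2.2) - lam⁻¹ • (V 2 s.2.2 * V 0 s.2.1) =
        (q - q⁻¹) • (V 0 s.2.2 * V 2 s.2.1) ∧
      s.1⁻¹ • (V 1 s.2.1 * V 2 s.2.2) - ς⁻¹ • (V 2 s.2.2 * V 1 s.2.1) =
        (q - q⁻¹) • (V 1 s.2.2 * V 2 s.2.1))
    (det : V 0 0 * V 1 1 * V 2 2
      + (-q * γ⁻¹) • (V 1 0 * V 0 1 * V 2 2)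
      + (-q * ς⁻¹) • (V 0 0 * V 2 1 * V 1 2)
      + (q ^ 2 * γ⁻¹ * lam⁻¹) • (V 1 0 * V 2 1 * V 0 2)
      + (q ^ 2 * lam⁻¹ * ς⁻¹) • (V 2 0 * V 0 1 * V 1 2)
      + (-q ^ 3 * γ⁻¹ * lam⁻¹ * ς⁻¹) • (V 2 0 * V 1 1 * V 0 2) = D)
    (unit : star D * D = 1 ∧ D * star D = 1)
    (mul_star : ∀ i k, V i k * star D =
      (![γ⁻¹ * lam⁻¹, γ * ς⁻¹, lam * ς] k / ![γ⁻¹ * lam⁻¹, γ * ς⁻¹, lam * ς] i : ℂ) •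
        (star D * V i k))
    (star0 : ∀ s : ℂ × Fin 3 × Fin 3 × Fin 3,
      s ∈ [(γ * lam, 0, 1, 2), (-q * ς, 1, 0, 2), (q ^ 2, 2, 0, 1)] →
      D * star (V 0 s.2.1) = (s.1 / (γ * lam) : ℂ) •
        (V 1 s.2.2.1 * V 2 s.2.2.2 - (q * ς⁻¹) • (V 2 s.2.2.1 * V 1 s.2.2.2)) ∧
      D * star (V 1 s.2.1) = (-s.1 / (q * ς) : ℂ) •
        (V 0 s.2.2.1 * V 2 s.2.2.2 - (q * lam⁻¹) • (V 2 s.2.2.1 * V 0 s.2.2.2)) ∧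
      D * star (V 2 s.2.1) = (s.1 / q ^ 2 : ℂ) •
        (V 0 s.2.2.1 * V 1 s.2.2.2 - (q * γ⁻¹) • (V 1 s.2.2.1 * V 0 s.2.2.2))) :
    p.IsUqTuple V (star D) := by
  subst hqq hγ hl hς
  have hq := p.q_ne_zero
  have t01 := p.θ_ne_zero 1 0
  have t02 := p.θ_ne_zero 2 0
  have t12 := p.θ_ne_zero 2 1
  have e01 := p.θ_inv 0 1
  have e02 := p.θ_inv 0 2
  have e12 := p.θ_inv 1 2
  have k0 : p.κ 0 = p.θ 1 0 * p.θ 2 0 := by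
    rw [κ, show ({j | 0 < j} : Finset (Fin 3)) = {1, 2} by decide]; simp
  have k1 : p.κ 1 = p.θ 2 1 := by
    rw [κ, show ({j | 1 < j} : Finset (Fin 3)) = {2} by decide]; simp
  have k2 : p.κ 2 = 1 := by
    rw [κ, show ({j | 2 < j} : Finset (Fin 3)) = ∅ by decide]; simp
  have c0 : ({0}ᶜ : Finset (Fin 3)) = {1, 2} := by decide
  have c1 : ({1}ᶜ : Finset (Fin 3)) = {0, 2} := by decide
  have c2 : ({2}ᶜ : Finset (Fin 3)) = {0, 1} := by decide
  have hD : p.qDet V = D := by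
    rw [qDet_eq, ← det, e01, e02, e12]
  simp only [List.forall_mem_cons, List.mem_nil_iff, false_imp_iff, imp_true_iff, and_true] at *
  constructor
  case star_V =>
    have key : ∀ {k i} {c : ℂ} {M : B}, D * star (V k i) = c • M →
        star (V k i) = c • (star D * M) := by
      intro k i c M h
      rw [← mul_smul_comm, ← h, ← mul_assoc, unit.1, one_mul]
    have a00 : (0 : Fin 3).succAbove (0 : Fin 2) = 1 := rfl
    have a01 : (0 : Fin 3).succAbove (1 : Fin 2) = 2 := rfl
    have a10 : (1 : Fin 3).succAbove (0 : Fin 2) = 0 := rfl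
    have a11 : (1 : Fin 3).succAbove (1 : Fin 2) = 2 := rfl
    have a20 : (2 : Fin 3).succAbove (0 : Fin 2) = 0 := rfl
    have a21 : (2 : Fin 3).succAbove (1 : Fin 2) = 1 := rfl
    simp only [cominor_eq, forall_fin_three, a00, a01, a10, a11, a20, a21, k0, k1, k2, e01, e02,
      e12]
    obtain ⟨⟨h00, h10, h20⟩, ⟨h01, h11, h21⟩, ⟨h02, h12, h22⟩⟩ := star0
    refine ⟨⟨(key h00).trans ?_, (key h01).trans ?_, (key h02).trans ?_⟩,
      ⟨(key h10).trans ?_, (key h11).trans ?_, (key h12).trans ?_⟩,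
      ⟨(key h20).trans ?_, (key h21).trans ?_, (key h22).trans ?_⟩⟩ <;> congr 1 <;>
    norm_num [zpow_neg] <;> first | exact p.q_pos.ne' | field_simp
  case star_Dinv => rw [star_star, hD]
  case det_mul => rw [hD, unit.2]
  case mul_Dinv =>
    have hc : ∀ k, ∏ j ∈ {k}ᶜ, p.θ k j = ![(p.θ 1 0)⁻¹ * (p.θ 2 0)⁻¹, p.θ 1 0 * (p.θ 2 1)⁻¹,
        p.θ 2 0 * p.θ 2 1] k := by
      rw [forall_fin_three, c0, c1, c2]
      simp [e01, e02, e12]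
    intro i k
    rw [mul_star, hc, hc]
  all_goals
    have l00 : ¬ (0 : Fin 3) < 0 := by decide
    have l01 : (0 : Fin 3) < 1 := by decide
    have l02 : (0 : Fin 3) < 2 := by decide
    have l10 : ¬ (1 : Fin 3) < 0 := by decide
    have l11 : ¬ (1 : Fin 3) < 1 := by decide
    have l12 : (1 : Fin 3) < 2 := by decide
    have l20 : ¬ (2 : Fin 3) < 0 := by decide
    have l21 : ¬ (2 : Fin 3) < 1 := by decide
    have l22 : ¬ (2 : Fin 3) < 2 := by decide
    simp only [forall_fin_three, l00, l01, l02, l10, l11, l12, l20, l21, l22, false_imp_iff,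
      true_imp_iff, true_and, and_true, e01, e02, e12]
  case row =>
    simp only [forall_fin_three] at row
    tauto
  case col =>
    simp only [forall_fin_three] at col
    tauto
  case diag => tauto
  case anti =>
    have key : ∀ {s t : ℂ} {x y : B}, s ≠ 0 → t ≠ 0 → x = (s * t)⁻¹ • y → s • x = t⁻¹ • y := by
      intro s t x y hs ht h
      rw [h, smul_smul, mul_inv, mul_inv_cancel_left₀ hs]
    obtain ⟨⟨h00, h10, h20⟩, ⟨h01, h11, h21⟩, ⟨h02, h12, h22⟩⟩ := anti
    constructorm* _ ∧ _ <;> apply key <;> assumption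

end UqParam

/-! ### Unitary triples satisfying the relations of the torus -/

theorem update_fin_one {α : Type*} (m t : α) : Function.update ![m] 0 t = ![t] := by
  ext i; fin_cases i; rfl

theorem update_fin_two {α : Type*} (m n t : α) :
    Function.update ![m, n] 0 t = ![t, n] ∧ Function.update ![m, n] 1 t = ![m, t] := by
  constructor <;> ext i <;> fin_cases i <;> rfl

theorem update_fin_three {α : Type*} (m n l t : α) :
    Function.update ![m, n, l] 0 t = ![t, n, l] ∧ Function.update ![m, n, l] 1 t = ![m, t, l] ∧
      Function.update ![m, n, l] 2 t = ![m, n, t] := by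
  refine ⟨?_, ?_, ?_⟩ <;> ext i <;> fin_cases i <;> rfl

/-- Unitary operators `W, X, Y` with `W X = a X W`, `W Y = b Y W`, `X Y = c Y X`. -/
structure TorusTriple {K : Type u} [NormedAddCommGroup K] [InnerProductSpace ℂ K] [CompleteSpace K]
    (W X Y : K →L[ℂ] K) (a b c : ℂ) : Prop where
  W_unitary : star W * W = 1 ∧ W * star W = 1
  X_unitary : star X * X = 1 ∧ X * star X = 1
  Y_unitary : star Y * Y = 1 ∧ Y * star Y = 1
  norm_a : ‖a‖ = 1
  norm_b : ‖b‖ = 1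
  norm_c : ‖c‖ = 1
  WX : W * X = a • (X * W)
  WY : W * Y = b • (Y * W)
  XY : X * Y = c • (Y * X)

section commute

variable {K : Type u} [NormedAddCommGroup K] [InnerProductSpace ℂ K] [CompleteSpace K]

theorem unitary_apply {U : K →L[ℂ] K} (h : star U * U = 1 ∧ U * star U = 1) (v : K) :
    star U (U v) = v ∧ U (star U v) = v :=
  ⟨congrArg (· v) h.1, congrArg (· v) h.2⟩

/-- The relation `U V = a V U` between unitaries, in a form that moves `U` and `U*` to the left of
`V` and `V*`. -/
theorem unitary_swap {U V : K →L[ℂ] K} {a : ℂ} (hU : star U * U = 1 ∧ U * star U = 1)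
    (hV : star V * V = 1 ∧ V * star V = 1) (ha : ‖a‖ = 1) (h : U * V = a • (V * U)) (v : K) :
    V (U v) = a⁻¹ • U (V v) ∧ star V (U v) = a • U (star V v) ∧
      V (star U v) = a • star U (V v) ∧ star V (star U v) = a⁻¹ • star U (star V v) := by
  have ha0 : a ≠ 0 := fun h0 => by simp [h0] at ha
  have e : ∀ v, U (V v) = a • V (U v) := fun v => congrArg (· v) h
  have uU := unitary_apply hU
  have uV := unitary_apply hV
  have h1 : ∀ v, V (U v) = a⁻¹ • U (V v) := fun v => by rw [e, inv_smul_smul₀ ha0]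
  have h2 : ∀ v, star V (U v) = a • U (star V v) := fun v => by
    have := e (star V v)
    rw [(uV v).2] at this
    rw [this, map_smul, (uV _).1]
  have h3 : ∀ v, V (star U v) = a • star U (V v) := fun v => by
    have := h1 (star U v)
    rw [(uU v).2] at this
    rw [this, map_smul, (uU _).1, smul_inv_smul₀ ha0]
  refine ⟨h1 v, h2 v, h3 v, ?_⟩
  have := h3 (star V v)
  rw [(uV v).2] at this
  rw [← (uV (star U (star V v))).1, this, map_smul, inv_smul_smul₀ ha0]

end commute

namespace TorusTriple

variable {K : Type u} [NormedAddCommGroup K] [InnerProductSpace ℂ K] [CompleteSpace K]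
  {W X Y : K →L[ℂ] K} {a b c : ℂ}

/-- The relations, in a form that brings words in `W, X, Y` and their adjoints into the order
`W, X, Y`. -/
theorem apply_eq (h : TorusTriple W X Y a b c) (v : K) :
    ((star W (W v) = v ∧ W (star W v) = v) ∧ (star X (X v) = v ∧ X (star X v) = v) ∧
      star Y (Y v) = v ∧ Y (star Y v) = v) ∧
    (X (W v) = a⁻¹ • W (X v) ∧ star X (W v) = a • W (star X v) ∧
      X (star W v) = a • star W (X v) ∧ star X (star W v) = a⁻¹ • star W (star X v)) ∧
    (Y (W v) = b⁻¹ • W (Y v) ∧ star Y (W v) = b • W (star Y v) ∧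
      Y (star W v) = b • star W (Y v) ∧ star Y (star W v) = b⁻¹ • star W (star Y v)) ∧
    (Y (X v) = c⁻¹ • X (Y v) ∧ star Y (X v) = c • X (star Y v) ∧
      Y (star X v) = c • star X (Y v) ∧ star Y (star X v) = c⁻¹ • star X (star Y v)) :=
  ⟨⟨unitary_apply h.W_unitary v, unitary_apply h.X_unitary v, unitary_apply h.Y_unitary v⟩,
    unitary_swap h.W_unitary h.X_unitary h.norm_a h.WX v,
    unitary_swap h.W_unitary h.Y_unitary h.norm_b h.WY v,
    unitary_swap h.X_unitary h.Y_unitary h.norm_c h.XY v⟩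

theorem of_rep {a : Fin 3 → ℂ} (ha : ∀ i, ‖a i‖ = 1) (ρ : NCTorus.{u} a →⋆ₐ[ℂ] (K →L[ℂ] K))
    {b c d : ℂ} (hb : a 0 = b) (hc : a 1 = c) (hd : a 2 = d) :
    TorusTriple (ρ NCTorus.W) (ρ NCTorus.X) (ρ NCTorus.Y) b c d := by
  subst hb hc hd
  have key : ∀ i, star (ρ ((torusPresentation.{u} a).gen i)) *
      ρ ((torusPresentation.{u} a).gen i) = 1 ∧ ρ ((torusPresentation.{u} a).gen i) *
      star (ρ ((torusPresentation.{u} a).gen i)) = 1 := fun i => by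
    rw [← map_star, ← map_mul, ← map_mul, (NCTorus.gen_unitary i).1, (NCTorus.gen_unitary i).2,
      map_one]
    exact ⟨rfl, rfl⟩
  refine ⟨key 0, key 1, key 2, ha 0, ha 1, ha 2, ?_, ?_, ?_⟩
  · rw [← map_mul, NCTorus.W_mul_X, map_smul, map_mul]
  · rw [← map_mul, NCTorus.W_mul_Y, map_smul, map_mul]
  · rw [← map_mul, NCTorus.X_mul_Y, map_smul, map_mul]

end TorusTriple

namespace UqParam

theorem norm_torusParam (p : UqParam) (w : Series) (i : Fin 3) : ‖p.torusParam w i‖ = 1 := by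
  cases w <;> fin_cases i <;> simp [torusParam, p.norm_θ]

variable (p : UqParam)

theorem scalar_facts {q γ lam ς : ℂ} (hqq : q = p.q) (hγ : γ = p.γ) (hl : lam = p.lam)
    (hς : ς = p.ς) : (q ≠ 0 ∧ γ ≠ 0 ∧ lam ≠ 0 ∧ ς ≠ 0) ∧
      conj q = q ∧ conj γ = γ⁻¹ ∧ conj lam = lam⁻¹ ∧ conj ς = ς⁻¹ := by
  subst hqq hγ hl hς
  exact ⟨⟨p.q_ne_zero, p.θ_ne_zero _ _, p.θ_ne_zero _ _, p.θ_ne_zero _ _⟩,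
    Complex.conj_ofReal _, p.conj_θ _ _, p.conj_θ _ _, p.conj_θ _ _⟩

variable {K : Type u} [NormedAddCommGroup K] [InnerProductSpace ℂ K] [CompleteSpace K]

theorem ext_ket_one (hq : p.q < 1) {B B' : L2 1 K →L[ℂ] L2 1 K}
    (h : ∀ n x, B (p.ket ![n] x) = B' (p.ket ![n] x)) : B = B' := by
  refine p.ext_ket hq fun n x => ?_
  rw [show n = ![n 0] by ext i; fin_cases i; rfl]
  exact h _ _

theorem ext_ket_two (hq : p.q < 1) {B B' : L2 2 K →L[ℂ] L2 2 K}
    (h : ∀ m n x, B (p.ket ![m, n] x) = B' (p.ket ![m, n] x)) : B = B' := by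
  refine p.ext_ket hq fun n x => ?_
  rw [show n = ![n 0, n 1] by ext i; fin_cases i <;> rfl]
  exact h _ _ _

theorem ext_ket_three (hq : p.q < 1) {B B' : L2 3 K →L[ℂ] L2 3 K}
    (h : ∀ m n l x, B (p.ket ![m, n, l] x) = B' (p.ket ![m, n, l] x)) : B = B' := by
  refine p.ext_ket hq fun n x => ?_
  rw [show n = ![n 0, n 1, n 2] by ext i; fin_cases i <;> rfl]
  exact h _ _ _ _

end UqParam

theorem nontrivial_L2 (k : ℕ) (K : Type u) [NormedAddCommGroup K] [Nontrivial K] :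
    Nontrivial (L2 k K) := by
  obtain ⟨x, hx⟩ := exists_ne (0 : K)
  exact ⟨⟨δ 0 x, 0, fun h => hx <| norm_eq_zero.1 (by rw [← norm_eq_zero.2 h]; exact
    (lp.norm_single (by norm_num) (E := fun _ : Fin k → ℕ => K) 0 x).symm)⟩⟩

/-! ### The operators of `ψ_{s₁}` -/

namespace UqParam

section OneFactor

variable (p : UqParam) (hq : p.q < 1) {K : Type u} [NormedAddCommGroup K] [InnerProductSpace ℂ K]
  [CompleteSpace K] (W X Y : K →L[ℂ] K)

local notation "𝖠" i => (UqParam.lowOp p i : L2 1 K →L[ℂ] L2 1 K)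
local notation "𝖠⋆" i => (star (UqParam.lowOp p i) : L2 1 K →L[ℂ] L2 1 K)
local notation "𝖰" i => (UqParam.qOp p hq i : L2 1 K →L[ℂ] L2 1 K)
local notation "𝖯" => (UqParam.phOp : Fin 1 → Circle → L2 1 K →L[ℂ] L2 1 K)
local notation "𝖳" => (UqParam.ampOp : (K →L[ℂ] K) → L2 1 K →L[ℂ] L2 1 K)

/-- The matrix of the operators `ψ_{s₁,ρ}(V_{i,j})`, where `W, X, Y` are the images of the
generators of the torus under `ρ`. -/
noncomputable def s1V : Fin 3 → Fin 3 → (L2 1 K →L[ℂ] L2 1 K) := ![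
  ![𝖠 0, (-(p.q * p.θ 1 0) : ℂ) • ((𝖰 0) * 𝖯 0 (p.θc 1 0) * 𝖳 (star W * Y)), 0],
  ![(𝖰 0) * 𝖯 0 (p.θc 1 0)⁻¹ * 𝖳 W, (𝖠⋆ 0) * 𝖳 Y, 0],
  ![0, 0, 𝖳 X]]

/-- The operator `ψ_{s₁,ρ}(D)`. -/
noncomputable def s1D : L2 1 K →L[ℂ] L2 1 K :=
  ampOp (X * Y)

variable {W X Y}

/-- The generators act on the rescaled basis vectors through rational functions of
`q, γ, λ, ς` and their powers; neither square roots nor an exceptional case `n = 0` appear. -/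
theorem s1V_ket (n : ℤ) (x : K) {q γ : ℂ} (hqq : q = p.q) (hγ : γ = p.γ) :
    p.s1V hq W X Y 0 0 (p.ket ![n] x) =
      p.ket ![n - 1] x ∧
    p.s1V hq W X Y 0 1 (p.ket ![n] x) =
      (-(q ^ n * q * (γ ^ n * γ))) • p.ket ![n] (star W (Y x)) ∧
    p.s1V hq W X Y 0 2 (p.ket ![n] x) =
      0 ∧
    p.s1V hq W X Y 1 0 (p.ket ![n] x) =
      (q ^ n * (γ ^ n)⁻¹) • p.ket ![n] (W x) ∧
    p.s1V hq W X Y 1 1 (p.ket ![n] x) =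
      (1 - (q ^ n * q) ^ 2) • p.ket ![n + 1] (Y x) ∧
    p.s1V hq W X Y 1 2 (p.ket ![n] x) =
      0 ∧
    p.s1V hq W X Y 2 0 (p.ket ![n] x) =
      0 ∧
    p.s1V hq W X Y 2 1 (p.ket ![n] x) =
      0 ∧
    p.s1V hq W X Y 2 2 (p.ket ![n] x) =
      p.ket ![n] (X x) := by
  subst hqq hγ
  refine ⟨?_, ?_, ?_, ?_, ?_, ?_, ?_, ?_, ?_⟩ <;>
    simp only [s1V, Matrix.cons_val, add_apply, mul_apply_eq_comp, smul_apply, zero_apply,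
      lowOp_ket, star_lowOp_ket, hq, qOp_ket, phOp_ket, ampOp_ket,
      star_qOp_ket, star_phOp_ket, star_ampOp_ket, update_fin_one, map_smul, smul_smul,
      Circle.coe_mul, Circle.coe_inv, coe_θc, mul_zpow, inv_zpow, mul_inv, inv_inv] <;>
    match_scalars <;> ring

theorem s1D_ket (n : ℤ) (x : K) :
    s1D X Y (p.ket ![n] x) = p.ket ![n] (X (Y x)) ∧
    star (s1D X Y) (p.ket ![n] x) = p.ket ![n] (star Y (star X x)) := by
  constructor <;>
    simp only [s1D, mul_apply_eq_comp, star_mul, phOp_ket, ampOp_ket,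
      star_phOp_ket, star_ampOp_ket, update_fin_one, map_smul, smul_smul,
      Circle.coe_mul, Circle.coe_inv, coe_θc, mul_zpow, inv_zpow, mul_inv, inv_inv]

set_option maxHeartbeats 4000000 in
theorem s1_isUqTuple {q γ lam ς : ℂ} (hqq : q = p.q) (hγ : γ = p.γ)
    (hl : lam = p.lam) (hς : ς = p.ς)
    (hT : TorusTriple W X Y (lam * ς⁻¹) (γ ^ 2) 1) :
    p.IsUqTuple (p.s1V hq W X Y) (star (s1D X Y)) := by
  have hV := fun n x => p.s1V_ket hq (W := W) (X := X) (Y := Y) n x hqq hγ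
  have hD := fun n x => p.s1D_ket (X := X) (Y := Y) n x
  obtain ⟨⟨q0, γ0, lam0, ς0⟩, cq, cγ, cl, cς⟩ := p.scalar_facts hqq hγ hl hς
  have hW := hT.apply_eq
  refine p.isUqTuple_of hqq hγ hl hς ?row ?col ?anti ?diag ?det ?unit ?mul_star ?star
  case' star =>
    simp only [List.forall_mem_cons, List.mem_nil_iff, false_imp_iff, imp_true_iff, and_true]
    -- the adjoints are expanded before `D` is applied, since they do not occur among the `V_{i,j}`
    constructorm* _ ∧ _ <;> refine p.ext_ket_one hq fun n x => ?_ <;>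
    rw [mul_apply_eq_comp] <;>
    conv_lhs =>
      enter [2]
      simp only [s1V, Matrix.cons_val, add_apply, mul_apply_eq_comp, smul_apply, zero_apply,
        star_add, star_mul, star_smul, star_star, star_zero,
        lowOp_ket, star_lowOp_ket, hq, qOp_ket, phOp_ket, ampOp_ket,
        star_qOp_ket, star_phOp_ket, star_ampOp_ket, update_fin_one, map_smul, smul_smul,
        Circle.coe_mul, Circle.coe_inv, coe_θc, mul_zpow, inv_zpow, mul_inv, inv_inv,
        Complex.star_def, map_neg, map_mul, map_inv₀, map_pow, cq, cγ, cl, cς,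
        ← hqq, ← hγ, ← hl, ← hς]
  case' row => rw [forall_fin_three]
  case' col => rw [forall_fin_three]
  case' anti =>
    simp only [List.forall_mem_cons, List.mem_nil_iff, false_imp_iff, imp_true_iff, and_true]
  case' diag =>
    simp only [List.forall_mem_cons, List.mem_nil_iff, false_imp_iff, imp_true_iff, and_true]
  case' mul_star => simp only [forall_fin_three, Matrix.cons_val]
  -- on rescaled basis vectors each relation is an identity of rational functions in `q, γ, λ, ς`
  -- and their powers with exponents in the indices
  all_goals
    (try constructorm* _ ∧ _) <;> (try refine p.ext_ket_one hq fun n x => ?_) <;>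
    simp only [mul_apply_eq_comp, smul_apply, add_apply, sub_apply, one_apply_eq_self, hV, hD, hW,
      map_add, map_smul, map_zero, smul_zero, smul_smul, smul_add, sub_add_cancel,
      add_sub_cancel_right,
      zpow_add_one₀ q0, zpow_add_one₀ γ0, zpow_add_one₀ lam0, zpow_add_one₀ ς0,
      zpow_sub_one₀ q0, zpow_sub_one₀ γ0, zpow_sub_one₀ lam0, zpow_sub_one₀ ς0] <;>
    match_scalars <;> field_simp <;> ring

theorem exists_PsiS₁ (hq : p.q < 1)
    (ρ : NCTorus.{u} (p.torusParam .s₁) →⋆ₐ[ℂ] (K →L[ℂ] K))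
    [Nontrivial K] :
    ∃ π : CU.{u} p →⋆ₐ[ℂ] (L2 1 K →L[ℂ] L2 1 K), p.IsPsiS₁ ρ π := by
  have := nontrivial_L2 1 K
  have h := p.s1_isUqTuple hq rfl rfl rfl rfl (TorusTriple.of_rep (p.norm_torusParam .s₁) ρ
    (by simp [torusParam, conj_θ]) (by simp [torusParam, conj_θ]) (by simp [torusParam, conj_θ]))
  obtain ⟨π, hπ, hD⟩ := p.exists_hom h
  rw [star_star] at hD
  refine ⟨π, ?_, ?_, ?_, ?_, ?_, ?_, ?_, ?_, ?_, ?_⟩ <;> intros <;>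
    simp only [hπ, hD, s1V, s1D, Matrix.cons_val, add_apply, mul_apply_eq_comp, smul_apply,
      lowOp_δ, star_lowOp_δ, hq, qOp_δ, phOp_δ, ampOp_δ, update_fin_one, map_smul, smul_smul,
      δ_smul, map_mul, map_star, Circle.coe_mul, Circle.coe_inv, coe_θc, conj_θ] <;>
    match_scalars <;> ring

end OneFactor

end UqParam

/-! ### The operators of `ψ_{s₂}` -/

namespace UqParam

section OneFactor

variable (p : UqParam) (hq : p.q < 1) {K : Type u} [NormedAddCommGroup K] [InnerProductSpace ℂ K]
  [CompleteSpace K] (W X Y : K →L[ℂ] K)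

local notation "𝖠" i => (UqParam.lowOp p i : L2 1 K →L[ℂ] L2 1 K)
local notation "𝖠⋆" i => (star (UqParam.lowOp p i) : L2 1 K →L[ℂ] L2 1 K)
local notation "𝖰" i => (UqParam.qOp p hq i : L2 1 K →L[ℂ] L2 1 K)
local notation "𝖯" => (UqParam.phOp : Fin 1 → Circle → L2 1 K →L[ℂ] L2 1 K)
local notation "𝖳" => (UqParam.ampOp : (K →L[ℂ] K) → L2 1 K →L[ℂ] L2 1 K)

/-- The matrix of the operators `ψ_{s₂,ρ}(V_{i,j})`, where `W, X, Y` are the images of the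
generators of the torus under `ρ`. -/
noncomputable def s2V : Fin 3 → Fin 3 → (L2 1 K →L[ℂ] L2 1 K) := ![
  ![𝖳 W, 0, 0],
  ![0, 𝖠 0, (-(p.q * p.θ 2 1) : ℂ) • ((𝖰 0) * 𝖯 0 (p.θc 2 1) * 𝖳 (star X * Y))],
  ![0, (𝖰 0) * 𝖯 0 (p.θc 2 1)⁻¹ * 𝖳 X, (𝖠⋆ 0) * 𝖳 Y]]

/-- The operator `ψ_{s₂,ρ}(D)`. -/
noncomputable def s2D : L2 1 K →L[ℂ] L2 1 K :=
  ampOp (Y * W)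

variable {W X Y}

theorem s2V_ket (n : ℤ) (x : K) {q ς : ℂ} (hqq : q = p.q) (hς : ς = p.ς) :
    p.s2V hq W X Y 0 0 (p.ket ![n] x) =
      p.ket ![n] (W x) ∧
    p.s2V hq W X Y 0 1 (p.ket ![n] x) =
      0 ∧
    p.s2V hq W X Y 0 2 (p.ket ![n] x) =
      0 ∧
    p.s2V hq W X Y 1 0 (p.ket ![n] x) =
      0 ∧
    p.s2V hq W X Y 1 1 (p.ket ![n] x) =
      p.ket ![n - 1] x ∧
    p.s2V hq W X Y 1 2 (p.ket ![n] x) =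
      (-(q ^ n * q * (ς ^ n * ς))) • p.ket ![n] (star X (Y x)) ∧
    p.s2V hq W X Y 2 0 (p.ket ![n] x) =
      0 ∧
    p.s2V hq W X Y 2 1 (p.ket ![n] x) =
      (q ^ n * (ς ^ n)⁻¹) • p.ket ![n] (X x) ∧
    p.s2V hq W X Y 2 2 (p.ket ![n] x) =
      (1 - (q ^ n * q) ^ 2) • p.ket ![n + 1] (Y x) := by
  subst hqq hς
  refine ⟨?_, ?_, ?_, ?_, ?_, ?_, ?_, ?_, ?_⟩ <;>
    simp only [s2V, Matrix.cons_val, add_apply, mul_apply_eq_comp, smul_apply, zero_apply,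
      lowOp_ket, star_lowOp_ket, hq, qOp_ket, phOp_ket, ampOp_ket,
      star_qOp_ket, star_phOp_ket, star_ampOp_ket, update_fin_one, map_smul, smul_smul,
      Circle.coe_mul, Circle.coe_inv, coe_θc, mul_zpow, inv_zpow, mul_inv, inv_inv] <;>
    match_scalars <;> ring

theorem s2D_ket (n : ℤ) (x : K) :
    s2D W Y (p.ket ![n] x) = p.ket ![n] (Y (W x)) ∧
    star (s2D W Y) (p.ket ![n] x) = p.ket ![n] (star W (star Y x)) := by
  constructor <;>
    simp only [s2D, mul_apply_eq_comp, star_mul, phOp_ket, ampOp_ket,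
      star_phOp_ket, star_ampOp_ket, update_fin_one, map_smul, smul_smul,
      Circle.coe_mul, Circle.coe_inv, coe_θc, mul_zpow, inv_zpow, mul_inv, inv_inv]

set_option maxHeartbeats 4000000 in
theorem s2_isUqTuple {q γ lam ς : ℂ} (hqq : q = p.q) (hγ : γ = p.γ)
    (hl : lam = p.lam) (hς : ς = p.ς)
    (hT : TorusTriple W X Y (γ * lam⁻¹) 1 (ς ^ 2)) :
    p.IsUqTuple (p.s2V hq W X Y) (star (s2D W Y)) := by
  have hV := fun n x => p.s2V_ket hq (W := W) (X := X) (Y := Y) n x hqq hς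
  have hD := fun n x => p.s2D_ket (W := W) (Y := Y) n x
  obtain ⟨⟨q0, γ0, lam0, ς0⟩, cq, cγ, cl, cς⟩ := p.scalar_facts hqq hγ hl hς
  have hW := hT.apply_eq
  refine p.isUqTuple_of hqq hγ hl hς ?row ?col ?anti ?diag ?det ?unit ?mul_star ?star
  case' star =>
    simp only [List.forall_mem_cons, List.mem_nil_iff, false_imp_iff, imp_true_iff, and_true]
    -- the adjoints are expanded before `D` is applied, since they do not occur among the `V_{i,j}`
    constructorm* _ ∧ _ <;> refine p.ext_ket_one hq fun n x => ?_ <;>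
    rw [mul_apply_eq_comp] <;>
    conv_lhs =>
      enter [2]
      simp only [s2V, Matrix.cons_val, add_apply, mul_apply_eq_comp, smul_apply, zero_apply,
        star_add, star_mul, star_smul, star_star, star_zero,
        lowOp_ket, star_lowOp_ket, hq, qOp_ket, phOp_ket, ampOp_ket,
        star_qOp_ket, star_phOp_ket, star_ampOp_ket, update_fin_one, map_smul, smul_smul,
        Circle.coe_mul, Circle.coe_inv, coe_θc, mul_zpow, inv_zpow, mul_inv, inv_inv,
        Complex.star_def, map_neg, map_mul, map_inv₀, map_pow, cq, cγ, cl, cς,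
        ← hqq, ← hγ, ← hl, ← hς]
  case' row => rw [forall_fin_three]
  case' col => rw [forall_fin_three]
  case' anti =>
    simp only [List.forall_mem_cons, List.mem_nil_iff, false_imp_iff, imp_true_iff, and_true]
  case' diag =>
    simp only [List.forall_mem_cons, List.mem_nil_iff, false_imp_iff, imp_true_iff, and_true]
  case' mul_star => simp only [forall_fin_three, Matrix.cons_val]
  -- on rescaled basis vectors each relation is an identity of rational functions in `q, γ, λ, ς`
  -- and their powers with exponents in the indices
  all_goals
    (try constructorm* _ ∧ _) <;> (try refine p.ext_ket_one hq fun n x => ?_) <;>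
    simp only [mul_apply_eq_comp, smul_apply, add_apply, sub_apply, one_apply_eq_self, hV, hD, hW,
      map_add, map_smul, map_zero, smul_zero, smul_smul, smul_add, sub_add_cancel,
      add_sub_cancel_right,
      zpow_add_one₀ q0, zpow_add_one₀ γ0, zpow_add_one₀ lam0, zpow_add_one₀ ς0,
      zpow_sub_one₀ q0, zpow_sub_one₀ γ0, zpow_sub_one₀ lam0, zpow_sub_one₀ ς0] <;>
    match_scalars <;> field_simp <;> ring

theorem exists_PsiS₂ (hq : p.q < 1)
    (ρ : NCTorus.{u} (p.torusParam .s₂) →⋆ₐ[ℂ] (K →L[ℂ] K))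
    [Nontrivial K] :
    ∃ π : CU.{u} p →⋆ₐ[ℂ] (L2 1 K →L[ℂ] L2 1 K), p.IsPsiS₂ ρ π := by
  have := nontrivial_L2 1 K
  have h := p.s2_isUqTuple hq rfl rfl rfl rfl (TorusTriple.of_rep (p.norm_torusParam .s₂) ρ
    (by simp [torusParam, conj_θ]) (by simp [torusParam, conj_θ]) (by simp [torusParam, conj_θ]))
  obtain ⟨π, hπ, hD⟩ := p.exists_hom h
  rw [star_star] at hD
  refine ⟨π, ?_, ?_, ?_, ?_, ?_, ?_, ?_, ?_, ?_, ?_⟩ <;> intros <;>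
    simp only [hπ, hD, s2V, s2D, Matrix.cons_val, add_apply, mul_apply_eq_comp, smul_apply,
      lowOp_δ, star_lowOp_δ, hq, qOp_δ, phOp_δ, ampOp_δ, update_fin_one, map_smul, smul_smul,
      δ_smul, map_mul, map_star, Circle.coe_mul, Circle.coe_inv, coe_θc, conj_θ] <;>
    match_scalars <;> ring

end OneFactor

end UqParam

/-! ### The operators of `ψ_{s₂s₁}` -/

namespace UqParam

section TwoFactors

variable (p : UqParam) (hq : p.q < 1) {K : Type u} [NormedAddCommGroup K] [InnerProductSpace ℂ K]
  [CompleteSpace K] (W X Y : K →L[ℂ] K)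

local notation "𝖠" i => (UqParam.lowOp p i : L2 2 K →L[ℂ] L2 2 K)
local notation "𝖠⋆" i => (star (UqParam.lowOp p i) : L2 2 K →L[ℂ] L2 2 K)
local notation "𝖰" i => (UqParam.qOp p hq i : L2 2 K →L[ℂ] L2 2 K)
local notation "𝖯" => (UqParam.phOp : Fin 2 → Circle → L2 2 K →L[ℂ] L2 2 K)
local notation "𝖳" => (UqParam.ampOp : (K →L[ℂ] K) → L2 2 K →L[ℂ] L2 2 K)

/-- The matrix of the operators `ψ_{s₂s₁,ρ}(V_{i,j})`, where `W, X, Y` are the images of the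
generators of the torus under `ρ`. -/
noncomputable def s21V : Fin 3 → Fin 3 → (L2 2 K →L[ℂ] L2 2 K) := ![
  ![𝖠 1, (-p.q : ℂ) • (𝖯 0 (p.θc 2 1 * (p.θc 2 0)⁻¹) * (𝖰 1) * 𝖯 1 (p.θc 1 0) * 𝖳 X), 0],
  ![p.θ 1 0 • ((𝖠 0) * 𝖯 0 (p.θc 2 0 * (p.θc 2 1)⁻¹) * (𝖰 1) * 𝖯 1 (p.θc 1 0)⁻¹ *
      𝖳 (W * star X)),
    (𝖠 0) * (𝖠⋆ 1) * 𝖳 W,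
    (-p.q : ℂ) • ((𝖰 0) * 𝖯 0 (p.θc 2 1)⁻¹ * 𝖯 1 (p.θc 2 0 * (p.θc 1 0)⁻¹) * 𝖳 Y)],
  ![(p.θ 2 0 * p.θ 1 0) • ((𝖰 0) * 𝖯 0 (p.θc 2 0) * (𝖰 1) * 𝖯 1 (p.θc 2 0)⁻¹ *
      𝖳 (W * star X * star Y)),
    (p.θ 1 0 * (p.θ 2 0)⁻¹ * (p.θ 2 1)⁻¹) • ((𝖰 0) * 𝖯 0 (p.θc 2 1) * (𝖠⋆ 1) *
      𝖯 1 (p.θc 1 0 * (p.θc 2 0)⁻¹) * 𝖳 (star Y * W)),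
    𝖠⋆ 0]]

/-- The operator `ψ_{s₂s₁,ρ}(D)`. -/
noncomputable def s21D : L2 2 K →L[ℂ] L2 2 K :=
  ampOp W

variable {W X Y}

theorem s21V_ket (m n : ℤ) (x : K) {q γ lam ς : ℂ} (hqq : q = p.q) (hγ : γ = p.γ)
    (hl : lam = p.lam) (hς : ς = p.ς) :
    p.s21V hq W X Y 0 0 (p.ket ![m, n] x) =
      p.ket ![m, n - 1] x ∧
    p.s21V hq W X Y 0 1 (p.ket ![m, n] x) =
      (-(ς ^ m * (lam ^ m)⁻¹ * (q ^ n * q * γ ^ n))) • p.ket ![m, n] (X x) ∧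
    p.s21V hq W X Y 0 2 (p.ket ![m, n] x) =
      0 ∧
    p.s21V hq W X Y 1 0 (p.ket ![m, n] x) =
      (γ * (lam ^ m * (ς ^ m)⁻¹) * (q ^ n * (γ ^ n)⁻¹)) • p.ket ![m - 1, n] (W (star X x)) ∧
    p.s21V hq W X Y 1 1 (p.ket ![m, n] x) =
      (1 - (q ^ n * q) ^ 2) • p.ket ![m - 1, n + 1] (W x) ∧
    p.s21V hq W X Y 1 2 (p.ket ![m, n] x) =
      (-(q ^ m * q * (ς ^ m)⁻¹ * (lam ^ n * (γ ^ n)⁻¹))) • p.ket ![m, n] (Y x) ∧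
    p.s21V hq W X Y 2 0 (p.ket ![m, n] x) =
      (lam * γ * (q ^ m * lam ^ m) * (q ^ n * (lam ^ n)⁻¹)) •
        p.ket ![m, n] (W (star X (star Y x))) ∧
    p.s21V hq W X Y 2 1 (p.ket ![m, n] x) =
      (γ * lam⁻¹ * ς⁻¹ * (q ^ m * ς ^ m) * ((1 - (q ^ n * q) ^ 2) * (γ ^ n * (lam ^ n)⁻¹))) •
        p.ket ![m, n + 1] (star Y (W x)) ∧
    p.s21V hq W X Y 2 2 (p.ket ![m, n] x) =
      (1 - (q ^ m * q) ^ 2) • p.ket ![m + 1, n] x := by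
  subst hqq hγ hl hς
  refine ⟨?_, ?_, ?_, ?_, ?_, ?_, ?_, ?_, ?_⟩ <;>
    simp only [s21V, Matrix.cons_val, add_apply, mul_apply_eq_comp, smul_apply, zero_apply,
      lowOp_ket, star_lowOp_ket, hq, qOp_ket, phOp_ket, ampOp_ket,
      star_qOp_ket, star_phOp_ket, star_ampOp_ket, update_fin_two, map_smul, smul_smul,
      Circle.coe_mul, Circle.coe_inv, coe_θc, mul_zpow, inv_zpow, mul_inv, inv_inv] <;>
    match_scalars <;> ring

theorem s21D_ket (m n : ℤ) (x : K) :
    s21D W (p.ket ![m, n] x) = p.ket ![m, n] (W x) ∧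
    star (s21D W) (p.ket ![m, n] x) = p.ket ![m, n] (star W x) := by
  constructor <;>
    simp only [s21D, mul_apply_eq_comp, star_mul, phOp_ket, ampOp_ket,
      star_phOp_ket, star_ampOp_ket, update_fin_two, map_smul, smul_smul,
      Circle.coe_mul, Circle.coe_inv, coe_θc, mul_zpow, inv_zpow, mul_inv, inv_inv]

set_option maxHeartbeats 4000000 in
theorem s21_isUqTuple {q γ lam ς : ℂ} (hqq : q = p.q) (hγ : γ = p.γ)
    (hl : lam = p.lam) (hς : ς = p.ς)
    (hT : TorusTriple W X Y (γ ^ 2 * lam * ς⁻¹) (γ⁻¹ * lam * ς ^ 2) (ς * γ⁻¹)) :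
    p.IsUqTuple (p.s21V hq W X Y) (star (s21D W)) := by
  have hV := fun m n x => p.s21V_ket hq (W := W) (X := X) (Y := Y) m n x hqq hγ hl hς
  have hD := fun m n x => p.s21D_ket (W := W) m n x
  obtain ⟨⟨q0, γ0, lam0, ς0⟩, cq, cγ, cl, cς⟩ := p.scalar_facts hqq hγ hl hς
  have hW := hT.apply_eq
  refine p.isUqTuple_of hqq hγ hl hς ?row ?col ?anti ?diag ?det ?unit ?mul_star ?star
  case' star =>
    simp only [List.forall_mem_cons, List.mem_nil_iff, false_imp_iff, imp_true_iff, and_true]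
    -- the adjoints are expanded before `D` is applied, since they do not occur among the `V_{i,j}`
    constructorm* _ ∧ _ <;> refine p.ext_ket_two hq fun m n x => ?_ <;>
    rw [mul_apply_eq_comp] <;>
    conv_lhs =>
      enter [2]
      simp only [s21V, Matrix.cons_val, add_apply, mul_apply_eq_comp, smul_apply, zero_apply,
        star_add, star_mul, star_smul, star_star, star_zero,
        lowOp_ket, star_lowOp_ket, hq, qOp_ket, phOp_ket, ampOp_ket,
        star_qOp_ket, star_phOp_ket, star_ampOp_ket, update_fin_two, map_smul, smul_smul,
        Circle.coe_mul, Circle.coe_inv, coe_θc, mul_zpow, inv_zpow, mul_inv, inv_inv,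
        Complex.star_def, map_neg, map_mul, map_inv₀, map_pow, cq, cγ, cl, cς,
        ← hqq, ← hγ, ← hl, ← hς]
  case' row => rw [forall_fin_three]
  case' col => rw [forall_fin_three]
  case' anti =>
    simp only [List.forall_mem_cons, List.mem_nil_iff, false_imp_iff, imp_true_iff, and_true]
  case' diag =>
    simp only [List.forall_mem_cons, List.mem_nil_iff, false_imp_iff, imp_true_iff, and_true]
  case' mul_star => simp only [forall_fin_three, Matrix.cons_val]
  -- on rescaled basis vectors each relation is an identity of rational functions in `q, γ, λ, ς`
  -- and their powers with exponents in the indices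
  all_goals
    (try constructorm* _ ∧ _) <;> (try refine p.ext_ket_two hq fun m n x => ?_) <;>
    simp only [mul_apply_eq_comp, smul_apply, add_apply, sub_apply, one_apply_eq_self, hV, hD, hW,
      map_add, map_smul, map_zero, smul_zero, smul_smul, smul_add, sub_add_cancel,
      add_sub_cancel_right,
      zpow_add_one₀ q0, zpow_add_one₀ γ0, zpow_add_one₀ lam0, zpow_add_one₀ ς0,
      zpow_sub_one₀ q0, zpow_sub_one₀ γ0, zpow_sub_one₀ lam0, zpow_sub_one₀ ς0] <;>
    match_scalars <;> field_simp <;> ring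

theorem exists_PsiS₂S₁ (hq : p.q < 1)
    (ρ : NCTorus.{u} (p.torusParam .s₂s₁) →⋆ₐ[ℂ] (K →L[ℂ] K))
    [Nontrivial K] :
    ∃ π : CU.{u} p →⋆ₐ[ℂ] (L2 2 K →L[ℂ] L2 2 K), p.IsPsiS₂S₁ ρ π := by
  have := nontrivial_L2 2 K
  have h := p.s21_isUqTuple hq rfl rfl rfl rfl (TorusTriple.of_rep (p.norm_torusParam .s₂s₁) ρ
    (by simp [torusParam, conj_θ]) (by simp [torusParam, conj_θ]) (by simp [torusParam, conj_θ]))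
  obtain ⟨π, hπ, hD⟩ := p.exists_hom h
  rw [star_star] at hD
  refine ⟨π, ?_, ?_, ?_, ?_, ?_, ?_, ?_, ?_, ?_, ?_⟩ <;> intros <;>
    simp only [hπ, hD, s21V, s21D, Matrix.cons_val, add_apply, mul_apply_eq_comp, smul_apply,
      lowOp_δ, star_lowOp_δ, hq, qOp_δ, phOp_δ, ampOp_δ, update_fin_two, map_smul, smul_smul,
      δ_smul, map_mul, map_star, Circle.coe_mul, Circle.coe_inv, coe_θc, conj_θ] <;>
    match_scalars <;> ring

end TwoFactors

end UqParam

/-! ### The operators of `ψ_{s₁s₂}` -/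

namespace UqParam

section TwoFactors

variable (p : UqParam) (hq : p.q < 1) {K : Type u} [NormedAddCommGroup K] [InnerProductSpace ℂ K]
  [CompleteSpace K] (W X Y : K →L[ℂ] K)

local notation "𝖠" i => (UqParam.lowOp p i : L2 2 K →L[ℂ] L2 2 K)
local notation "𝖠⋆" i => (star (UqParam.lowOp p i) : L2 2 K →L[ℂ] L2 2 K)
local notation "𝖰" i => (UqParam.qOp p hq i : L2 2 K →L[ℂ] L2 2 K)
local notation "𝖯" => (UqParam.phOp : Fin 2 → Circle → L2 2 K →L[ℂ] L2 2 K)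
local notation "𝖳" => (UqParam.ampOp : (K →L[ℂ] K) → L2 2 K →L[ℂ] L2 2 K)

/-- The matrix of the operators `ψ_{s₁s₂,ρ}(V_{i,j})`, where `W, X, Y` are the images of the
generators of the torus under `ρ`. -/
noncomputable def s12V : Fin 3 → Fin 3 → (L2 2 K →L[ℂ] L2 2 K) := ![
  ![𝖠 1,
    (-((p.θ 2 1)⁻¹ * p.θ 2 0 * p.θ 1 0 * p.q)) • ((𝖠 0) * 𝖯 0 ((p.θc 2 0)⁻¹ * p.θc 2 1) * (𝖰 1) *
      𝖯 1 (p.θc 1 0) * 𝖳 (star W * Y)),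
    (p.θ 2 0 * p.θ 2 1 * p.q ^ 2) • ((𝖰 0) * 𝖯 0 (p.θc 2 0)⁻¹ * (𝖰 1) * 𝖯 1 (p.θc 2 0) *
      𝖳 (star W * star X * Y))],
  ![𝖯 0 (p.θc 2 0 * (p.θc 2 1)⁻¹) * (𝖰 1) * 𝖯 1 (p.θc 1 0)⁻¹ * 𝖳 W,
    (𝖠 0) * (𝖠⋆ 1) * 𝖳 Y,
    (-(p.θ 2 0 * p.θ 2 1 * (p.θ 1 0)⁻¹ * p.q)) • ((𝖰 0) * 𝖯 0 (p.θc 2 1)⁻¹ * (𝖠⋆ 1) *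
      𝖯 1 (p.θc 2 0 * (p.θc 1 0)⁻¹) * 𝖳 (star X * Y))],
  ![0, (𝖰 0) * 𝖯 0 (p.θc 2 1) * 𝖯 1 (p.θc 1 0 * (p.θc 2 0)⁻¹) * 𝖳 X, 𝖠⋆ 0]]

/-- The operator `ψ_{s₁s₂,ρ}(D)`. -/
noncomputable def s12D : L2 2 K →L[ℂ] L2 2 K :=
  ampOp Y

variable {W X Y}

theorem s12V_ket (m n : ℤ) (x : K) {q γ lam ς : ℂ} (hqq : q = p.q) (hγ : γ = p.γ)
    (hl : lam = p.lam) (hς : ς = p.ς) :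
    p.s12V hq W X Y 0 0 (p.ket ![m, n] x) =
      p.ket ![m, n - 1] x ∧
    p.s12V hq W X Y 0 1 (p.ket ![m, n] x) =
      (-(ς⁻¹ * lam * γ * ((lam ^ m)⁻¹ * ς ^ m) * (q ^ n * q * γ ^ n))) •
        p.ket ![m - 1, n] (star W (Y x)) ∧
    p.s12V hq W X Y 0 2 (p.ket ![m, n] x) =
      (lam * ς * (q ^ m * q * (lam ^ m)⁻¹) * (q ^ n * q * lam ^ n)) •
        p.ket ![m, n] (star W (star X (Y x))) ∧
    p.s12V hq W X Y 1 0 (p.ket ![m, n] x) =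
      (lam ^ m * (ς ^ m)⁻¹ * (q ^ n * (γ ^ n)⁻¹)) • p.ket ![m, n] (W x) ∧
    p.s12V hq W X Y 1 1 (p.ket ![m, n] x) =
      (1 - (q ^ n * q) ^ 2) • p.ket ![m - 1, n + 1] (Y x) ∧
    p.s12V hq W X Y 1 2 (p.ket ![m, n] x) =
      (-(lam * ς * γ⁻¹ * (q ^ m * q * (ς ^ m)⁻¹) *
          ((1 - (q ^ n * q) ^ 2) * (lam ^ n * (γ ^ n)⁻¹)))) •
        p.ket ![m, n + 1] (star X (Y x)) ∧
    p.s12V hq W X Y 2 0 (p.ket ![m, n] x) =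
      0 ∧
    p.s12V hq W X Y 2 1 (p.ket ![m, n] x) =
      (q ^ m * ς ^ m * (γ ^ n * (lam ^ n)⁻¹)) • p.ket ![m, n] (X x) ∧
    p.s12V hq W X Y 2 2 (p.ket ![m, n] x) =
      (1 - (q ^ m * q) ^ 2) • p.ket ![m + 1, n] x := by
  subst hqq hγ hl hς
  refine ⟨?_, ?_, ?_, ?_, ?_, ?_, ?_, ?_, ?_⟩ <;>
    simp only [s12V, Matrix.cons_val, add_apply, mul_apply_eq_comp, smul_apply, zero_apply,
      lowOp_ket, star_lowOp_ket, hq, qOp_ket, phOp_ket, ampOp_ket,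
      star_qOp_ket, star_phOp_ket, star_ampOp_ket, update_fin_two, map_smul, smul_smul,
      Circle.coe_mul, Circle.coe_inv, coe_θc, mul_zpow, inv_zpow, mul_inv, inv_inv] <;>
    match_scalars <;> ring

theorem s12D_ket (m n : ℤ) (x : K) :
    s12D Y (p.ket ![m, n] x) = p.ket ![m, n] (Y x) ∧
    star (s12D Y) (p.ket ![m, n] x) = p.ket ![m, n] (star Y x) := by
  constructor <;>
    simp only [s12D, mul_apply_eq_comp, star_mul, phOp_ket, ampOp_ket,
      star_phOp_ket, star_ampOp_ket, update_fin_two, map_smul, smul_smul,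
      Circle.coe_mul, Circle.coe_inv, coe_θc, mul_zpow, inv_zpow, mul_inv, inv_inv]

set_option maxHeartbeats 4000000 in
theorem s12_isUqTuple {q γ lam ς : ℂ} (hqq : q = p.q) (hγ : γ = p.γ)
    (hl : lam = p.lam) (hς : ς = p.ς)
    (hT : TorusTriple W X Y (γ * ς⁻¹) (γ ^ 2 * ς⁻¹ * lam) (γ⁻¹ * ς ^ 2 * lam)) :
    p.IsUqTuple (p.s12V hq W X Y) (star (s12D Y)) := by
  have hV := fun m n x => p.s12V_ket hq (W := W) (X := X) (Y := Y) m n x hqq hγ hl hς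
  have hD := fun m n x => p.s12D_ket (Y := Y) m n x
  obtain ⟨⟨q0, γ0, lam0, ς0⟩, cq, cγ, cl, cς⟩ := p.scalar_facts hqq hγ hl hς
  have hW := hT.apply_eq
  refine p.isUqTuple_of hqq hγ hl hς ?row ?col ?anti ?diag ?det ?unit ?mul_star ?star
  case' star =>
    simp only [List.forall_mem_cons, List.mem_nil_iff, false_imp_iff, imp_true_iff, and_true]
    -- the adjoints are expanded before `D` is applied, since they do not occur among the `V_{i,j}`
    constructorm* _ ∧ _ <;> refine p.ext_ket_two hq fun m n x => ?_ <;>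
    rw [mul_apply_eq_comp] <;>
    conv_lhs =>
      enter [2]
      simp only [s12V, Matrix.cons_val, add_apply, mul_apply_eq_comp, smul_apply, zero_apply,
        star_add, star_mul, star_smul, star_star, star_zero,
        lowOp_ket, star_lowOp_ket, hq, qOp_ket, phOp_ket, ampOp_ket,
        star_qOp_ket, star_phOp_ket, star_ampOp_ket, update_fin_two, map_smul, smul_smul,
        Circle.coe_mul, Circle.coe_inv, coe_θc, mul_zpow, inv_zpow, mul_inv, inv_inv,
        Complex.star_def, map_neg, map_mul, map_inv₀, map_pow, cq, cγ, cl, cς,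
        ← hqq, ← hγ, ← hl, ← hς]
  case' row => rw [forall_fin_three]
  case' col => rw [forall_fin_three]
  case' anti =>
    simp only [List.forall_mem_cons, List.mem_nil_iff, false_imp_iff, imp_true_iff, and_true]
  case' diag =>
    simp only [List.forall_mem_cons, List.mem_nil_iff, false_imp_iff, imp_true_iff, and_true]
  case' mul_star => simp only [forall_fin_three, Matrix.cons_val]
  -- on rescaled basis vectors each relation is an identity of rational functions in `q, γ, λ, ς`
  -- and their powers with exponents in the indices
  all_goals
    (try constructorm* _ ∧ _) <;> (try refine p.ext_ket_two hq fun m n x => ?_) <;>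
    simp only [mul_apply_eq_comp, smul_apply, add_apply, sub_apply, one_apply_eq_self, hV, hD, hW,
      map_add, map_smul, map_zero, smul_zero, smul_smul, smul_add, sub_add_cancel,
      add_sub_cancel_right,
      zpow_add_one₀ q0, zpow_add_one₀ γ0, zpow_add_one₀ lam0, zpow_add_one₀ ς0,
      zpow_sub_one₀ q0, zpow_sub_one₀ γ0, zpow_sub_one₀ lam0, zpow_sub_one₀ ς0] <;>
    match_scalars <;> field_simp <;> ring

theorem exists_PsiS₁S₂ (hq : p.q < 1)
    (ρ : NCTorus.{u} (p.torusParam .s₁s₂) →⋆ₐ[ℂ] (K →L[ℂ] K))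
    [Nontrivial K] :
    ∃ π : CU.{u} p →⋆ₐ[ℂ] (L2 2 K →L[ℂ] L2 2 K), p.IsPsiS₁S₂ ρ π := by
  have := nontrivial_L2 2 K
  have h := p.s12_isUqTuple hq rfl rfl rfl rfl (TorusTriple.of_rep (p.norm_torusParam .s₁s₂) ρ
    (by simp [torusParam, conj_θ]) (by simp [torusParam, conj_θ]) (by simp [torusParam, conj_θ]))
  obtain ⟨π, hπ, hD⟩ := p.exists_hom h
  rw [star_star] at hD
  refine ⟨π, ?_, ?_, ?_, ?_, ?_, ?_, ?_, ?_, ?_, ?_⟩ <;> intros <;>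
    simp only [hπ, hD, s12V, s12D, Matrix.cons_val, add_apply, mul_apply_eq_comp, smul_apply,
      lowOp_δ, star_lowOp_δ, hq, qOp_δ, phOp_δ, ampOp_δ, update_fin_two, map_smul, smul_smul,
      δ_smul, map_mul, map_star, Circle.coe_mul, Circle.coe_inv, coe_θc, conj_θ] <;>
    match_scalars <;> ring

end TwoFactors

end UqParam

/-! ### The operators of `ψ_{s₂s₁s₂}` -/

namespace UqParam

section ThreeFactors

variable (p : UqParam) (hq : p.q < 1) {K : Type u} [NormedAddCommGroup K] [InnerProductSpace ℂ K]
  [CompleteSpace K] (W X Y : K →L[ℂ] K)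

local notation "𝖠" i => (UqParam.lowOp p i : L2 3 K →L[ℂ] L2 3 K)
local notation "𝖠⋆" i => (star (UqParam.lowOp p i) : L2 3 K →L[ℂ] L2 3 K)
local notation "𝖰" i => (UqParam.qOp p hq i : L2 3 K →L[ℂ] L2 3 K)
local notation "𝖯" => (UqParam.phOp : Fin 3 → Circle → L2 3 K →L[ℂ] L2 3 K)
local notation "𝖳" => (UqParam.ampOp : (K →L[ℂ] K) → L2 3 K →L[ℂ] L2 3 K)

/-- The matrix of the operators `ψ_{s₂s₁s₂,ρ}(V_{i,j})`, where `W, X, Y` are the images of the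
generators of the torus under `ρ`. -/
noncomputable def longV : Fin 3 → Fin 3 → (L2 3 K →L[ℂ] L2 3 K) := ![
  ![(𝖠 1),
    (p.q : ℂ) • (𝖯 0 (p.θc 1 0) * 𝖯 0 (p.θc 1 0) * (𝖰 1) * 𝖯 1 (p.θc 1 0) * (𝖠 2)),
    (p.q ^ 2 : ℂ) • (𝖯 0 (p.θc 2 0 * p.θc 1 0) * (𝖰 1) * 𝖯 1 (p.θc 2 0) *
      (𝖰 2) * 𝖯 2 (p.θc 2 1) * 𝖳 X)],
  ![(𝖠 0) * (𝖰 1) * 𝖯 1 (p.θc 1 0)⁻¹,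
    (-(p.θ 1 0)⁻¹) • ((𝖠 0) * 𝖯 0 (p.θc 1 0) * 𝖯 0 (p.θc 1 0) * (𝖠⋆ 1) *
        (𝖠 2)) +
      (-(p.q * p.θ 2 0) : ℂ) • ((𝖰 0) * 𝖯 0 (p.θc 1 0) * (𝖰 2) *
        𝖯 2 (p.θc 1 0)⁻¹ * 𝖳 (star X * star Y * W)),
    (p.q * p.θ 2 0 * p.θ 2 1 : ℂ) • ((𝖰 0) * 𝖯 0 (p.θc 2 0) *
        𝖯 1 (p.θc 2 0 * (p.θc 1 0)⁻¹) * (𝖠⋆ 2) * 𝖯 2 ((p.θc 1 0)⁻¹ * p.θc 2 1) *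
        𝖳 (star Y * W)) +
      (-(p.q * (p.θ 1 0)⁻¹) : ℂ) • ((𝖠 0) * 𝖯 0 (p.θc 2 0 * p.θc 1 0) * (𝖠⋆ 1) *
        𝖯 1 (p.θc 2 0 * (p.θc 1 0)⁻¹) * (𝖰 2) * 𝖯 2 (p.θc 2 1) * 𝖳 X)],
  ![(𝖰 0) * 𝖯 0 (p.θc 2 1)⁻¹ * (𝖰 1) * 𝖯 1 (p.θc 2 0)⁻¹ *
      𝖯 2 ((p.θc 1 0)⁻¹ * (p.θc 2 0)⁻¹) * 𝖳 Y,
    ((p.θ 2 0)⁻¹ * (p.θ 2 1)⁻¹ : ℂ) • ((𝖠⋆ 0) * 𝖯 0 (p.θc 1 0 * (p.θc 2 1)⁻¹) *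
        𝖯 1 (p.θc 1 0 * (p.θc 2 0)⁻¹) * (𝖰 2) *
        𝖯 2 ((p.θc 1 0)⁻¹ * (p.θc 1 0)⁻¹ * (p.θc 2 0)⁻¹) * 𝖳 (star X * W)) +
      (-(p.θ 1 0)) • ((𝖰 0) * 𝖯 0 (p.θc 1 0 * p.θc 1 0 * (p.θc 2 1)⁻¹) *
        (𝖠⋆ 1) * 𝖯 1 (p.θc 1 0 * (p.θc 2 0)⁻¹) * (𝖠 2) *
        𝖯 2 ((p.θc 1 0)⁻¹ * (p.θc 2 0)⁻¹) * 𝖳 Y),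
    (-(p.θ 1 0)⁻¹ : ℂ) • ((𝖠⋆ 0) * 𝖯 0 (p.θc 2 0 * (p.θc 2 1)⁻¹) *
        (𝖠⋆ 2) * 𝖯 2 ((p.θc 1 0)⁻¹ * (p.θc 1 0)⁻¹ * (p.θc 2 0)⁻¹ * p.θc 2 1) *
        𝖳 W) +
      (-(p.q * p.θ 2 0) : ℂ) • ((𝖰 0) * 𝖯 0 (p.θc 1 0 * p.θc 2 0 * (p.θc 2 1)⁻¹) *
        (𝖠⋆ 1) * (𝖰 2) * 𝖯 2 ((p.θc 1 0)⁻¹ * (p.θc 2 0)⁻¹ * p.θc 2 1) *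
        𝖳 (X * Y))]]

/-- The operator `ψ_{s₂s₁s₂,ρ}(D)`. -/
noncomputable def longD : L2 3 K →L[ℂ] L2 3 K :=
  𝖯 0 (p.θc 1 0 * p.θc 1 0 * p.θc 2 0 * (p.θc 2 1)⁻¹) *
    𝖯 2 ((p.θc 1 0)⁻¹ * (p.θc 1 0)⁻¹ * (p.θc 2 0)⁻¹ * p.θc 2 1) * 𝖳 W

variable {W X Y}

theorem longV_ket (m n l : ℤ) (x : K) {q γ lam ς : ℂ} (hqq : q = p.q) (hγ : γ = p.γ)
    (hl : lam = p.lam) (hς : ς = p.ς) :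
    p.longV hq W X Y 0 0 (p.ket ![m, n, l] x) =
      p.ket ![m, n - 1, l] x ∧
    p.longV hq W X Y 0 1 (p.ket ![m, n, l] x) =
      ((γ ^ m) ^ 2 * (q ^ n * q * γ ^ n)) • p.ket ![m, n, l - 1] x ∧
    p.longV hq W X Y 0 2 (p.ket ![m, n, l] x) =
      (lam ^ m * γ ^ m * (q ^ n * q * lam ^ n) * (q ^ l * q * ς ^ l)) • p.ket ![m, n, l] (X x) ∧
    p.longV hq W X Y 1 0 (p.ket ![m, n, l] x) =
      (q ^ n * (γ ^ n)⁻¹) • p.ket ![m - 1, n, l] x ∧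
    p.longV hq W X Y 1 1 (p.ket ![m, n, l] x) =
      (-(γ⁻¹ * (γ ^ m) ^ 2 * (1 - (q ^ n * q) ^ 2))) • p.ket ![m - 1, n + 1, l - 1] x +
      (-(q * lam * (q ^ m * γ ^ m) * (q ^ l * (γ ^ l)⁻¹))) •
        p.ket ![m, n, l] (star X (star Y (W x))) ∧
    p.longV hq W X Y 1 2 (p.ket ![m, n, l] x) =
      (q * lam * ς * (q ^ m * lam ^ m) * (lam ^ n * (γ ^ n)⁻¹) *
        ((1 - (q ^ l * q) ^ 2) * ((γ ^ l)⁻¹ * ς ^ l))) • p.ket ![m, n, l + 1] (star Y (W x)) +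
      (-(q * γ⁻¹ * (lam ^ m * γ ^ m) * ((1 - (q ^ n * q) ^ 2) * (lam ^ n * (γ ^ n)⁻¹)) *
        (q ^ l * ς ^ l))) • p.ket ![m - 1, n + 1, l] (X x) ∧
    p.longV hq W X Y 2 0 (p.ket ![m, n, l] x) =
      (q ^ m * (ς ^ m)⁻¹ * (q ^ n * (lam ^ n)⁻¹) * ((γ ^ l)⁻¹ * (lam ^ l)⁻¹)) •
        p.ket ![m, n, l] (Y x) ∧
    p.longV hq W X Y 2 1 (p.ket ![m, n, l] x) =
      (lam⁻¹ * ς⁻¹ * ((1 - (q ^ m * q) ^ 2) * (γ ^ m * (ς ^ m)⁻¹)) * (γ ^ n * (lam ^ n)⁻¹) *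
        (q ^ l * ((γ ^ l)⁻¹ ^ 2 * (lam ^ l)⁻¹))) • p.ket ![m + 1, n, l] (star X (W x)) +
      (-(γ * (q ^ m * ((γ ^ m) ^ 2 * (ς ^ m)⁻¹)) * ((1 - (q ^ n * q) ^ 2) * (γ ^ n * (lam ^ n)⁻¹)) *
        ((γ ^ l)⁻¹ * (lam ^ l)⁻¹))) • p.ket ![m, n + 1, l - 1] (Y x) ∧
    p.longV hq W X Y 2 2 (p.ket ![m, n, l] x) =
      (-(γ⁻¹ * ((1 - (q ^ m * q) ^ 2) * (lam ^ m * (ς ^ m)⁻¹)) *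
        ((1 - (q ^ l * q) ^ 2) * ((γ ^ l)⁻¹ ^ 2 * (lam ^ l)⁻¹ * ς ^ l)))) •
          p.ket ![m + 1, n, l + 1] (W x) +
      (-(q * lam * (q ^ m * (γ ^ m * lam ^ m * (ς ^ m)⁻¹)) * (1 - (q ^ n * q) ^ 2) *
        (q ^ l * ((γ ^ l)⁻¹ * (lam ^ l)⁻¹ * ς ^ l)))) • p.ket ![m, n + 1, l] (X (Y x)) := by
  subst hqq hγ hl hς
  refine ⟨?_, ?_, ?_, ?_, ?_, ?_, ?_, ?_, ?_⟩ <;>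
    simp only [longV, Matrix.cons_val, add_apply, mul_apply_eq_comp, smul_apply, zero_apply,
      lowOp_ket, star_lowOp_ket, hq, qOp_ket, phOp_ket, ampOp_ket,
      star_qOp_ket, star_phOp_ket, star_ampOp_ket, update_fin_three, map_smul, smul_smul,
      Circle.coe_mul, Circle.coe_inv, coe_θc, mul_zpow, inv_zpow, mul_inv, inv_inv] <;>
    match_scalars <;> ring

theorem longD_ket (m n l : ℤ) (x : K) {γ lam ς : ℂ} (hγ : γ = p.γ)
    (hl : lam = p.lam) (hς : ς = p.ς) :
    p.longD W (p.ket ![m, n, l] x) = ((γ ^ m) ^ 2 * lam ^ m * (ς ^ m)⁻¹ *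
      ((γ ^ l)⁻¹ ^ 2 * (lam ^ l)⁻¹ * ς ^ l)) • p.ket ![m, n, l] (W x) ∧
    star (p.longD W) (p.ket ![m, n, l] x) = ((γ ^ l) ^ 2 * lam ^ l * (ς ^ l)⁻¹ *
      ((γ ^ m)⁻¹ ^ 2 * (lam ^ m)⁻¹ * ς ^ m)) • p.ket ![m, n, l] (star W x) := by
  subst hγ hl hς
  constructor <;>
    simp only [longD, Matrix.cons_val, mul_apply_eq_comp, star_mul, phOp_ket, ampOp_ket,
      star_phOp_ket, star_ampOp_ket, update_fin_three, map_smul, smul_smul,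
      Circle.coe_mul, Circle.coe_inv, coe_θc, mul_zpow, inv_zpow, mul_inv, inv_inv] <;>
    match_scalars <;> ring

set_option maxHeartbeats 4000000 in
theorem long_isUqTuple {q γ lam ς : ℂ} (hqq : q = p.q) (hγ : γ = p.γ)
    (hl : lam = p.lam) (hς : ς = p.ς)
    (hT : TorusTriple W X Y (γ * lam ^ 2 * ς) (γ⁻¹ * lam⁻¹ ^ 2 * ς⁻¹) (lam⁻¹ ^ 2)) :
    p.IsUqTuple (p.longV hq W X Y) (star (p.longD W)) := by
  have hV := fun m n l x => p.longV_ket hq (W := W) (X := X) (Y := Y) m n l x hqq hγ hl hς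
  have hD := fun m n l x => p.longD_ket (W := W) m n l x hγ hl hς
  obtain ⟨⟨q0, γ0, lam0, ς0⟩, cq, cγ, cl, cς⟩ := p.scalar_facts hqq hγ hl hς
  have hW := hT.apply_eq
  refine p.isUqTuple_of hqq hγ hl hς ?row ?col ?anti ?diag ?det ?unit ?mul_star ?star
  case' star =>
    simp only [List.forall_mem_cons, List.mem_nil_iff, false_imp_iff, imp_true_iff, and_true]
    -- the adjoints are expanded before `D` is applied, since they do not occur among the `V_{i,j}`
    constructorm* _ ∧ _ <;> refine p.ext_ket_three hq fun m n l x => ?_ <;>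
    rw [mul_apply_eq_comp] <;>
    conv_lhs =>
      enter [2]
      simp only [longV, Matrix.cons_val, add_apply, mul_apply_eq_comp, smul_apply, zero_apply,
        star_add, star_mul, star_smul, star_star, star_zero,
        lowOp_ket, star_lowOp_ket, hq, qOp_ket, phOp_ket, ampOp_ket,
        star_qOp_ket, star_phOp_ket, star_ampOp_ket, update_fin_three, map_smul, smul_smul,
        Circle.coe_mul, Circle.coe_inv, coe_θc, mul_zpow, inv_zpow, mul_inv, inv_inv,
        Complex.star_def, map_neg, map_mul, map_inv₀, map_pow, cq, cγ, cl, cς,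
        ← hqq, ← hγ, ← hl, ← hς]
  case' row => rw [forall_fin_three]
  case' col => rw [forall_fin_three]
  case' anti =>
    simp only [List.forall_mem_cons, List.mem_nil_iff, false_imp_iff, imp_true_iff, and_true]
  case' diag =>
    simp only [List.forall_mem_cons, List.mem_nil_iff, false_imp_iff, imp_true_iff, and_true]
  case' mul_star => simp only [forall_fin_three, Matrix.cons_val]
  -- on rescaled basis vectors each relation is an identity of rational functions in `q, γ, λ, ς`
  -- and their powers with exponents in the indices
  all_goals
    (try constructorm* _ ∧ _) <;> (try refine p.ext_ket_three hq fun m n l x => ?_) <;>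
    simp only [mul_apply_eq_comp, smul_apply, add_apply, sub_apply, one_apply_eq_self, hV, hD, hW,
      map_add, map_smul, map_zero, smul_zero, smul_smul, smul_add, sub_add_cancel,
      add_sub_cancel_right,
      zpow_add_one₀ q0, zpow_add_one₀ γ0, zpow_add_one₀ lam0, zpow_add_one₀ ς0,
      zpow_sub_one₀ q0, zpow_sub_one₀ γ0, zpow_sub_one₀ lam0, zpow_sub_one₀ ς0] <;>
    match_scalars <;> field_simp <;> ring

theorem exists_PsiS₂S₁S₂ (hq : p.q < 1)
    (ρ : NCTorus.{u} (p.torusParam .s₂s₁s₂) →⋆ₐ[ℂ] (K →L[ℂ] K))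
    [Nontrivial K] :
    ∃ π : CU.{u} p →⋆ₐ[ℂ] (L2 3 K →L[ℂ] L2 3 K), p.IsPsiS₂S₁S₂ ρ π := by
  have := nontrivial_L2 3 K
  have h := p.long_isUqTuple hq rfl rfl rfl rfl (TorusTriple.of_rep (p.norm_torusParam .s₂s₁s₂) ρ
    (by simp [torusParam, conj_θ]) (by simp [torusParam, conj_θ]) (by simp [torusParam, conj_θ]))
  obtain ⟨π, hπ, hD⟩ := p.exists_hom h
  rw [star_star] at hD
  refine ⟨π, ?_, ?_, ?_, ?_, ?_, ?_, ?_, ?_, ?_, ?_⟩ <;> intros <;>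
    simp only [hπ, hD, longV, longD, Matrix.cons_val, add_apply, mul_apply_eq_comp, smul_apply,
      lowOp_δ, star_lowOp_δ, hq, qOp_δ, phOp_δ, ampOp_δ, update_fin_three, map_smul, smul_smul,
      δ_smul, map_mul, map_star, Circle.coe_mul, Circle.coe_inv, coe_θc, conj_θ] <;>
    match_scalars <;> ring

end ThreeFactors

end UqParam

/-! ### Intertwiners -/

section Intertwiner

variable {A : Type*} [CStarAlgebra A] {a : Fin 3 → ℂ} {k : ℕ}
  {K : Type u} [NormedAddCommGroup K] [InnerProductSpace ℂ K] [CompleteSpace K]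
  {K' : Type u} [NormedAddCommGroup K'] [InnerProductSpace ℂ K'] [CompleteSpace K']

/-- The vector `n` with its `i`-th entry lowered by one. -/
def lower (n : Fin k → ℕ) (i : Fin k) : Fin k → ℕ := Function.update n i (n i - 1)

theorem sum_lower_lt {n : Fin k → ℕ} {i : Fin k} (h : n i ≠ 0) : ∑ j, lower n i j < ∑ j, n j := by
  refine Finset.sum_lt_sum (fun j _ => ?_) ⟨i, Finset.mem_univ i, ?_⟩
  · by_cases hj : j = i
    · subst hj; simp [lower]
    · simp [lower, hj]
  · simp only [lower, Function.update_self]; omega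

/-- The representation `π` on `ℓ²(ℕ)^{⊗k} ⊗ K` is generated from the vacuum vectors `e_0 ⊗ x` by the
raising elements `R i`: their adjoints annihilate the vacuum, and each `e_n ⊗ x` with `n ≠ 0` is,
up to the nonzero scalar `coef n`, the image under `R (idx n)` of the vector with the entry `idx n`
lowered by one. On the vacuum, the elements `g j` act as nonzero multiples of the generators of the
torus. The data `R, idx, coef, g, z` do not depend on `ρ`. -/
structure IsVacuumGenerated (R : Fin k → A) (idx : (Fin k → ℕ) → Fin k)
    (coef : (Fin k → ℕ) → ℂ) (g : Fin 3 → A) (z : Fin 3 → ℂ)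
    (ρ : NCTorus.{u} a →⋆ₐ[ℂ] (K →L[ℂ] K)) (π : A →⋆ₐ[ℂ] (L2 k K →L[ℂ] L2 k K)) : Prop where
  vacuum : ∀ i x, π (star (R i)) (δ 0 x) = 0
  idx_ne_zero : ∀ n : Fin k → ℕ, n ≠ 0 → n (idx n) ≠ 0
  coef_ne_zero : ∀ n : Fin k → ℕ, n ≠ 0 → coef n ≠ 0
  raise : ∀ n : Fin k → ℕ, n ≠ 0 → ∀ x, π (R (idx n)) (δ (lower n (idx n)) x) = coef n • δ n x
  z_ne_zero : ∀ j, z j ≠ 0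
  torus : ∀ j x, π (g j) (δ 0 x) = z j • δ 0 (ρ ((torusPresentation a).gen j) x)

theorem inner_rep (π : A →⋆ₐ[ℂ] (K →L[ℂ] K)) (b : A) (x y : K) :
    inner ℂ (π b x) y = inner ℂ x (π (star b) y) := by
  rw [map_star, ContinuousLinearMap.star_eq_adjoint, ContinuousLinearMap.adjoint_inner_right]

/-- An operator that intertwines two representations of the torus on the generators intertwines
them everywhere. -/
theorem torus_intertwine {ρ : NCTorus.{u} a →⋆ₐ[ℂ] (K →L[ℂ] K)}
    {ρ' : NCTorus.{u} a →⋆ₐ[ℂ] (K' →L[ℂ] K')} (t : K →L[ℂ] K')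
    (h : ∀ j x, t (ρ ((torusPresentation a).gen j) x) = ρ' ((torusPresentation a).gen j) (t x))
    (τ : NCTorus.{u} a) (x : K) : t (ρ τ x) = ρ' τ (t x) := by
  have cont : ∀ x, Continuous fun τ => t (ρ τ x) := fun x => t.continuous.comp
    ((CStarPresentation.continuous_hom ρ).clm_apply continuous_const)
  have cont' : ∀ x, Continuous fun τ => ρ' τ (t x) := fun x =>
    (CStarPresentation.continuous_hom ρ').clm_apply continuous_const
  refine (CStarPresentation.induction_gen (P := torusPresentation.{u} a)
    (p := fun τ => (∀ x, t (ρ τ x) = ρ' τ (t x)) ∧ ∀ x, t (ρ (star τ) x) = ρ' (star τ) (t x))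
    ?_ ?_ ?_ ?_ ?_ ?_ τ).1 x
  · intro j
    refine ⟨h j, fun x => ?_⟩
    -- the generators are unitary, so intertwining them implies intertwining their adjoints
    obtain ⟨h1, h2⟩ := NCTorus.gen_unitary.{u} (a := a) j
    have e1 : ∀ y, ρ ((torusPresentation a).gen j) (ρ (star ((torusPresentation a).gen j)) y) = y :=
      fun y => by rw [← mul_apply_eq_comp, ← map_mul, h2, map_one, one_apply_eq_self]
    have e2 : ∀ y,
        ρ' (star ((torusPresentation a).gen j)) (ρ' ((torusPresentation a).gen j) y) = y :=
      fun y => by rw [← mul_apply_eq_comp, ← map_mul, h1, map_one, one_apply_eq_self]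
    rw [← e2 (t _), ← h j, e1]
  · intro c
    constructor <;> intro x
    · rw [AlgHomClass.commutes, AlgHomClass.commutes, Algebra.algebraMap_eq_smul_one,
        Algebra.algebraMap_eq_smul_one]; simp
    · rw [← algebraMap_star_comm, AlgHomClass.commutes, AlgHomClass.commutes,
        Algebra.algebraMap_eq_smul_one, Algebra.algebraMap_eq_smul_one]; simp
  · rintro x y ⟨hx, hx'⟩ ⟨hy, hy'⟩
    simp only [map_add, star_add, add_apply, hx, hx', hy, hy', implies_true, and_self]
  · rintro x y ⟨hx, hx'⟩ ⟨hy, hy'⟩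
    simp only [map_mul, star_mul, mul_apply_eq_comp, hx, hx', hy, hy', implies_true, and_self]
  · rintro x ⟨hx, hx'⟩
    exact ⟨hx', by rwa [star_star]⟩
  · have e : {τ : NCTorus.{u} a | (∀ x, t (ρ τ x) = ρ' τ (t x)) ∧
        ∀ x, t (ρ (star τ) x) = ρ' (star τ) (t x)} =
        (⋂ x, {τ | t (ρ τ x) = ρ' τ (t x)}) ∩ ⋂ x, {τ | t (ρ (star τ) x) = ρ' (star τ) (t x)} := by
      ext; simp
    rw [e]
    exact (isClosed_iInter fun x => isClosed_eq (cont x) (cont' x)).inter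
      (isClosed_iInter fun x => isClosed_eq ((cont x).comp continuous_star)
        ((cont' x).comp continuous_star))

namespace IsVacuumGenerated

variable {R : Fin k → A} {idx : (Fin k → ℕ) → Fin k}
  {coef : (Fin k → ℕ) → ℂ} {g : Fin 3 → A} {z : Fin 3 → ℂ}
  {ρ : NCTorus.{u} a →⋆ₐ[ℂ] (K →L[ℂ] K)} {π : A →⋆ₐ[ℂ] (L2 k K →L[ℂ] L2 k K)}
  {ρ' : NCTorus.{u} a →⋆ₐ[ℂ] (K' →L[ℂ] K')} {π' : A →⋆ₐ[ℂ] (L2 k K' →L[ℂ] L2 k K')}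

/-- The vectors annihilated by the adjoints of the raising elements are the vacuum vectors. -/
theorem eq_δ_zero (h : IsVacuumGenerated R idx coef g z ρ π) {f : L2 k K}
    (hf : ∀ i, π (star (R i)) f = 0) : f = δ 0 (f 0) := by
  refine lp.ext (funext fun n => ?_)
  by_cases hn : n = 0
  · rw [hn, δ_apply_self]
  · have : f n = 0 := by
      refine ext_inner_left ℂ fun x => ?_
      have h1 : inner ℂ (coef n • δ n x) f = 0 := by
        rw [← h.raise n hn, inner_rep, hf, inner_zero_right]
      rw [inner_smul_left, inner_δ_left] at h1
      rw [inner_zero_right]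
      exact (mul_eq_zero.1 h1).resolve_left (by simpa using h.coef_ne_zero n hn)
    rw [this, δ, lp.single_apply, Pi.single_eq_of_ne hn]

/-- The operator on `K` induced by an operator on `ℓ²(ℕ)^{⊗k} ⊗ K` through the vacuum vectors. -/
noncomputable def vac (T : L2 k K →L[ℂ] L2 k K') : K →L[ℂ] K' :=
  lp.evalCLM ℂ (fun _ : Fin k → ℕ => K') 2 0 ∘L T ∘L
    lp.singleContinuousLinearMap ℂ (fun _ : Fin k → ℕ => K) 2 0

/-- An intertwiner has the form `1 ⊗ t`. -/
theorem intertwiner_apply (h : IsVacuumGenerated R idx coef g z ρ π)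
    (h' : IsVacuumGenerated R idx coef g z ρ' π') {T : L2 k K →L[ℂ] L2 k K'}
    (hT : ∀ b f, T (π b f) = π' b (T f)) (n : Fin k → ℕ) (x : K) :
    T (δ n x) = δ n (vac T x) := by
  induction hs : ∑ i, n i using Nat.strong_induction_on generalizing n with
  | _ s ih =>
    by_cases hn : n = 0
    · subst hn
      refine h'.eq_δ_zero fun i => ?_
      rw [← hT, h.vacuum, map_zero]
    · have h1 := ih _ (hs ▸ sum_lower_lt (h.idx_ne_zero n hn)) _ rfl
      have h2 := congrArg (π' (R (idx n))) h1
      rw [← hT, h.raise n hn, h'.raise n hn, map_smul] at h2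
      exact smul_right_injective _ (h.coef_ne_zero n hn) h2

theorem vac_intertwine (h : IsVacuumGenerated R idx coef g z ρ π)
    (h' : IsVacuumGenerated R idx coef g z ρ' π') {T : L2 k K →L[ℂ] L2 k K'}
    (hT : ∀ b f, T (π b f) = π' b (T f)) (τ : NCTorus.{u} a) (x : K) :
    vac T (ρ τ x) = ρ' τ (vac T x) := by
  refine torus_intertwine _ (fun j x => ?_) τ x
  have h1 := hT (g j) (δ 0 x)
  rw [h.torus, map_smul, intertwiner_apply h h' hT, intertwiner_apply h h' hT, h'.torus] at h1
  have h2 := congrArg (fun f : L2 k K' => f 0) (smul_right_injective _ (h.z_ne_zero j) h1)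
  simpa only [δ_apply_self] using h2

theorem isIrreducibleRep (h : IsVacuumGenerated R idx coef g z ρ π)
    (hρ : IsIrreducibleRep ρ) : IsIrreducibleRep π := by
  have := hρ.1
  refine ⟨nontrivial_L2 k K, fun S hS hinv => ?_⟩
  have : CompleteSpace S := hS.completeSpace_coe
  set P := S.starProjection with hP
  have hPS : ∀ f, P f ∈ S := fun f => S.starProjection_apply_mem f
  have hPf : ∀ f, P f = f ↔ f ∈ S := fun f => S.starProjection_eq_self_iff
  have hcomm : ∀ b f, P (π b f) = π b (P f) := by
    intro b f
    have h1 : π b (f - P f) ∈ Sᗮ := by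
      rw [Submodule.mem_orthogonal']
      intro s hs
      rw [inner_rep]
      exact (Submodule.mem_orthogonal' _ _).1 (S.sub_starProjection_mem_orthogonal f) _
        (hinv _ _ hs)
    have h2 : P (π b (f - P f)) = 0 := S.starProjection_apply_eq_zero_iff.2 h1
    rw [map_sub, map_sub, sub_eq_zero, (hPf (π b (P f))).2 (hinv _ _ (hPS f))] at h2
    exact h2
  have hδ := intertwiner_apply h h hcomm
  have hidem : ∀ x, vac P (vac P x) = vac P x := fun x => by
    have h1 := (hPf (P (δ 0 x))).2 (hPS _)
    rw [hδ, hδ] at h1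
    simpa only [δ_apply_self] using congrArg (fun f : L2 k K => f 0) h1
  -- the fixed space of the projection induced on `K` is invariant under the torus
  have hcl : IsClosed
      ((LinearMap.eqLocus (vac P).toLinearMap LinearMap.id : Submodule ℂ K) : Set K) :=
    isClosed_eq (vac P).continuous continuous_id
  rcases hρ.2 (LinearMap.eqLocus (vac P).toLinearMap LinearMap.id) hcl (fun τ x hx => by
    have hx' : vac P x = x := hx
    change vac P (ρ τ x) = ρ τ x
    rw [vac_intertwine h h hcomm, hx']) with h0 | h0
  · left
    have hP0 : P = 0 := ext_δ fun n x => by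
      have h1 : vac P x ∈ (LinearMap.eqLocus (vac P).toLinearMap LinearMap.id : Submodule ℂ K) :=
        hidem x
      rw [h0, Submodule.mem_bot] at h1
      rw [hδ, h1, δ_zero, zero_apply]
    refine (Submodule.eq_bot_iff _).2 fun f hf => ?_
    rw [← (hPf f).2 hf, hP0, zero_apply]
  · right
    have hP1 : P = 1 := ext_δ fun n x => by
      have h1 : vac P x = x := show x ∈ (LinearMap.eqLocus (vac P).toLinearMap LinearMap.id :
        Submodule ℂ K) by rw [h0]; trivial
      rw [hδ, h1, one_apply_eq_self]
    refine (Submodule.eq_top_iff').2 fun f => ?_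
    rw [← hPf, hP1, one_apply_eq_self]

/-- A unitary equivalence of the representations generated from the vacuum restricts to a unitary
equivalence of the representations of the torus. -/
theorem isEquivalentRep (h : IsVacuumGenerated R idx coef g z ρ π)
    (h' : IsVacuumGenerated R idx coef g z ρ' π') (he : IsEquivalentRep π π') :
    IsEquivalentRep ρ ρ' := by
  obtain ⟨U, hU⟩ := he
  set T : L2 k K →L[ℂ] L2 k K' := U.toContinuousLinearEquiv.toContinuousLinearMap
  set T' : L2 k K' →L[ℂ] L2 k K := U.symm.toContinuousLinearEquiv.toContinuousLinearMap
  have hT : ∀ b f, T (π b f) = π' b (T f) := hU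
  have hT' : ∀ b f, T' (π' b f) = π b (T' f) := fun b f => by
    change U.symm _ = π b (U.symm f)
    rw [LinearIsometryEquiv.symm_apply_eq, hU, LinearIsometryEquiv.apply_symm_apply]
  have hδ := intertwiner_apply h h' hT
  have hδ' := intertwiner_apply h' h hT'
  have inv1 : ∀ x, vac T (vac T' x) = x := fun x => by
    have h1 : T (T' (δ 0 x)) = δ 0 x := U.apply_symm_apply _
    rw [hδ', hδ] at h1
    simpa only [δ_apply_self] using congrArg (fun f : L2 k K' => f 0) h1
  have inv2 : ∀ x, vac T' (vac T x) = x := fun x => by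
    have h1 : T' (T (δ 0 x)) = δ 0 x := U.symm_apply_apply _
    rw [hδ, hδ'] at h1
    simpa only [δ_apply_self] using congrArg (fun f : L2 k K => f 0) h1
  refine ⟨⟨LinearEquiv.ofLinearMap (vac T).toLinearMap (vac T').toLinearMap
    (LinearMap.ext inv1) (LinearMap.ext inv2), fun x => ?_⟩, fun τ x => ?_⟩
  · change ‖vac T x‖ = ‖x‖
    rw [← norm_δ (k := k) 0 (vac T x), ← hδ, ← norm_δ (k := k) 0 x]
    exact U.norm_map _
  · exact vac_intertwine h h' hT τ x

end IsVacuumGenerated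

end Intertwiner

/-! ### The five series are generated from the vacuum -/

section adjoint

variable {k : ℕ} {K : Type u} [NormedAddCommGroup K] [InnerProductSpace ℂ K] [CompleteSpace K]
  {B : L2 k K →L[ℂ] L2 k K} {c : (Fin k → ℕ) → ℂ}

/-- If `B` maps each `e_n ⊗ x` to a multiple of `e_{s n} ⊗ x`, then `B*` annihilates the vectors
`e_m ⊗ x` with `m` outside the range of `s`. -/
theorem star_apply_eq_zero {s : (Fin k → ℕ) → (Fin k → ℕ)}
    (hB : ∀ n x, B (δ n x) = c n • δ (s n) x) {m : Fin k → ℕ} (hs : ∀ n, s n ≠ m) (x : K) :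
    star B (δ m x) = 0 := by
  refine lp.ext (funext fun n => ext_inner_left ℂ fun y => ?_)
  rw [← inner_δ_left, ContinuousLinearMap.star_eq_adjoint, ContinuousLinearMap.adjoint_inner_right,
    hB, inner_smul_left, inner_δ_left, δ, lp.single_apply, Pi.single_eq_of_ne (hs n)]
  simp

/-- The adjoint of a weighted lowering operator is the weighted raising operator. -/
theorem star_lower {i : Fin k} (hB : ∀ n x, B (δ n x) = c n • δ (lower n i) x)
    (hc : ∀ n, n i = 0 → c n = 0) {n : Fin k → ℕ} (hn : n i ≠ 0) (x : K) :
    star B (δ (lower n i) x) = conj (c n) • δ n x := by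
  refine lp.ext (funext fun m => ext_inner_left ℂ fun y => ?_)
  rw [← inner_δ_left, ContinuousLinearMap.star_eq_adjoint, ContinuousLinearMap.adjoint_inner_right,
    hB, inner_smul_left, inner_δ_left, lp.coeFn_smul, Pi.smul_apply, inner_smul_right, δ, δ,
    lp.single_apply, lp.single_apply]
  by_cases hm : m = n
  · subst hm; simp
  · rw [Pi.single_eq_of_ne hm]
    by_cases h : lower m i = lower n i
    · have h0 : m i = 0 := by
        by_contra h0
        refine hm (funext fun j => ?_)
        have hj := congrFun h j
        by_cases hji : j = i
        · subst hji
          simp only [lower, Function.update_self] at hj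
          omega
        · simpa [lower, hji] using hj
      simp [hc m h0]
    · rw [Pi.single_eq_of_ne h]; simp

end adjoint

theorem lower_fin_one (n : ℕ) : lower ![n] 0 = ![n - 1] := update_fin_one _ _

theorem lower_fin_two (m n : ℕ) : lower ![m, n] 0 = ![m - 1, n] ∧ lower ![m, n] 1 = ![m, n - 1] :=
  ⟨(update_fin_two _ _ _).1, (update_fin_two _ _ _).2⟩

theorem lower_fin_three (m n l : ℕ) : lower ![m, n, l] 0 = ![m - 1, n, l] ∧
    lower ![m, n, l] 1 = ![m, n - 1, l] ∧ lower ![m, n, l] 2 = ![m, n, l - 1] :=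
  ⟨(update_fin_three _ _ _ _).1, (update_fin_three _ _ _ _).2.1, (update_fin_three _ _ _ _).2.2⟩

theorem exists_fin_one (n : Fin 1 → ℕ) : ∃ m, n = ![m] := ⟨n 0, by ext i; fin_cases i; rfl⟩

theorem exists_fin_two (n : Fin 2 → ℕ) : ∃ m l, n = ![m, l] :=
  ⟨n 0, n 1, by ext i; fin_cases i <;> rfl⟩

theorem exists_fin_three (n : Fin 3 → ℕ) : ∃ m l j, n = ![m, l, j] :=
  ⟨n 0, n 1, n 2, by ext i; fin_cases i <;> rfl⟩

namespace UqParam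

variable {p : UqParam} {K : Type u} [NormedAddCommGroup K] [InnerProductSpace ℂ K]
  [CompleteSpace K]

theorem r_ne_zero (hq : p.q < 1) {n : ℕ} (hn : n ≠ 0) : p.r n ≠ 0 := by
  obtain ⟨m, rfl⟩ := Nat.exists_eq_succ_of_ne_zero hn
  exact p.r_succ_ne_zero hq m

theorem isVacuumGenerated_s₁ (hq : p.q < 1) {ρ : NCTorus.{u} (p.torusParam .s₁) →⋆ₐ[ℂ] (K →L[ℂ] K)}
    {π : CU.{u} p →⋆ₐ[ℂ] (L2 1 K →L[ℂ] L2 1 K)} (h : p.IsPsiS₁ ρ π) :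
    IsVacuumGenerated ![star (p.V 0 0)] (fun _ => 0) (fun n => p.r (n 0))
      ![p.V 1 0, p.V 2 2, p.V 0 0 * p.V 1 1] ![1, 1, p.r 1 * p.r 1] ρ π := by
  have e0 : (0 : Fin 1 → ℕ) = ![0] := by ext i; fin_cases i; rfl
  constructor
  · intro i x
    fin_cases i
    simp [e0, h.a, r_zero]
  · intro n hn h0
    obtain ⟨n, rfl⟩ := exists_fin_one n
    exact hn (by simp_all)
  · intro n hn
    obtain ⟨n, rfl⟩ := exists_fin_one n
    exact r_ne_zero hq fun h0 => hn (by simp_all)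
  · intro n hn x
    have h1 := star_lower (B := π (p.V 0 0)) (c := fun n => p.r (n 0)) (i := 0) (fun n x => by
      obtain ⟨n, rfl⟩ := exists_fin_one n
      rw [h.a, lower_fin_one]; rfl) (fun n hn => by simp [hn, r_zero]) (n := n) (fun h0 => hn (by
        obtain ⟨n, rfl⟩ := exists_fin_one n
        simp_all)) x
    rw [← map_star] at h1
    simpa [conj_r] using h1
  · intro j
    have := r_ne_zero hq (n := 1) one_ne_zero
    fin_cases j <;> simp [this]
  · intro j x
    fin_cases j <;> simp [e0, h.d, h.k, h.a, h.e, smul_smul] <;> rfl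

theorem isVacuumGenerated_s₂ (hq : p.q < 1) {ρ : NCTorus.{u} (p.torusParam .s₂) →⋆ₐ[ℂ] (K →L[ℂ] K)}
    {π : CU.{u} p →⋆ₐ[ℂ] (L2 1 K →L[ℂ] L2 1 K)} (h : p.IsPsiS₂ ρ π) :
    IsVacuumGenerated ![star (p.V 1 1)] (fun _ => 0) (fun n => p.r (n 0))
      ![p.V 0 0, p.V 2 1, p.V 1 1 * p.V 2 2] ![1, 1, p.r 1 * p.r 1] ρ π := by
  have e0 : (0 : Fin 1 → ℕ) = ![0] := by ext i; fin_cases i; rfl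
  constructor
  · intro i x
    fin_cases i
    simp [e0, h.e, r_zero]
  · intro n hn h0
    obtain ⟨n, rfl⟩ := exists_fin_one n
    exact hn (by simp_all)
  · intro n hn
    obtain ⟨n, rfl⟩ := exists_fin_one n
    exact r_ne_zero hq fun h0 => hn (by simp_all)
  · intro n hn x
    have h1 := star_lower (B := π (p.V 1 1)) (c := fun n => p.r (n 0)) (i := 0) (fun n x => by
      obtain ⟨n, rfl⟩ := exists_fin_one n
      rw [h.e, lower_fin_one]; rfl) (fun n hn => by simp [hn, r_zero]) (n := n) (fun h0 => hn (by
        obtain ⟨n, rfl⟩ := exists_fin_one n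
        simp_all)) x
    rw [← map_star] at h1
    simpa [conj_r] using h1
  · intro j
    have := r_ne_zero hq (n := 1) one_ne_zero
    fin_cases j <;> simp [this]
  · intro j x
    fin_cases j <;> simp [e0, h.a, h.h, h.e, h.k, smul_smul] <;> rfl

/-- In the two series on `ℓ²(ℕ)^{⊗2} ⊗ K`, the operators `k = A* ⊗ 1 ⊗ 1` and `a* = 1 ⊗ A* ⊗ 1`
raise the two indices. -/
theorem isVacuumGenerated_two (hq : p.q < 1) {a : Fin 3 → ℂ} {ρ : NCTorus.{u} a →⋆ₐ[ℂ] (K →L[ℂ] K)}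
    {π : CU.{u} p →⋆ₐ[ℂ] (L2 2 K →L[ℂ] L2 2 K)}
    (ha : ∀ m n x, π (p.V 0 0) (δ ![m, n] x) = p.r n • δ ![m, n - 1] x)
    (hk : ∀ m n x, π (p.V 2 2) (δ ![m, n] x) = p.r (m + 1) • δ ![m + 1, n] x)
    {g : Fin 3 → CU.{u} p} {z : Fin 3 → ℂ} (hz : ∀ j, z j ≠ 0)
    (hg : ∀ j x, π (g j) (δ 0 x) = z j • δ 0 (ρ ((torusPresentation a).gen j) x)) :
    IsVacuumGenerated ![p.V 2 2, star (p.V 0 0)] (fun n => if n 1 = 0 then 0 else 1)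
      (fun n => if n 1 = 0 then p.r (n 0) else p.r (n 1)) g z ρ π := by
  have e0 : (0 : Fin 2 → ℕ) = ![0, 0] := by ext i; fin_cases i <;> rfl
  refine ⟨?_, ?_, ?_, ?_, hz, hg⟩
  · intro i x
    fin_cases i
    · have h1 := star_apply_eq_zero (B := π (p.V 2 2)) (c := fun n => p.r (n 0 + 1))
        (s := fun n => ![n 0 + 1, n 1]) (fun n x => by
          obtain ⟨m, n, rfl⟩ := exists_fin_two n
          exact hk m n x) (m := 0) (fun n h0 => by simpa using congrFun h0 0) x
      rw [← map_star] at h1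
      simpa using h1
    · simp [e0, ha, r_zero]
  · intro n hn
    obtain ⟨m, n, rfl⟩ := exists_fin_two n
    by_cases h0 : n = 0
    · simp_all
    · simp [h0]
  · intro n hn
    obtain ⟨m, n, rfl⟩ := exists_fin_two n
    by_cases h0 : n = 0
    · subst h0
      simpa using r_ne_zero hq fun h0 => hn (by simp_all)
    · simpa [h0] using r_ne_zero hq h0
  · intro n hn x
    obtain ⟨m, n, rfl⟩ := exists_fin_two n
    by_cases h0 : n = 0
    · subst h0
      have hm : m - 1 + 1 = m := Nat.sub_add_cancel
        (Nat.one_le_iff_ne_zero.2 fun h0 => hn (by simp_all))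
      simp [lower_fin_two, hk, hm]
    · have h1 := star_lower (B := π (p.V 0 0)) (c := fun n => p.r (n 1)) (i := 1) (fun n x => by
        obtain ⟨m, n, rfl⟩ := exists_fin_two n
        rw [ha, (lower_fin_two _ _).2]; rfl) (fun n hn => by simp [hn, r_zero]) (n := ![m, n])
        h0 x
      rw [← map_star] at h1
      simpa [h0, conj_r] using h1

theorem isVacuumGenerated_s₂s₁ (hq : p.q < 1)
    {ρ : NCTorus.{u} (p.torusParam .s₂s₁) →⋆ₐ[ℂ] (K →L[ℂ] K)}
    {π : CU.{u} p →⋆ₐ[ℂ] (L2 2 K →L[ℂ] L2 2 K)} (h : p.IsPsiS₂S₁ ρ π) :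
    IsVacuumGenerated ![p.V 2 2, star (p.V 0 0)] (fun n => if n 1 = 0 then 0 else 1)
      (fun n => if n 1 = 0 then p.r (n 0) else p.r (n 1))
      ![p.D, p.V 0 1, p.V 1 2] ![1, -p.q, -p.q] ρ π := by
  refine isVacuumGenerated_two hq h.a h.k ?_ ?_
  · intro j
    fin_cases j <;> simp [p.q_pos.ne']
  · have e0 : (0 : Fin 2 → ℕ) = ![0, 0] := by ext i; fin_cases i <;> rfl
    intro j x
    fin_cases j <;> simp [e0, h.D, h.b, h.f] <;> rfl

theorem isVacuumGenerated_s₁s₂ (hq : p.q < 1)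
    {ρ : NCTorus.{u} (p.torusParam .s₁s₂) →⋆ₐ[ℂ] (K →L[ℂ] K)}
    {π : CU.{u} p →⋆ₐ[ℂ] (L2 2 K →L[ℂ] L2 2 K)} (h : p.IsPsiS₁S₂ ρ π) :
    IsVacuumGenerated ![p.V 2 2, star (p.V 0 0)] (fun n => if n 1 = 0 then 0 else 1)
      (fun n => if n 1 = 0 then p.r (n 0) else p.r (n 1))
      ![p.V 1 0, p.V 2 1, p.D] ![1, 1, 1] ρ π := by
  refine isVacuumGenerated_two hq h.a h.k ?_ ?_
  · intro j
    fin_cases j <;> simp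
  · have e0 : (0 : Fin 2 → ℕ) = ![0, 0] := by ext i; fin_cases i <;> rfl
    intro j x
    fin_cases j <;> simp [e0, h.D, h.d, h.h] <;> rfl

/-- The operators `a`, `d` and `b` lower the second, first and third index. The weights of `d`
depend also on the second index and those of `b` on the first two, but `d` is only used once the
second index is `0`, and `b` once the first two are `0`, where these factors are `1` and `q`. -/
theorem isVacuumGenerated_s₂s₁s₂ (hq : p.q < 1)
    {ρ : NCTorus.{u} (p.torusParam .s₂s₁s₂) →⋆ₐ[ℂ] (K →L[ℂ] K)}
    {π : CU.{u} p →⋆ₐ[ℂ] (L2 3 K →L[ℂ] L2 3 K)} (h : p.IsPsiS₂S₁S₂ ρ π) :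
    IsVacuumGenerated ![star (p.V 1 0), star (p.V 0 0), star (p.V 0 1)]
      (fun n => if n 1 ≠ 0 then 1 else if n 0 ≠ 0 then 0 else 2)
      (fun n => if n 1 ≠ 0 then p.r (n 1) else if n 0 ≠ 0 then p.r (n 0) else p.q * p.r (n 2))
      ![p.D, p.V 0 2, p.V 2 0] ![1, p.q ^ 2, 1] ρ π := by
  have e0 : (0 : Fin 3 → ℕ) = ![0, 0, 0] := by ext i; fin_cases i <;> rfl
  constructor
  · intro i x
    fin_cases i <;> simp [e0, h.d, h.a, h.b, r_zero]
  · intro n hn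
    obtain ⟨m, n, l, rfl⟩ := exists_fin_three n
    by_cases h1 : n = 0 <;> by_cases h0 : m = 0 <;> simp_all
  · intro n hn
    obtain ⟨m, n, l, rfl⟩ := exists_fin_three n
    by_cases h1 : n = 0
    · by_cases h0 : m = 0
      · have := r_ne_zero hq (n := l) fun h2 => hn (by simp_all)
        simp [h1, h0, this, p.q_pos.ne']
      · simpa [h1, h0] using r_ne_zero hq h0
    · simpa [h1] using r_ne_zero hq h1
  · intro n hn x
    obtain ⟨m, n, l, rfl⟩ := exists_fin_three n
    by_cases h1 : n = 0
    · by_cases h0 : m = 0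
      · have h2 := star_lower (B := π (p.V 0 1)) (i := 2)
          (c := fun n => p.γ ^ (2 * n 0) * ((p.q : ℂ) ^ (n 1 + 1) * p.γ ^ n 1) * p.r (n 2))
          (fun n x => by
            obtain ⟨m, n, l, rfl⟩ := exists_fin_three n
            rw [h.b, (lower_fin_three _ _ _).2.2]; rfl) (fun n hn => by simp [hn, r_zero])
          (n := ![m, n, l]) (fun h2 => hn (by simp_all)) x
        rw [← map_star] at h2
        simpa [h1, h0, conj_r] using h2
      · have h2 := star_lower (B := π (p.V 1 0)) (i := 0)
          (c := fun n => p.r (n 0) * ((p.q : ℂ) ^ n 1 * conj p.γ ^ n 1))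
          (fun n x => by
            obtain ⟨m, n, l, rfl⟩ := exists_fin_three n
            rw [h.d, (lower_fin_three _ _ _).1]; rfl) (fun n hn => by simp [hn, r_zero])
          (n := ![m, n, l]) h0 x
        rw [← map_star] at h2
        simpa [h1, h0, conj_r] using h2
    · have h2 := star_lower (B := π (p.V 0 0)) (i := 1) (c := fun n => p.r (n 1))
          (fun n x => by
            obtain ⟨m, n, l, rfl⟩ := exists_fin_three n
            rw [h.a, (lower_fin_three _ _ _).2.1]; rfl) (fun n hn => by simp [hn, r_zero])
          (n := ![m, n, l]) h1 x
      rw [← map_star] at h2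
      simpa [h1, conj_r] using h2
  · intro j
    fin_cases j <;> simp [p.q_pos.ne']
  · intro j x
    fin_cases j <;> simp [e0, h.D, h.c, h.g, pow_two] <;> rfl

end UqParam

/-! ### The one-dimensional representations -/

namespace UqParam

variable (p : UqParam)

/-- In a commutative algebra, the diagonal matrices with unitary entries satisfy the relations. -/
theorem isUqTuple_diagonal {B : Type*} [CommCStarAlgebra B] {v : Fin 3 → B}
    (hv : ∀ i, star (v i) * v i = 1) :
    p.IsUqTuple (Matrix.diagonal v) (star (v 0 * v 1 * v 2)) := by
  have h0 := hv 0
  have h1 := hv 1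
  have h2 := hv 2
  have q0 := p.q_ne_zero
  have γ0 := p.θ_ne_zero 1 0
  have l0 := p.θ_ne_zero 2 0
  have ς0 := p.θ_ne_zero 2 1
  refine p.isUqTuple_of rfl rfl rfl rfl ?_ ?_ ?_ ?_ ?_ ?_ ?_ ?_
  · simp [forall_fin_three]
  · simp [forall_fin_three]
  · simp
  · simp [mul_comm]
  · simp
  · simp only [star_mul]
    constructor <;> linear_combination
      (star (v 1) * v 1 * (star (v 2) * v 2)) * h0 + (star (v 2) * v 2) * h1 + h2
  · simp only [forall_fin_three]
    simp [γ0, l0, ς0, mul_comm]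
  · have e0 : v 0 * v 1 * v 2 * star (v 0) = v 1 * v 2 := by linear_combination (v 1 * v 2) * h0
    have e1 : v 0 * v 1 * v 2 * star (v 1) = v 0 * v 2 := by linear_combination (v 0 * v 2) * h1
    have e2 : v 0 * v 1 * v 2 * star (v 2) = v 0 * v 1 := by linear_combination (v 0 * v 1) * h2
    simp [γ0, l0, ς0, q0, e0, e1, e2]

theorem exists_chi (μ : Fin 3 → Circle) : ∃ π : CU.{u} p →⋆ₐ[ℂ] (ℂ →L[ℂ] ℂ), p.IsChi μ π := by
  -- a copy of `ℂ` in the universe of the models of the presentation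
  let v : Fin 3 → PUnit.{u + 1} → ℂ :=
    ![fun _ => μ 0, fun _ => (μ 1 / μ 0 : Circle), fun _ => (μ 2 / μ 1 : Circle)]
  have hv : ∀ i, star (v i) * v i = 1 := by
    have key : ∀ z : Circle, conj (z : ℂ) * z = 1 := fun z => by
      rw [← Complex.normSq_eq_conj_mul_self, Circle.normSq_coe, Complex.ofReal_one]
    rw [forall_fin_three]
    refine ⟨funext fun _ => key (μ 0), funext fun _ => key (μ 1 / μ 0),
      funext fun _ => key (μ 2 / μ 1)⟩
  obtain ⟨φ, hφ, hD⟩ := p.exists_hom (p.isUqTuple_diagonal hv)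
  refine ⟨(StarAlgHom.ofId ℂ (ℂ →L[ℂ] ℂ)).comp ((Pi.evalStarAlgHom ℂ _ PUnit.unit).comp φ),
    ?_, ?_, ?_, ?_, fun i j hij => ?_⟩
  · simp [hφ, v, Algebra.algebraMap_eq_smul_one]
  · simp [hφ, v, Algebra.algebraMap_eq_smul_one]
  · simp [hφ, v, Algebra.algebraMap_eq_smul_one]
  · have h0 := Circle.coe_ne_zero (μ 0)
    have h1 := Circle.coe_ne_zero (μ 1)
    simp [hD, v, Algebra.algebraMap_eq_smul_one]
    field_simp
  · simp [hφ, Matrix.diagonal_apply_ne _ hij]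

variable {p}

theorem IsChi.eq {μ : Fin 3 → Circle} {π π' : CU.{u} p →⋆ₐ[ℂ] (ℂ →L[ℂ] ℂ)}
    (h : p.IsChi μ π) (h' : p.IsChi μ π') : π = π' := by
  refine p.hom_ext fun i j => ?_
  by_cases hij : i = j
  · subst hij
    fin_cases i
    exacts [h.a.trans h'.a.symm, h.e.trans h'.e.symm, h.k.trans h'.k.symm]
  · rw [h.off_diag i j hij, h'.off_diag i j hij]

theorem isIrreducibleRep_one_dim {A : Type*} [CStarAlgebra A] (π : A →⋆ₐ[ℂ] (ℂ →L[ℂ] ℂ)) :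
    IsIrreducibleRep π :=
  ⟨inferInstance, fun S _ _ => IsSimpleOrder.eq_bot_or_eq_top S⟩

theorem IsChi.eq_of_isEquivalentRep {μ μ' : Fin 3 → Circle} {π π' : CU.{u} p →⋆ₐ[ℂ] (ℂ →L[ℂ] ℂ)}
    (h : p.IsChi μ π) (h' : p.IsChi μ' π') (he : IsEquivalentRep π π') : μ = μ' := by
  obtain ⟨U, hU⟩ := he
  have h0 : U 1 ≠ 0 := fun h0 => one_ne_zero ((U.map_eq_zero_iff).1 h0)
  have key : ∀ {a : CU.{u} p} {s t : ℂ}, π a = s • 1 → π' a = t • 1 → s = t := by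
    intro a s t hs ht
    have h1 := hU a 1
    rw [hs, ht, smul_apply, smul_apply, one_apply_eq_self, one_apply_eq_self, map_smul] at h1
    exact smul_left_injective ℂ h0 h1
  have e0 := key h.a h'.a
  have e2 := key h.D h'.D
  have e1 := key h.e h'.e
  rw [e0] at e1
  have e1' := (div_left_inj' (Circle.coe_ne_zero (μ' 0))).1 e1
  exact funext (forall_fin_three.2 ⟨Circle.ext e0, Circle.ext e1', Circle.ext e2⟩)

/-! ### Uniqueness and separation of the series -/

section separate

variable {K : Type u} [NormedAddCommGroup K] [InnerProductSpace ℂ K] [CompleteSpace K]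

theorem IsPsi.eq {w : Series} {ρ : NCTorus.{u} (p.torusParam w) →⋆ₐ[ℂ] (K →L[ℂ] K)}
    {π π' : CU.{u} p →⋆ₐ[ℂ] (L2 w.length K →L[ℂ] L2 w.length K)}
    (h : p.IsPsi w ρ π) (h' : p.IsPsi w ρ π') : π = π' := by
  have ext_one : ∀ {B B' : L2 1 K →L[ℂ] L2 1 K}, (∀ n x, B (δ ![n] x) = B' (δ ![n] x)) → B = B' :=
    fun H => ext_δ fun n x => by obtain ⟨n, rfl⟩ := exists_fin_one n; exact H n x
  have ext_two : ∀ {B B' : L2 2 K →L[ℂ] L2 2 K},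
      (∀ m n x, B (δ ![m, n] x) = B' (δ ![m, n] x)) → B = B' :=
    fun H => ext_δ fun n x => by obtain ⟨m, n, rfl⟩ := exists_fin_two n; exact H m n x
  have ext_three : ∀ {B B' : L2 3 K →L[ℂ] L2 3 K},
      (∀ m n l x, B (δ ![m, n, l] x) = B' (δ ![m, n, l] x)) → B = B' :=
    fun H => ext_δ fun n x => by obtain ⟨m, n, l, rfl⟩ := exists_fin_three n; exact H m n l x
  refine p.hom_ext ?_
  simp only [forall_fin_three]
  cases w
  case s₁ =>
    obtain ⟨a, b, c, d, e, f, g, h, k, -⟩ := h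
    obtain ⟨a', b', c', d', e', f', g', h', k', -⟩ := h'
    refine ⟨⟨ext_one fun n x => ?_, ext_one fun n x => ?_, ?_⟩, ⟨ext_one fun n x => ?_,
      ext_one fun n x => ?_, ?_⟩, ?_, ?_, ext_one fun n x => ?_⟩
    exacts [(a n x).trans (a' n x).symm, (b n x).trans (b' n x).symm, c.trans c'.symm,
      (d n x).trans (d' n x).symm, (e n x).trans (e' n x).symm, f.trans f'.symm, g.trans g'.symm,
      h.trans h'.symm, (k n x).trans (k' n x).symm]
  case s₂ =>
    obtain ⟨a, b, c, d, e, f, g, h, k, -⟩ := h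
    obtain ⟨a', b', c', d', e', f', g', h', k', -⟩ := h'
    refine ⟨⟨ext_one fun n x => ?_, ?_, ?_⟩, ⟨?_, ext_one fun n x => ?_, ext_one fun n x => ?_⟩,
      ?_, ext_one fun n x => ?_, ext_one fun n x => ?_⟩
    exacts [(a n x).trans (a' n x).symm, b.trans b'.symm, c.trans c'.symm, d.trans d'.symm,
      (e n x).trans (e' n x).symm, (f n x).trans (f' n x).symm, g.trans g'.symm,
      (h n x).trans (h' n x).symm, (k n x).trans (k' n x).symm]
  case s₂s₁ =>
    obtain ⟨a, b, c, d, e, f, g, h, k, -⟩ := h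
    obtain ⟨a', b', c', d', e', f', g', h', k', -⟩ := h'
    refine ⟨⟨?_, ?_, c.trans c'.symm⟩, ⟨?_, ?_, ?_⟩, ?_, ?_, ?_⟩ <;> refine ext_two fun m n x => ?_
    exacts [(a m n x).trans (a' m n x).symm, (b m n x).trans (b' m n x).symm,
      (d m n x).trans (d' m n x).symm, (e m n x).trans (e' m n x).symm,
      (f m n x).trans (f' m n x).symm, (g m n x).trans (g' m n x).symm,
      (h m n x).trans (h' m n x).symm, (k m n x).trans (k' m n x).symm]
  case s₁s₂ =>
    obtain ⟨a, b, c, d, e, f, g, h, k, -⟩ := h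
    obtain ⟨a', b', c', d', e', f', g', h', k', -⟩ := h'
    refine ⟨⟨?_, ?_, ?_⟩, ⟨?_, ?_, ?_⟩, g.trans g'.symm, ?_, ?_⟩ <;> refine ext_two fun m n x => ?_
    exacts [(a m n x).trans (a' m n x).symm, (b m n x).trans (b' m n x).symm,
      (c m n x).trans (c' m n x).symm, (d m n x).trans (d' m n x).symm,
      (e m n x).trans (e' m n x).symm, (f m n x).trans (f' m n x).symm,
      (h m n x).trans (h' m n x).symm, (k m n x).trans (k' m n x).symm]
  case s₂s₁s₂ =>
    obtain ⟨a, b, c, d, e, f, g, h, k, -⟩ := h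
    obtain ⟨a', b', c', d', e', f', g', h', k', -⟩ := h'
    refine ⟨⟨?_, ?_, ?_⟩, ⟨?_, ?_, ?_⟩, ?_, ?_, ?_⟩ <;> refine ext_three fun m n l x => ?_
    exacts [(a m n l x).trans (a' m n l x).symm, (b m n l x).trans (b' m n l x).symm,
      (c m n l x).trans (c' m n l x).symm, (d m n l x).trans (d' m n l x).symm,
      (e m n l x).trans (e' m n l x).symm, (f m n l x).trans (f' m n l x).symm,
      (g m n l x).trans (g' m n l x).symm, (h m n l x).trans (h' m n l x).symm,
      (k m n l x).trans (k' m n l x).symm]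

/-- An operator that maps `e_n ⊗ x` to a nonzero multiple of `e_m ⊗ ρ(τ)x`, with `τ` unitary, is
nonzero. -/
theorem ne_zero_of_apply_δ [Nontrivial K] {a : Fin 3 → ℂ} (ρ : NCTorus.{u} a →⋆ₐ[ℂ] (K →L[ℂ] K))
    {k : ℕ} {B : L2 k K →L[ℂ] L2 k K} {n m : Fin k → ℕ} {c : ℂ} {τ : NCTorus.{u} a}
    (hτ : τ ∈ unitary (NCTorus.{u} a)) (hc : c ≠ 0)
    (hB : ∀ x, B (δ n x) = c • δ m (ρ τ x)) : B ≠ 0 := by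
  rintro rfl
  obtain ⟨x, hx⟩ := exists_ne (0 : K)
  refine smul_ne_zero hc (δ_ne_zero m fun h0 => hx ?_) (hB x).symm
  rw [← one_apply_eq_self (F := K →L[ℂ] K) x, ← map_one ρ, ← (Unitary.mem_iff.1 hτ).1, map_mul,
    mul_apply_eq_comp, h0, map_zero]

/-- The vanishing of the entries `g, c, d` distinguishes the five series, and `h` distinguishes
`ψ_{s₂}` from the one-dimensional representations. -/
theorem IsPsi.vanishing (hq : p.q < 1) [Nontrivial K] {w : Series}
    {ρ : NCTorus.{u} (p.torusParam w) →⋆ₐ[ℂ] (K →L[ℂ] K)}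
    {π : CU.{u} p →⋆ₐ[ℂ] (L2 w.length K →L[ℂ] L2 w.length K)} (h : p.IsPsi w ρ π) :
    (π (p.V 2 0) = 0 ↔ w = .s₁ ∨ w = .s₂ ∨ w = .s₁s₂) ∧
    (π (p.V 0 2) = 0 ↔ w = .s₁ ∨ w = .s₂ ∨ w = .s₂s₁) ∧
    (π (p.V 1 0) = 0 ↔ w = .s₂) ∧ (w = .s₂ → π (p.V 2 1) ≠ 0) := by
  have hg : ∀ {a : Fin 3 → ℂ} (i : Fin 3), (torusPresentation.{u} a).gen i ∈
    unitary (NCTorus.{u} a) := fun i => Unitary.mem_iff.2 (NCTorus.gen_unitary i)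
  have hW : ∀ {a}, NCTorus.W ∈ unitary (NCTorus.{u} a) := hg 0
  have hX : ∀ {a}, NCTorus.X ∈ unitary (NCTorus.{u} a) := hg 1
  have hY : ∀ {a}, NCTorus.Y ∈ unitary (NCTorus.{u} a) := hg 2
  have q0 := p.q_ne_zero
  have γ0 := p.θ_ne_zero 1 0
  have l0 := p.θ_ne_zero 2 0
  have ς0 := p.θ_ne_zero 2 1
  have r1 := r_ne_zero hq one_ne_zero
  cases w
  case s₁ =>
    have hd := ne_zero_of_apply_δ ρ hW (by simp) (h.d 0)
    simpa using ⟨h.g, h.c, hd⟩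
  case s₂ =>
    have hh := ne_zero_of_apply_δ ρ hX (by simp) (h.h 0)
    simpa using ⟨h.g, h.c, h.d, hh⟩
  case s₂s₁ =>
    have hd := ne_zero_of_apply_δ ρ (mul_mem hW (Unitary.star_mem hX))
      (by simp [r1, γ0, l0, ς0]) (h.d 1 0)
    have hg := ne_zero_of_apply_δ ρ (mul_mem (mul_mem hW (Unitary.star_mem hX))
      (Unitary.star_mem hY)) (by simp [γ0, l0]) (h.g 0 0)
    simpa using ⟨hg, h.c, hd⟩
  case s₁s₂ =>
    have hd := ne_zero_of_apply_δ ρ hW (by simp) (h.d 0 0)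
    have hc := ne_zero_of_apply_δ ρ (mul_mem (mul_mem (Unitary.star_mem hW) (Unitary.star_mem hX))
      hY) (by simp [l0, ς0, q0]) (h.c 0 0)
    simpa using ⟨h.g, hc, hd⟩
  case s₂s₁s₂ =>
    have hd := ne_zero_of_apply_δ ρ (one_mem _) (c := p.r 1) r1
      (fun x => by simpa using h.d 1 0 0 x)
    have hc := ne_zero_of_apply_δ ρ hX (by simp [q0]) (h.c 0 0 0)
    have hg := ne_zero_of_apply_δ ρ hY (by simp) (h.g 0 0 0)
    simpa using ⟨hg, hc, hd⟩

end separate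

end UqParam

theorem IsEquivalentRep.apply_eq_zero_iff {A : Type*} [CStarAlgebra A]
    {H : Type*} [NormedAddCommGroup H] [InnerProductSpace ℂ H] [CompleteSpace H]
    {H' : Type*} [NormedAddCommGroup H'] [InnerProductSpace ℂ H'] [CompleteSpace H']
    {π : A →⋆ₐ[ℂ] (H →L[ℂ] H)} {π' : A →⋆ₐ[ℂ] (H' →L[ℂ] H')} (he : IsEquivalentRep π π') (a : A) :
    π a = 0 ↔ π' a = 0 := by
  obtain ⟨U, hU⟩ := he
  constructor <;> intro h <;> ext x
  · obtain ⟨y, rfl⟩ := U.surjective x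
    rw [← hU, h, zero_apply, map_zero, zero_apply]
  · refine U.injective ?_
    rw [hU, h, zero_apply, zero_apply, map_zero]

theorem mainTheorem2 (p : UqParam) (hq : p.q < 1) :
    (∀ μ : Fin 3 → Circle,
      (∃! π : UqParam.CU.{u} p →⋆ₐ[ℂ] (ℂ →L[ℂ] ℂ), p.IsChi μ π) ∧
      ∀ π : UqParam.CU.{u} p →⋆ₐ[ℂ] (ℂ →L[ℂ] ℂ), p.IsChi μ π → IsIrreducibleRep π) ∧
    (∀ (w : Series) (K : Type u) [NormedAddCommGroup K] [InnerProductSpace ℂ K] [CompleteSpace K]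
      (ρ : NCTorus.{u} (p.torusParam w) →⋆ₐ[ℂ] (K →L[ℂ] K)), IsIrreducibleRep ρ →
      (∃! π : UqParam.CU.{u} p →⋆ₐ[ℂ] (L2 w.length K →L[ℂ] L2 w.length K), p.IsPsi w ρ π) ∧
      ∀ π : UqParam.CU.{u} p →⋆ₐ[ℂ] (L2 w.length K →L[ℂ] L2 w.length K),
        p.IsPsi w ρ π → IsIrreducibleRep π) ∧
    (∀ (μ μ' : Fin 3 → Circle) (π π' : UqParam.CU.{u} p →⋆ₐ[ℂ] (ℂ →L[ℂ] ℂ)),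
      p.IsChi μ π → p.IsChi μ' π' → μ ≠ μ' → ¬ IsEquivalentRep π π') ∧
    (∀ (μ : Fin 3 → Circle) (π : UqParam.CU.{u} p →⋆ₐ[ℂ] (ℂ →L[ℂ] ℂ))
      (w : Series) (K : Type u) [NormedAddCommGroup K] [InnerProductSpace ℂ K] [CompleteSpace K]
      (ρ : NCTorus.{u} (p.torusParam w) →⋆ₐ[ℂ] (K →L[ℂ] K))
      (π' : UqParam.CU.{u} p →⋆ₐ[ℂ] (L2 w.length K →L[ℂ] L2 w.length K)),
      p.IsChi μ π → IsIrreducibleRep ρ → p.IsPsi w ρ π' → ¬ IsEquivalentRep π π') ∧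
    (∀ (w w' : Series)
      (K : Type u) [NormedAddCommGroup K] [InnerProductSpace ℂ K] [CompleteSpace K]
      (K' : Type u) [NormedAddCommGroup K'] [InnerProductSpace ℂ K'] [CompleteSpace K']
      (ρ : NCTorus.{u} (p.torusParam w) →⋆ₐ[ℂ] (K →L[ℂ] K))
      (ρ' : NCTorus.{u} (p.torusParam w') →⋆ₐ[ℂ] (K' →L[ℂ] K'))
      (π : UqParam.CU.{u} p →⋆ₐ[ℂ] (L2 w.length K →L[ℂ] L2 w.length K))
      (π' : UqParam.CU.{u} p →⋆ₐ[ℂ] (L2 w'.length K' →L[ℂ] L2 w'.length K')),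
      IsIrreducibleRep ρ → IsIrreducibleRep ρ' → p.IsPsi w ρ π → p.IsPsi w' ρ' π' →
      w ≠ w' → ¬ IsEquivalentRep π π') ∧
    (∀ (w : Series)
      (K : Type u) [NormedAddCommGroup K] [InnerProductSpace ℂ K] [CompleteSpace K]
      (K' : Type u) [NormedAddCommGroup K'] [InnerProductSpace ℂ K'] [CompleteSpace K']
      (ρ : NCTorus.{u} (p.torusParam w) →⋆ₐ[ℂ] (K →L[ℂ] K))
      (ρ' : NCTorus.{u} (p.torusParam w) →⋆ₐ[ℂ] (K' →L[ℂ] K'))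
      (π : UqParam.CU.{u} p →⋆ₐ[ℂ] (L2 w.length K →L[ℂ] L2 w.length K))
      (π' : UqParam.CU.{u} p →⋆ₐ[ℂ] (L2 w.length K' →L[ℂ] L2 w.length K')),
      IsIrreducibleRep ρ → IsIrreducibleRep ρ' → p.IsPsi w ρ π → p.IsPsi w ρ' π' →
      ¬ IsEquivalentRep ρ ρ' → ¬ IsEquivalentRep π π') := by
  refine ⟨fun μ => ?_, fun w K _ _ _ ρ hρ => ?_, fun μ μ' π π' h h' hμ he => ?_,
    fun μ π w K _ _ _ ρ π' h hρ h' he => ?_,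
    fun w w' K _ _ _ K' _ _ _ ρ ρ' π π' hρ hρ' h h' hw he => ?_,
    fun w K _ _ _ K' _ _ _ ρ ρ' π π' hρ hρ' h h' hne he => hne ?_⟩
  · obtain ⟨π, h⟩ := p.exists_chi μ
    exact ⟨⟨π, h, fun π' h' => h'.eq h⟩, fun π' _ => UqParam.isIrreducibleRep_one_dim π'⟩
  · have := hρ.1
    constructor
    · obtain ⟨π, h⟩ : ∃ π : UqParam.CU.{u} p →⋆ₐ[ℂ] (L2 w.length K →L[ℂ] L2 w.length K),
          p.IsPsi w ρ π := by
        cases w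
        exacts [p.exists_PsiS₁ hq ρ, p.exists_PsiS₂ hq ρ, p.exists_PsiS₂S₁ hq ρ,
          p.exists_PsiS₁S₂ hq ρ, p.exists_PsiS₂S₁S₂ hq ρ]
      exact ⟨π, h, fun π' h' => h'.eq h⟩
    · intro π h
      cases w
      exacts [(UqParam.isVacuumGenerated_s₁ hq h).isIrreducibleRep hρ,
        (UqParam.isVacuumGenerated_s₂ hq h).isIrreducibleRep hρ,
        (UqParam.isVacuumGenerated_s₂s₁ hq h).isIrreducibleRep hρ,
        (UqParam.isVacuumGenerated_s₁s₂ hq h).isIrreducibleRep hρ,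
        (UqParam.isVacuumGenerated_s₂s₁s₂ hq h).isIrreducibleRep hρ]
  · exact hμ (h.eq_of_isEquivalentRep h' he)
  · have := hρ.1
    obtain ⟨-, -, hd, hh⟩ := h'.vanishing hq
    have hs := hd.1 ((he.apply_eq_zero_iff _).1 (h.off_diag 1 0 (by decide)))
    exact hh hs ((he.apply_eq_zero_iff _).1 (h.off_diag 2 1 (by decide)))
  · have := hρ.1
    have := hρ'.1
    obtain ⟨hg, hc, hd, -⟩ := h.vanishing hq
    obtain ⟨hg', hc', hd', -⟩ := h'.vanishing hq
    rw [he.apply_eq_zero_iff, hg'] at hg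
    rw [he.apply_eq_zero_iff, hc'] at hc
    rw [he.apply_eq_zero_iff, hd'] at hd
    clear * - hg hc hd hw
    cases w <;> cases w' <;> simp at hg hc hd hw
  · cases w
    exacts [(UqParam.isVacuumGenerated_s₁ hq h).isEquivalentRep
        (UqParam.isVacuumGenerated_s₁ hq h') he,
      (UqParam.isVacuumGenerated_s₂ hq h).isEquivalentRep
        (UqParam.isVacuumGenerated_s₂ hq h') he,
      (UqParam.isVacuumGenerated_s₂s₁ hq h).isEquivalentRep
        (UqParam.isVacuumGenerated_s₂s₁ hq h') he,
      (UqParam.isVacuumGenerated_s₁s₂ hq h).isEquivalentRep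
        (UqParam.isVacuumGenerated_s₁s₂ hq h') he,
      (UqParam.isVacuumGenerated_s₂s₁s₂ hq h).isEquivalentRep
        (UqParam.isVacuumGenerated_s₂s₁s₂ hq h') he]
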